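/- **Setting.** Let $d\ge 3$, $\Omega=(0,1)^d$, $h=\frac1{N+1}$ with $N\in\mathbb N$, $\mathcal K_h=h\{0,\dots,N+1\}^d$, $\Omega_h=\Omega\cap\mathcal K_h$, $\partial\Omega_h=\partial\Omega\cap\mathcal K_h$ and $\overline\Omega_h=\mathcal K_h$. For $\mathcal W\subset\mathbb R^d$ put $\mathcal W^*_{h,k}=\{x\pm\frac h2e_k: x\in\mathcal W\}$, $\overline{\mathcal W}_{h,k}=(\mathcal W^*_{h,k})^*_{h,k}$ and $\partial_k\mathcal W=\overline{\mathcal W}_{h,k}\setminus\mathcal W$. Let $$D_ku(x)=\frac{u(x+\frac h2e_k)-u(x-\frac h2e_k)}{h},\qquad A_ku(x)=\frac{u(x+\frac h2e_k)+u(x-\frac h2e_k)}{2}.$$ For $x\in\partial_k\Omega_h$ let $n_k(x)=1$ if $x-\frac h2e_k\in\Omega^*_{h,k}$ and $x+\frac h2e_k\notin\Omega^*_{h,k}$, and $n_k(x)=-1$ if $x-\frac h2e_k\notin\Omega^*_{h,k}$ and $x+\frac h2e_k\in\Omega^*_{h,k}$; let $n_k=0$ outside $\partial_k\Omega_h$.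 The trace is $t_r^k(v)(x)=v(x-n_k(x)\frac h2e_k)$ for $x\in\partial_k\Omega_h$. Integrals are $\int_{\mathcal W}u=h^d\sum_{x\in\mathcal W}u(x)$ over meshes and $\int_{\Gamma}u=h^{d-1}\sum_{x\in\Gamma}u(x)$ over sets $\Gamma$ of boundary points; $\|u\|^2_{L^2_h(\mathcal W)}=\int_{\mathcal W}|u|^2$ and $\|u\|_{L^\infty_h(\mathcal W)}=\max_{\mathcal W}|u|$. Let $\widetilde\Omega$ be an open neighbourhood of $\overline\Omega$, and let $\sigma^1,\dots,\sigma^d$ be positive continuous functions on $\widetilde\Omega$, not depending on $h$ and sampled on the meshes. Put $$\Delta_hu=\sum_{k=1}^dD_k(\sigma^kD_ku)\ \text{ in }\Omega_h,\qquad \partial_nu=\sum_{k=1}^dt_r^k(\sigma^kD_ku)\,n_k .$$ Assume that, for all sufficiently small $h$, $\sum_k\|\sigma^k\|_{L^\infty_h((\overline\Omega_h)^*_{h,k})}$ is bounded by a constant independent of $h$ and $$\sum_{k,j}\|D_j\sigma^k\|_{L^\infty_h(\overline\Omega_{h,k})}<1,\qquad \sum_{k,j}\|A_j\sigma^k-1\|_{L^\infty_h(\overline\Omega_{h,k})}<1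 .$$ Let $\psi\in C^\infty(\widetilde\Omega)$ with $\psi>0$ and $|\nabla\psi|>0$ in $\widetilde\Omega$, and for $\lambda\ge1$ put $\varphi=e^{-\lambda\psi}$. **Proposition (discrete Carleman estimate).** There is $\lambda_0\ge1$ such that for each $\lambda\ge\lambda_0$ there exist $s_0=s_0(\lambda)\ge1$, $0<h_0<1$ and $\varepsilon_0>0$ such that for every $M$ there is a constant $C>0$, independent of $h$, with $$s^3\|e^{s\varphi}u\|^2_{L^2_h(\Omega_h)}+s\sum_{k=1}^d\int_{\Omega^*_{h,k}}e^{2s\varphi}|D_ku|^2\le C\Big(\|e^{s\varphi}(-\Delta_h+q)u\|^2_{L^2_h(\Omega_h)}+s\sum_{k=1}^d\int_{\partial_k\Omega_h}t_r^k(e^{2s\varphi})|\partial_nu|^2\Big)$$ for all $h=\frac1{N+1}\le h_0$, all $s\ge s_0$ with $sh\le\varepsilon_0$, all $q:\Omega_h\to\mathbb R$ with $\|q\|_{L^\infty_h(\Omega_h)}\le M$, and all $u:\overline\Omega_h\to\mathbb R$ with $u=0$ on $\partial\Omega_h$. -/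

import Mathlib

noncomputable section

namespace DiscreteCarleman

/-- Points of `ℝ^d`. A discrete function on a mesh `W ⊆ ℝ^d` is represented by a function
`Pt d → ℝ` of which only the values on `W` are used. -/
abbrev Pt (d : ℕ) : Type := EuclideanSpace ℝ (Fin d)

/-- The open unit cube `Ω = (0,1)^d`. -/
def cube (d : ℕ) : Set (Pt d) := {x | ∀ i, 0 < x i ∧ x i < 1}

/-- The mesh size `h = 1 / (N + 1)`. -/
def meshSize (N : ℕ) : ℝ := 1 / ((N : ℝ) + 1)

/-- The Cartesian grid `𝒦_h = h ⟦0, N+1⟧^d` of `[0,1]^d`; it is also the closed mesh `Ω̄_h`. -/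
def grid (d N : ℕ) : Set (Pt d) :=
  {x | ∃ m : Fin d → ℕ, (∀ i, m i ≤ N + 1) ∧ ∀ i, x i = meshSize N * (m i : ℝ)}

/-- `Ω_h = Ω ∩ 𝒦_h`. -/
def innerMesh (d N : ℕ) : Set (Pt d) := cube d ∩ grid d N

/-- `∂Ω_h = ∂Ω ∩ 𝒦_h`. -/
def boundaryMesh (d N : ℕ) : Set (Pt d) := frontier (cube d) ∩ grid d N

variable {d : ℕ}

/-- `x + (h/2) e_k`. -/
def shiftPos (h : ℝ) (k : Fin d) (x : Pt d) : Pt d := x + (h / 2) • EuclideanSpace.single k (1 : ℝ)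

/-- `x - (h/2) e_k`. -/
def shiftNeg (h : ℝ) (k : Fin d) (x : Pt d) : Pt d := x - (h / 2) • EuclideanSpace.single k (1 : ℝ)

/-- The dual mesh `W*_{h,k} = τ_k(W) ∪ τ_{-k}(W)`. -/
def dualMesh (h : ℝ) (k : Fin d) (W : Set (Pt d)) : Set (Pt d) :=
  shiftPos h k '' W ∪ shiftNeg h k '' W

/-- `W̄_{h,k} = (W*_{h,k})*_{h,k}`. -/
def closedMesh (h : ℝ) (k : Fin d) (W : Set (Pt d)) : Set (Pt d) := dualMesh h k (dualMesh h k W)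

/-- The boundary points in the direction `e_k`: `∂_k W = W̄_{h,k} \ W`. -/
def dirBoundary (h : ℝ) (k : Fin d) (W : Set (Pt d)) : Set (Pt d) := closedMesh h k W \ W

/-- The difference operator `D_k`. -/
def diffOp (h : ℝ) (k : Fin d) (u : Pt d → ℝ) (x : Pt d) : ℝ :=
  (u (shiftPos h k x) - u (shiftNeg h k x)) / h

/-- The average operator `A_k`. -/
def avgOp (h : ℝ) (k : Fin d) (u : Pt d → ℝ) (x : Pt d) : ℝ :=
  (u (shiftPos h k x) + u (shiftNeg h k x)) / 2

open Classical in
/-- The outward normal `n_k` on `∂_k W`, extended by `0` outside `∂_k W`. -/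
def normal (h : ℝ) (k : Fin d) (W : Set (Pt d)) (x : Pt d) : ℝ :=
  if x ∈ dirBoundary h k W ∧ shiftNeg h k x ∈ dualMesh h k W ∧ shiftPos h k x ∉ dualMesh h k W
  then 1
  else if x ∈ dirBoundary h k W ∧ shiftNeg h k x ∉ dualMesh h k W ∧ shiftPos h k x ∈ dualMesh h k W
  then -1
  else 0

open Classical in
/-- The trace operator `t_r^k` in the direction `e_k` on `∂_k W`. -/
def traceOp (h : ℝ) (k : Fin d) (W : Set (Pt d)) (u : Pt d → ℝ) (x : Pt d) : ℝ :=
  if normal h k W x = 1 then u (shiftNeg h k x)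
  else if normal h k W x = -1 then u (shiftPos h k x)
  else 0

/-- `Δ_h u = ∑_k D_k (σ^k D_k u)`. -/
def discreteLaplacian (h : ℝ) (σ : Fin d → Pt d → ℝ) (u : Pt d → ℝ) (x : Pt d) : ℝ :=
  ∑ k, diffOp h k (fun y => σ k y * diffOp h k u y) x

/-- `∂_n u = ∑_k t_r^k (σ^k D_k u) n_k`. -/
def normalDeriv (h : ℝ) (σ : Fin d → Pt d → ℝ) (W : Set (Pt d)) (u : Pt d → ℝ) (x : Pt d) : ℝ :=
  ∑ k, traceOp h k W (fun y => σ k y * diffOp h k u y) x * normal h k W x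

/-- The discrete integral `h^d ∑_{x ∈ W} u(x)` over a finite mesh. -/
def meshIntegral (h : ℝ) (W : Set (Pt d)) (u : Pt d → ℝ) : ℝ := h ^ d * ∑ᶠ x ∈ W, u x

/-- The discrete boundary integral `h^{d-1} ∑_{x ∈ Γ} u(x)` over a finite set. -/
def boundaryIntegral (h : ℝ) (Γ : Set (Pt d)) (u : Pt d → ℝ) : ℝ := h ^ (d - 1) * ∑ᶠ x ∈ Γ, u x

/-- The `L²_h(W)` norm. -/
def l2Norm (h : ℝ) (W : Set (Pt d)) (u : Pt d → ℝ) : ℝ :=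
  Real.sqrt (meshIntegral h W fun x => u x * u x)

/-- The `L^∞_h(W)` norm, for a finite mesh `W`. -/
def linftyNorm (W : Set (Pt d)) (u : Pt d → ℝ) : ℝ := ⨆ x : W, |u x|

/-- `ε_d(h) = ∑_{k,j} ‖D_j σ^k‖_{L^∞(Ω̄_{h,k})}`. -/
def epsDiff (σ : Fin d → Pt d → ℝ) (N : ℕ) : ℝ :=
  ∑ k, ∑ j, linftyNorm (closedMesh (meshSize N) k (innerMesh d N)) (diffOp (meshSize N) j (σ k))

/-- `ε_a(h) = ∑_{k,j} ‖A_j σ^k - 1‖_{L^∞(Ω̄_{h,k})}`. -/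
def epsAvg (σ : Fin d → Pt d → ℝ) (N : ℕ) : ℝ :=
  ∑ k, ∑ j, linftyNorm (closedMesh (meshSize N) k (innerMesh d N))
    (fun x => avgOp (meshSize N) j (σ k) x - 1)

/-- `M(h) = ∑_k ‖σ^k‖_{L^∞((Ω̄_h)*_k)}`. -/
def coeffBound (σ : Fin d → Pt d → ℝ) (N : ℕ) : ℝ :=
  ∑ k, linftyNorm (dualMesh (meshSize N) k (grid d N)) (σ k)

/-- The mesh assumption on the coefficients: as `h → 0`, `M(h)` stays bounded and
`ε_d(h), ε_a(h) < 1`. -/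
def MeshAssumption (σ : Fin d → Pt d → ℝ) : Prop :=
  (∃ M₀ : ℝ, ∀ᶠ N in Filter.atTop, coeffBound σ N ≤ M₀) ∧
    (∀ᶠ N in Filter.atTop, epsDiff σ N < 1) ∧ (∀ᶠ N in Filter.atTop, epsAvg σ N < 1)

/-- The function `φ = e^{-λψ}`. -/
def phi (lam : ℝ) (ψ : Pt d → ℝ) (x : Pt d) : ℝ := Real.exp (-lam * ψ x)

end DiscreteCarleman

end

noncomputable section

namespace DiscreteCarleman

variable {d : ℕ}

/-! The estimate is proved on `ℤ^d` for functions supported in a finite set `D`, by conjugating with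
the weight. With `v = e^{sφ} u`, the operator `e^{sφ} Δ_h e^{-sφ}` equals `S - Y` up to a zeroth
order term of size `s` (`Phase.conjugation`). Here `S` is `symPart`, a divergence form operator plus
a potential of size `s²`. `Y` is `multPart`, a transport operator of size `s` plus a free multiplier
`G v`. Since `-4 S Y ≤ (S - Y)²`, it suffices to bound `-2 ∑ S Y` from below.

That sum is computed exactly by discrete integration by parts (`sum_symPart_mul_multPart`). Put `Φ =
λφ` and `γ = ∑ a_k b_k²`, where `a` is the diffusion and `b` the gradient of the phase `β = -ψ`. To
leading order the sum is a quadratic form with density `s λΦγ |∇v|²_a` and `s³ λΦ³γ² v²`, plus a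
nonnegative square. If `G ≈ c s λΦγ`, the two coefficients are `2c - 2` and `6 - 2c`. The choice `c
= 2` makes both positive (`quadratic_form_lower`).

Two kinds of error occur. Some are bounded by `C Φ^i` with `C` independent of `λ`; they lack the
extra factor `λ` of the main terms and are absorbed by large `λ`. The others are bounded by `K(λ) ε`
with `ε = sh + 1/s`, and are absorbed by small `sh` and large `s` once `λ` is fixed. The classes
`Gr` and `Neg` record these two kinds, and `Phase.exists_coeffBounds` verifies the resulting bounds
for the actual coefficients. Outside `D` the product `S Y` is not controlled by the equation, but `v
= 0` there, so it is bounded by `s/h` times squared differences on the adjacent edges. This is the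
boundary term (`Phase.lattice_carleman`).

The thresholds `s₀`, `h₀`, `ε₀` must not depend on the bound `M` for the potential, although
absorbing `q` needs `s ≥ s₁(M)`. For `s₀ ≤ s < s₁`, either `s₁ h ≤ ε₀`, and the estimate at `s₁` is
transferred to `s` at the cost of powers of `e^{s₁}`; or `s₁ h > ε₀`, which leaves finitely many
meshes. On each of those, unique continuation layer by layer (`Phase.layer_bound`) gives a finite
constant. See `Phase.lattice_carleman_potential`.

The coefficients are only assumed continuous, but the bound on their difference quotients on all
fine meshes makes them Lipschitz along coordinate lines of the cube (`lipschitz_of_meshAssumption`),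
which is the regularity used above. `exists_phase` extends `-ψ` and the coefficients to the whole
space, and the `transfer` lemmas identify mesh integrals with lattice sums. -/

/-- The lattice `ℤ^d` indexing mesh points. -/
abbrev Lat (d : ℕ) : Type := Fin d → ℤ

/-- The lattice unit vector `e_k`. -/
def ev (k : Fin d) : Lat d := Pi.single k 1

/-- Forward difference quotient on the lattice. -/
def fd (h : ℝ) (k : Fin d) (f : Lat d → ℝ) (x : Lat d) : ℝ := (f (x + ev k) - f x) / h

/-! ### Finite lattice sums and their translation invariance. -/

/-- `H` vanishes at every point in whose `2`-neighbourhood `v` vanishes. -/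
def LocalTo (v H : Lat d → ℝ) : Prop :=
  ∀ x, (∀ z : Lat d, (∀ i, |z i| ≤ 2) → v (x + z) = 0) → H x = 0

/-- The `3`-neighbourhood of a finite set of lattice points. -/
def fatten (D : Finset (Lat d)) : Finset (Lat d) :=
  (D ×ˢ Finset.Icc (fun _ => (-3 : ℤ)) (fun _ => 3)).image fun p => p.1 + p.2

lemma mem_fatten {D : Finset (Lat d)} {x z : Lat d} (hx : x + z ∈ D) (hz : ∀ i, |z i| ≤ 3) :
    x ∈ fatten D := by
  refine Finset.mem_image.2 ⟨(x + z, -z), ?_, by simp⟩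
  simp only [Finset.mem_product, Finset.mem_Icc, Pi.le_def, Pi.neg_apply]
  exact ⟨hx, fun i => by have := abs_le.1 (hz i); omega, fun i => by have := abs_le.1 (hz i); omega⟩

lemma subset_fatten (D : Finset (Lat d)) : D ⊆ fatten D := fun x hx =>
  mem_fatten (z := 0) (by simpa using hx) (by simp)

/-- The support of `H` lies within distance `2` of `D`, so a shift by at most `1` stays within the
radius `3` of `fatten D`. Both sums are therefore full sums over the lattice. This replaces all
boundary terms in the integrations by parts. -/
lemma sum_shift {v H : Lat d → ℝ} {D : Finset (Lat d)} (hv : ∀ x, x ∉ D → v x = 0)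
    (hH : LocalTo v H) (z : Lat d) (hz : ∀ i, |z i| ≤ 1) :
    ∑ x ∈ fatten D, H (x + z) = ∑ x ∈ fatten D, H x := by
  have key : ∀ x, H x ≠ 0 → x ∈ fatten D ∧ x - z ∈ fatten D := by
    intro x hx
    have : ∃ y : Lat d, (∀ i, |y i| ≤ 2) ∧ x + y ∈ D := by
      by_contra hc
      push Not at hc
      exact hx (hH x fun y hy => hv _ (hc y hy))
    obtain ⟨y, hy, hyD⟩ := this
    refine ⟨mem_fatten hyD fun i => (hy i).trans (by norm_num), mem_fatten (z := y + z) ?_ ?_⟩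
    · convert hyD using 1; abel
    · intro i
      have := abs_add_le (y i) (z i)
      have h1 := hy i
      have h2 := hz i
      simp only [Pi.add_apply]; omega
  rw [← finsum_eq_sum_of_support_subset (s := fatten D) H fun x hx => (key x hx).1,
    ← finsum_eq_sum_of_support_subset (s := fatten D) (fun x => H (x + z)) ?_]
  · exact finsum_comp_equiv (Equiv.addRight z)
  · intro x hx
    have := (key _ hx).2
    simpa using this

lemma abs_ev_le (k i : Fin d) : |ev k i| ≤ 1 := by
  unfold ev
  rcases eq_or_ne i k with rfl | h
  · simp
  · simp [Pi.single_eq_of_ne h]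

/-! ### Exact integration by parts for the product of the symmetric part and the multiplier. -/

section Identities

variable {v : Lat d → ℝ} {D : Finset (Lat d)}

lemma sum_shift_ev {H : Lat d → ℝ} (hv : ∀ x, x ∉ D → v x = 0)
    (hH : LocalTo v H) (k : Fin d) :
    ∑ x ∈ fatten D, H (x + ev k) = ∑ x ∈ fatten D, H x :=
  sum_shift hv hH _ (abs_ev_le k)

lemma LocalTo.mul_left {H : Lat d → ℝ} (hH : LocalTo v H) (c : Lat d → ℝ) :
    LocalTo v fun x => c x * H x := fun x hx => by simp [hH x hx]

lemma LocalTo.mul_right {H : Lat d → ℝ} (hH : LocalTo v H) (c : Lat d → ℝ) :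
    LocalTo v fun x => H x * c x := fun x hx => by simp [hH x hx]

lemma localTo_self : LocalTo v v := fun x hx => by simpa using hx 0 (by simp)

lemma localTo_sub (j : Fin d) : LocalTo v fun x => v (x - ev j) := fun x hx => by
  have := hx (-ev j) (fun i => by have := abs_ev_le j i; simp only [Pi.neg_apply, abs_neg]; omega)
  simpa [sub_eq_add_neg] using this

lemma localTo_add (j : Fin d) : LocalTo v fun x => v (x + ev j) := fun x hx =>
  hx (ev j) (fun i => (abs_ev_le j i).trans (by norm_num))

lemma localTo_fd (h : ℝ) (j : Fin d) : LocalTo v (fd h j v) := fun x hx => by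
  simp [fd, localTo_self x hx, localTo_add j x hx]

lemma localTo_fd_sub (h : ℝ) (j : Fin d) : LocalTo v fun x => fd h j v (x - ev j) := fun x hx => by
  simp [fd, localTo_self x hx, localTo_sub j x hx]

/-- Summation by parts for the principal part of the symmetric operator. -/
lemma sum_by_parts (hv : ∀ x, x ∉ D → v x = 0) (h : ℝ) (j : Fin d) (α Z : Lat d → ℝ) :
    ∑ x ∈ fatten D, (α x * fd h j v x - α (x - ev j) * fd h j v (x - ev j)) / h * Z x
      = -∑ x ∈ fatten D, α x * fd h j v x * fd h j Z x := by
  have h1 := sum_shift_ev hv (((localTo_fd_sub h j).mul_left fun x => α (x - ev j)).mul_right Z) j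
  simp only [add_sub_cancel_right] at h1
  have h2 : ∀ x, (α x * fd h j v x - α (x - ev j) * fd h j v (x - ev j)) / h * Z x
      = -(α x * fd h j v x * fd h j Z x) + h⁻¹ * (α x * fd h j v x * Z (x + ev j))
        - h⁻¹ * (α (x - ev j) * fd h j v (x - ev j) * Z x) := by
    intro x; simp only [fd, div_eq_mul_inv]; ring
  simp only [h2, Finset.sum_sub_distrib, Finset.sum_add_distrib, ← Finset.mul_sum, h1,
    Finset.sum_neg_distrib]
  ring

/-- The transport operator in direction `k`, without zeroth order term. -/
def transport (h : ℝ) (k : Fin d) (B v : Lat d → ℝ) (x : Lat d) : ℝ :=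
  B x * fd h k v x + B (x - ev k) * fd h k v (x - ev k)

/-- Edge average in direction `j`. -/
def av (j : Fin d) (f : Lat d → ℝ) (x : Lat d) : ℝ := (f x + f (x + ev j)) / 2

/-- After one summation by parts in direction `j`, the two integrands differ by two telescoping
differences in direction `k`, which sum to zero. The term with `(fd h j v (x + ev k) - fd h j v x) ^
2` has no continuous counterpart; it is the remainder of the discrete product rule. -/
lemma principal_transport_identity (hv : ∀ x, x ∉ D → v x = 0) {h : ℝ} (hh : h ≠ 0)
    (j k : Fin d) (α B : Lat d → ℝ) :
    -2 * ∑ x ∈ fatten D, (α x * fd h j v x - α (x - ev j) * fd h j v (x - ev j)) / h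
        * transport h k B v x
      = ∑ x ∈ fatten D,
        (-2 * fd h j v x ^ 2 *
            ((av j B x * av k α x - av j B (x - ev k) * av k α (x - ev k)) / h)
          + av j B x * fd h k α x * (fd h j v (x + ev k) - fd h j v x) ^ 2
          + 2 * α x * fd h j v x * (fd h j B x * av j (fd h k v) x
            + fd h j B (x - ev k) * av j (fd h k v) (x - ev k))) := by
  rw [sum_by_parts hv]
  have h1 := sum_shift_ev hv ((localTo_fd (v := v) h j).mul_left fun x =>
    2 * α x * av j B (x - ev k) * fd h k (fd h j v) (x - ev k)) k
  have h2 := sum_shift_ev hv ((localTo_fd (v := v) h j).mul_left fun x =>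
    2 * av j B (x - ev k) * av k α (x - ev k) / h * fd h j v x) k
  simp only [add_sub_cancel_right] at h1 h2
  have h3 : ∀ x, -2 * fd h j v x ^ 2 *
            ((av j B x * av k α x - av j B (x - ev k) * av k α (x - ev k)) / h)
          + av j B x * fd h k α x * (fd h j v (x + ev k) - fd h j v x) ^ 2
          + 2 * α x * fd h j v x * (fd h j B x * av j (fd h k v) x
            + fd h j B (x - ev k) * av j (fd h k v) (x - ev k))
      = 2 * (α x * fd h j v x * fd h j (transport h k B v) x)
        + (2 * α (x + ev k) * av j B x * fd h k (fd h j v) x * fd h j v (x + ev k)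
          - 2 * α x * av j B (x - ev k) * fd h k (fd h j v) (x - ev k) * fd h j v x)
        - (2 * av j B x * av k α x / h * fd h j v (x + ev k) * fd h j v (x + ev k)
          - 2 * av j B (x - ev k) * av k α (x - ev k) / h * fd h j v x * fd h j v x) := by
    intro x
    have e1 : x - ev k + ev j = x + ev j - ev k := by abel
    have e2 : x + ev j + ev k = x + ev k + ev j := by abel
    simp only [fd, av, transport, e1, e2, sub_add_cancel]
    field_simp
    ring
  rw [Finset.sum_congr rfl fun x _ => h3 x]
  simp only [Finset.sum_sub_distrib, Finset.sum_add_distrib, ← Finset.mul_sum] at h1 h2 ⊢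
  rw [h1, h2]
  ring

/-- This is the discrete form of `-2 ∫ μ v · 2B ∂_k v = 2 ∫ ∂_k(Bμ) v²`. The `h ^ 2` term is the
discretization remainder, later made harmless by the smallness of `sh`. -/
lemma potential_transport_identity (hv : ∀ x, x ∉ D → v x = 0) {h : ℝ} (hh : h ≠ 0)
    (k : Fin d) (μ B : Lat d → ℝ) :
    -2 * ∑ x ∈ fatten D, μ x * v x * transport h k B v x
      = ∑ x ∈ fatten D,
        (2 * v x ^ 2 * ((B x * av k μ x - B (x - ev k) * av k μ (x - ev k)) / h)
          - B x * fd h k μ x * h ^ 2 * fd h k v x ^ 2) := by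
  have h1 := sum_shift_ev hv ((localTo_self (v := v)).mul_left fun x =>
    2 * μ x * B (x - ev k) * fd h k v (x - ev k)) k
  have h2 := sum_shift_ev hv ((localTo_self (v := v)).mul_left fun x =>
    2 * B (x - ev k) * av k μ (x - ev k) / h * v x) k
  simp only [add_sub_cancel_right] at h1 h2
  have h3 : ∀ x, 2 * v x ^ 2 * ((B x * av k μ x - B (x - ev k) * av k μ (x - ev k)) / h)
          - B x * fd h k μ x * h ^ 2 * fd h k v x ^ 2
      = -2 * (μ x * v x * transport h k B v x)
        - (2 * μ (x + ev k) * B x * fd h k v x * v (x + ev k)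
          - 2 * μ x * B (x - ev k) * fd h k v (x - ev k) * v x)
        + (2 * B x * av k μ x / h * v (x + ev k) * v (x + ev k)
          - 2 * B (x - ev k) * av k μ (x - ev k) / h * v x * v x) := by
    intro x
    simp only [fd, av, transport, sub_add_cancel]
    field_simp
    ring
  rw [Finset.sum_congr rfl fun x _ => h3 x]
  simp only [Finset.sum_sub_distrib, Finset.sum_add_distrib, ← Finset.mul_sum] at h1 h2 ⊢
  rw [h1, h2]
  ring

lemma principal_multiplier_identity (hv : ∀ x, x ∉ D → v x = 0) (h : ℝ)
    (j : Fin d) (α G : Lat d → ℝ) :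
    -2 * ∑ x ∈ fatten D, (α x * fd h j v x - α (x - ev j) * fd h j v (x - ev j)) / h
        * (G x * v x)
      = ∑ x ∈ fatten D, (2 * α x * G x * fd h j v x ^ 2
          + 2 * α x * fd h j G x * fd h j v x * v (x + ev j)) := by
  rw [sum_by_parts hv h j α fun x => G x * v x, mul_neg, neg_mul, neg_neg, Finset.mul_sum]
  refine Finset.sum_congr rfl fun x _ => ?_
  simp only [fd, div_eq_mul_inv]
  ring

/-- The symmetric part of the conjugated operator. -/
def symPart (h : ℝ) (α : Fin d → Lat d → ℝ) (μ v : Lat d → ℝ) (x : Lat d) : ℝ :=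
  ∑ j, (α j x * fd h j v x - α j (x - ev j) * fd h j v (x - ev j)) / h + μ x * v x

/-- The first order multiplier. -/
def multPart (h : ℝ) (B : Fin d → Lat d → ℝ) (G v : Lat d → ℝ) (x : Lat d) : ℝ :=
  ∑ k, transport h k (B k) v x + G x * v x

lemma sum_symPart_mul_multPart (hv : ∀ x, x ∉ D → v x = 0) {h : ℝ} (hh : h ≠ 0)
    (α B : Fin d → Lat d → ℝ) (μ G : Lat d → ℝ) :
    -2 * ∑ x ∈ fatten D, symPart h α μ v x * multPart h B G v x
      = ∑ j, ∑ k, ∑ x ∈ fatten D,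
        (-2 * fd h j v x ^ 2 *
            ((av j (B k) x * av k (α j) x - av j (B k) (x - ev k) * av k (α j) (x - ev k)) / h)
          + av j (B k) x * fd h k (α j) x * (fd h j v (x + ev k) - fd h j v x) ^ 2
          + 2 * α j x * fd h j v x * (fd h j (B k) x * av j (fd h k v) x
            + fd h j (B k) (x - ev k) * av j (fd h k v) (x - ev k)))
        + ∑ k, ∑ x ∈ fatten D,
          (2 * v x ^ 2 * ((B k x * av k μ x - B k (x - ev k) * av k μ (x - ev k)) / h)
            - B k x * fd h k μ x * h ^ 2 * fd h k v x ^ 2)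
        + ∑ j, ∑ x ∈ fatten D, (2 * α j x * G x * fd h j v x ^ 2
          + 2 * α j x * fd h j G x * fd h j v x * v (x + ev j))
        - 2 * ∑ x ∈ fatten D, μ x * G x * v x ^ 2 := by
  simp only [← principal_transport_identity hv hh, ← potential_transport_identity hv hh,
    ← principal_multiplier_identity hv, ← Finset.mul_sum]
  have : ∀ x, symPart h α μ v x * multPart h B G v x
      = (∑ j, ∑ k, (α j x * fd h j v x - α j (x - ev j) * fd h j v (x - ev j)) / h
          * transport h k (B k) v x)
        + (∑ k, μ x * v x * transport h k (B k) v x)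
        + (∑ j, (α j x * fd h j v x - α j (x - ev j) * fd h j v (x - ev j)) / h * (G x * v x))
        + μ x * G x * v x ^ 2 := by
    intro x
    rw [← Finset.sum_mul_sum, ← Finset.mul_sum, ← Finset.sum_mul]
    unfold symPart multPart
    ring
  rw [Finset.sum_congr rfl fun x _ => this x]
  simp only [Finset.sum_add_distrib]
  rw [Finset.sum_comm (s := fatten D), Finset.sum_comm (s := fatten D),
    Finset.sum_comm (s := fatten D)]
  have : ∀ j : Fin d, ∑ x ∈ fatten D, ∑ k, (α j x * fd h j v x
      - α j (x - ev j) * fd h j v (x - ev j)) / h * transport h k (B k) v x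
      = ∑ k, ∑ x ∈ fatten D, (α j x * fd h j v x
      - α j (x - ev j) * fd h j v (x - ev j)) / h * transport h k (B k) v x :=
    fun j => Finset.sum_comm
  simp only [this]
  ring

end Identities

/-! ### Lower bound for the quadratic form under abstract bounds on the coefficients. -/

/-- The offsets `{-1,0,1}^d`. -/
def offsets (d : ℕ) : Finset (Lat d) := Fintype.piFinset fun _ => {-1, 0, 1}

lemma mem_offsets {z : Lat d} : z ∈ offsets d ↔ ∀ i, |z i| ≤ 1 := by
  simp only [offsets, Fintype.mem_piFinset, Finset.mem_insert, Finset.mem_singleton]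
  refine forall_congr' fun i => ?_
  rw [abs_le]; omega

lemma card_offsets (d : ℕ) : (offsets d).card = 3 ^ d := by
  simp [offsets, Fintype.card_piFinset]

/-- The squared gradient summed over neighbouring edges. -/
def nbhdGrad (h : ℝ) (v : Lat d → ℝ) (x : Lat d) : ℝ :=
  ∑ z ∈ offsets d, ∑ j, fd h j v (x + z) ^ 2

lemma sq_fd_le_nbhdGrad (h : ℝ) (v : Lat d → ℝ) (x : Lat d) (j : Fin d) {z : Lat d}
    (hz : ∀ i, |z i| ≤ 1) : fd h j v (x + z) ^ 2 ≤ nbhdGrad h v x := by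
  refine le_trans ?_ (Finset.single_le_sum (f := fun z => ∑ j, fd h j v (x + z) ^ 2)
    (fun z _ => Finset.sum_nonneg fun j _ => sq_nonneg _) (mem_offsets.2 hz))
  exact Finset.single_le_sum (f := fun j => fd h j v (x + z) ^ 2) (fun j _ => sq_nonneg _)
    (Finset.mem_univ j)

lemma sq_fd_le_nbhdGrad_self (h : ℝ) (v : Lat d → ℝ) (x : Lat d) (j : Fin d) :
    fd h j v x ^ 2 ≤ nbhdGrad h v x := by
  simpa using sq_fd_le_nbhdGrad h v x j (z := 0) (by simp)

lemma sq_fd_le_nbhdGrad_add (h : ℝ) (v : Lat d → ℝ) (x : Lat d) (j k : Fin d) :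
    fd h j v (x + ev k) ^ 2 ≤ nbhdGrad h v x :=
  sq_fd_le_nbhdGrad h v x j (abs_ev_le k)

lemma sq_fd_le_nbhdGrad_sub (h : ℝ) (v : Lat d → ℝ) (x : Lat d) (j k : Fin d) :
    fd h j v (x - ev k) ^ 2 ≤ nbhdGrad h v x := by
  rw [sub_eq_add_neg]
  exact sq_fd_le_nbhdGrad h v x j (fun i => by simpa using abs_ev_le k i)

lemma sq_fd_le_nbhdGrad_sub_add (h : ℝ) (v : Lat d → ℝ) (x : Lat d) (i j k : Fin d) :
    fd h i v (x - ev k + ev j) ^ 2 ≤ nbhdGrad h v x := by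
  have : x - ev k + ev j = x + (ev j - ev k) := by abel
  rw [this]
  refine sq_fd_le_nbhdGrad h v x i fun l => ?_
  simp only [Pi.sub_apply, ev, Pi.single_apply]
  split_ifs <;> simp

/-- The weighted norm `∑ a_k b_k²` of the gradient of the phase. -/
def gam (a b : Fin d → Lat d → ℝ) (x : Lat d) : ℝ := ∑ k, a k x * b k x ^ 2

/-- Bounds on the coefficients of the conjugated operator, in terms of the principal parts
`a, b, Φ`; the constant `C` multiplies errors which are small for a large convexification
parameter `lam`, the constant `K` multiplies errors which are small with `ε`. -/
structure CoeffBounds (h s lam ε C K : ℝ) (α B a b : Fin d → Lat d → ℝ)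
    (μ G Φ : Lat d → ℝ) : Prop where
  C_nonneg : 0 ≤ C
  K_nonneg : 0 ≤ K
  s_pos : 0 < s
  inv_le : 1 ≤ s * ε
  Φ_pos : ∀ x, 0 < Φ x
  Φ_shift : ∀ x z, (∀ i, |z i| ≤ 1) → Φ (x - z) ≤ Φ x + K * ε
  divergence : ∀ j k x, |(av j (B k) x * av k (α j) x
      - av j (B k) (x - ev k) * av k (α j) (x - ev k)) / h
      - s * (lam * Φ x * (a j x * (a k x * b k x ^ 2)))| ≤ s * (C * Φ x + K * ε)
  drift : ∀ j k x, |av j (B k) x * fd h k (α j) x| ≤ s * (C * Φ x + K * ε)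
  hessian : ∀ j k x, |α j x * fd h j (B k) x
      - s * (lam * Φ x * ((a j x * b j x) * (a k x * b k x)))| ≤ s * (C * Φ x + K * ε)
  hessian_sub : ∀ j k x, |α j x * fd h j (B k) (x - ev k)
      - s * (lam * Φ x * ((a j x * b j x) * (a k x * b k x)))| ≤ s * (C * Φ x + K * ε)
  hessian_shift : ∀ j k x, |lam * Φ (x - ev j) * ((a j (x - ev j) * b j (x - ev j)) *
      (a k (x - ev j) * b k (x - ev j)))
      - lam * Φ x * ((a j x * b j x) * (a k x * b k x))| ≤ K * ε
  potential : ∀ x, |∑ k, (B k x * av k μ x - B k (x - ev k) * av k μ (x - ev k)) / h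
      - s ^ 3 * (3 * lam * Φ x ^ 3 * gam a b x ^ 2)| ≤ s ^ 3 * (C * Φ x ^ 3 + K * ε)
  potential_drift : ∀ k x, |B k x * fd h k μ x * h ^ 2| ≤ s * (K * ε)
  multiplier : ∀ j x, |α j x * G x - s * (2 * lam * Φ x * gam a b x * a j x)| ≤ s * (K * ε)
  multiplier_drift : ∀ j x, |α j x * fd h j G x| ≤ s * K
  potential_multiplier : ∀ x, |μ x * G x - s ^ 3 * (2 * lam * Φ x ^ 3 * gam a b x ^ 2)|
      ≤ s ^ 3 * (K * ε)

section Lower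

variable {h s lam ε C K : ℝ} {α B a b : Fin d → Lat d → ℝ} {μ G Φ v : Lat d → ℝ}
  {D : Finset (Lat d)}

/-- Vertex-centred difference quotient. -/
def cfd (h : ℝ) (k : Fin d) (v : Lat d → ℝ) (x : Lat d) : ℝ :=
  (fd h k v x + fd h k v (x - ev k)) / 2

lemma abs_sub_le_mul {r t w y Y : ℝ} (h : |r - t| ≤ w) (hy : |y| ≤ Y) :
    t * y - w * Y ≤ r * y := by
  have h1 : |(r - t) * y| ≤ w * Y := by
    rw [abs_mul]
    exact mul_le_mul h hy (abs_nonneg _) ((abs_nonneg _).trans h)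
  have := (abs_le.1 h1).1
  linarith

lemma neg_le_mul_of_abs_le {r w y Y : ℝ} (h : |r| ≤ w) (hy : |y| ≤ Y) :
    -(w * Y) ≤ r * y := by
  have := abs_sub_le_mul (t := 0) (by simpa only [sub_zero] using h) hy
  linarith

lemma two_abs_mul_le (x y : ℝ) : |2 * x * y| ≤ x ^ 2 + y ^ 2 := by
  rw [abs_le]; constructor <;> nlinarith [sq_nonneg (x + y), sq_nonneg (x - y)]

lemma CoeffBounds.eps_pos (H : CoeffBounds h s lam ε C K α B a b μ G Φ) : 0 < ε := by
  by_contra hc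
  have := mul_nonpos_of_nonneg_of_nonpos H.s_pos.le (not_lt.1 hc)
  linarith [H.inv_le]

/-- The coefficients are frozen at their principal parts, and every error is charged to `nbhdGrad`.
The Hessian term is moved to vertex-centred differences `cfd`, because only then does its double sum
over `j` and `k` become a perfect square. The five error terms contribute `2 + 4 + 2 + 2 + 2 = 12`.
-/
lemma principal_lower (H : CoeffBounds h s lam ε C K α B a b μ G Φ)
    (hv : ∀ x, x ∉ D → v x = 0) (j k : Fin d) :
    ∑ x ∈ fatten D, (-2 * (s * (lam * Φ x * (a j x * (a k x * b k x ^ 2)))) * fd h j v x ^ 2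
        + 4 * s * (lam * Φ x * ((a j x * b j x) * (a k x * b k x))) * cfd h j v x * cfd h k v x
        - 12 * (s * (C * Φ x + K * ε)) * nbhdGrad h v x)
      ≤ ∑ x ∈ fatten D,
        (-2 * fd h j v x ^ 2 *
            ((av j (B k) x * av k (α j) x - av j (B k) (x - ev k) * av k (α j) (x - ev k)) / h)
          + av j (B k) x * fd h k (α j) x * (fd h j v (x + ev k) - fd h j v x) ^ 2
          + 2 * α j x * fd h j v x * (fd h j (B k) x * av j (fd h k v) x
            + fd h j (B k) (x - ev k) * av j (fd h k v) (x - ev k))) := by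
  set t : Lat d → ℝ := fun x => lam * Φ x * ((a j x * b j x) * (a k x * b k x)) with ht
  -- The four values of `fd h k v` around the edge `(x, x + ev j)` split into the vertex differences
  -- at its two ends. Shifting the contribution of the far end back to `x` pairs `cfd h k v x` with
  -- both `fd h j v x` and `fd h j v (x - ev j)`, that is, with `2 * cfd h j v x`.
  have hshift := sum_shift_ev hv (((localTo_fd_sub (v := v) h j).mul_left
    fun x => 2 * s * t (x - ev j)).mul_right (cfd h k v)) j
  simp only [add_sub_cancel_right] at hshift
  rw [← sub_eq_zero, ← Finset.sum_sub_distrib] at hshift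
  refine sub_nonneg.1 ?_
  rw [← Finset.sum_sub_distrib]
  refine le_of_le_of_eq ?_ ((congrArg (_ - ·) hshift).trans (sub_zero _))
  rw [← Finset.sum_sub_distrib]
  refine Finset.sum_nonneg fun x _ => ?_
  have q0 := sq_fd_le_nbhdGrad_self h v x j
  have q1 := sq_fd_le_nbhdGrad_add h v x j k
  have q2 := sq_fd_le_nbhdGrad_self h v x k
  have q3 := sq_fd_le_nbhdGrad_add h v x k j
  have q4 := sq_fd_le_nbhdGrad_sub h v x k k
  have q5 := sq_fd_le_nbhdGrad_sub_add h v x k j k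
  have q6 := sq_fd_le_nbhdGrad_sub h v x j j
  have e1 : x - ev k + ev j = x + ev j - ev k := by abel
  have hω : K * ε ≤ C * Φ x + K * ε := by
    have := mul_nonneg H.C_nonneg (H.Φ_pos x).le; linarith
  set Q := nbhdGrad h v x
  have m1 := abs_sub_le_mul (H.divergence j k x) (y := -2 * fd h j v x ^ 2) (Y := 2 * Q) (by
    rw [abs_le]; constructor <;> nlinarith [sq_nonneg (fd h j v x)])
  have m2 := neg_le_mul_of_abs_le (H.drift j k x)
    (y := (fd h j v (x + ev k) - fd h j v x) ^ 2) (Y := 4 * Q) (by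
      rw [abs_of_nonneg (sq_nonneg _)]; nlinarith [sq_nonneg (fd h j v (x + ev k) + fd h j v x)])
  have m3 := abs_sub_le_mul (H.hessian j k x) (y := 2 * fd h j v x * av j (fd h k v) x)
    (Y := 2 * Q) ((two_abs_mul_le _ _).trans (by
      unfold av; nlinarith [sq_nonneg (fd h k v x - fd h k v (x + ev j))]))
  have m4 := abs_sub_le_mul (H.hessian_sub j k x)
    (y := 2 * fd h j v x * av j (fd h k v) (x - ev k))
    (Y := 2 * Q) ((two_abs_mul_le _ _).trans (by
      unfold av; nlinarith [sq_nonneg (fd h k v (x - ev k) - fd h k v (x - ev k + ev j))]))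
  have m5 := abs_sub_le_mul (H.hessian_shift j k x) (y := 2 * fd h j v (x - ev j) * cfd h k v x)
    (Y := 2 * Q) ((two_abs_mul_le _ _).trans (by
      unfold cfd; nlinarith [sq_nonneg (fd h k v x - fd h k v (x - ev k))]))
  have hQ : 0 ≤ Q := (sq_nonneg _).trans q0
  have m5' := mul_le_mul_of_nonneg_left m5 H.s_pos.le
  have m6 : s * (K * ε * (2 * Q)) ≤ s * (C * Φ x + K * ε) * (2 * Q) := by
    have := mul_le_mul_of_nonneg_left (mul_le_mul_of_nonneg_right hω
      (by linarith : 0 ≤ 2 * Q)) H.s_pos.le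
    linarith
  have e5 : cfd h k v (x + ev j) = (fd h k v (x + ev j) + fd h k v (x + ev j - ev k)) / 2 := rfl
  have e6 : av j (fd h k v) x = (fd h k v x + fd h k v (x + ev j)) / 2 := rfl
  have e7 : av j (fd h k v) (x - ev k)
      = (fd h k v (x - ev k) + fd h k v (x + ev j - ev k)) / 2 := by rw [← e1]; rfl
  have e8 : cfd h k v x = (fd h k v x + fd h k v (x - ev k)) / 2 := rfl
  have e9 : cfd h j v x = (fd h j v x + fd h j v (x - ev j)) / 2 := rfl
  simp only [ht]
  rw [e5, e9]
  rw [e6] at m3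
  rw [e7] at m4
  rw [e8] at m5'
  rw [e6, e7, e8]
  linarith

/-- Each of the `3 ^ d` offsets is undone by translating the sum. This moves the shift onto the
slowly varying `Φ`, at the cost of `K * ε`. -/
lemma sum_nbhdGrad_le (H : CoeffBounds h s lam ε C K α B a b μ G Φ)
    (hv : ∀ x, x ∉ D → v x = 0) :
    ∑ x ∈ fatten D, (C * Φ x + K * ε) * nbhdGrad h v x
      ≤ 3 ^ d * ∑ x ∈ fatten D, (C * (Φ x + K * ε) + K * ε) * ∑ j, fd h j v x ^ 2 := by
  have h1 : ∀ z ∈ offsets d, ∑ x ∈ fatten D, (C * Φ x + K * ε) * ∑ j, fd h j v (x + z) ^ 2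
      ≤ ∑ x ∈ fatten D, (C * (Φ x + K * ε) + K * ε) * ∑ j, fd h j v x ^ 2 := by
    intro z hz
    rw [mem_offsets] at hz
    have hloc : LocalTo v fun x => ∑ j, fd h j v x ^ 2 := fun x hx =>
      Finset.sum_eq_zero fun j _ => by simp [localTo_fd h j x hx]
    have := sum_shift hv (hloc.mul_left fun x => C * Φ (x - z) + K * ε) z hz
    simp only [add_sub_cancel_right] at this
    rw [this]
    refine Finset.sum_le_sum fun x _ => mul_le_mul_of_nonneg_right ?_
      (Finset.sum_nonneg fun j _ => sq_nonneg _)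
    have := mul_le_mul_of_nonneg_left (H.Φ_shift x z hz) H.C_nonneg
    linarith
  unfold nbhdGrad
  simp only [Finset.mul_sum (s := offsets d)]
  rw [Finset.sum_comm]
  refine (Finset.sum_le_sum h1).trans ?_
  rw [Finset.sum_const, card_offsets, nsmul_eq_mul]
  push_cast
  exact le_rfl

lemma potential_lower (H : CoeffBounds h s lam ε C K α B a b μ G Φ) :
    ∑ x ∈ fatten D, (6 * (s ^ 3 * (lam * Φ x ^ 3 * gam a b x ^ 2)) * v x ^ 2
        - 2 * (s ^ 3 * (C * Φ x ^ 3 + K * ε)) * v x ^ 2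
        - s * (K * ε) * ∑ k, fd h k v x ^ 2)
      ≤ ∑ k, ∑ x ∈ fatten D,
          (2 * v x ^ 2 * ((B k x * av k μ x - B k (x - ev k) * av k μ (x - ev k)) / h)
            - B k x * fd h k μ x * h ^ 2 * fd h k v x ^ 2) := by
  rw [Finset.sum_comm]
  refine Finset.sum_le_sum fun x _ => ?_
  rw [Finset.sum_sub_distrib, ← Finset.mul_sum]
  have h1 := abs_sub_le_mul (H.potential x) (y := 2 * v x ^ 2) (Y := 2 * v x ^ 2)
    (by rw [abs_of_nonneg (by positivity)])
  have h2 : ∑ k, B k x * fd h k μ x * h ^ 2 * fd h k v x ^ 2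
      ≤ s * (K * ε) * ∑ k, fd h k v x ^ 2 := by
    rw [Finset.mul_sum]
    exact Finset.sum_le_sum fun k _ => mul_le_mul_of_nonneg_right
      ((le_abs_self _).trans (H.potential_drift k x)) (sq_nonneg _)
  linarith

lemma multiplier_lower (H : CoeffBounds h s lam ε C K α B a b μ G Φ)
    (hv : ∀ x, x ∉ D → v x = 0) :
    ∑ x ∈ fatten D, (4 * s * (lam * Φ x * gam a b x) * (∑ j, a j x * fd h j v x ^ 2)
        - 3 * (s * (K * ε)) * (∑ j, fd h j v x ^ 2) - d * (s ^ 3 * (K * ε)) * v x ^ 2)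
      ≤ ∑ j, ∑ x ∈ fatten D, (2 * α j x * G x * fd h j v x ^ 2
          + 2 * α j x * fd h j G x * fd h j v x * v (x + ev j)) := by
  have h1 : ∀ j, ∑ x ∈ fatten D, (4 * s * (lam * Φ x * gam a b x) * (a j x * fd h j v x ^ 2)
        - 3 * (s * (K * ε)) * fd h j v x ^ 2 - s ^ 3 * (K * ε) * v x ^ 2)
      ≤ ∑ x ∈ fatten D, (2 * α j x * G x * fd h j v x ^ 2
          + 2 * α j x * fd h j G x * fd h j v x * v (x + ev j)) := by
    intro j
    have h2 := sum_shift_ev hv ((localTo_self (v := v)).mul_left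
      fun x => s ^ 3 * (K * ε) * v x) j
    simp only [mul_assoc, ← sq] at h2
    rw [Finset.sum_sub_distrib]
    simp only [mul_assoc] at h2 ⊢
    rw [← h2, ← Finset.sum_sub_distrib]
    refine Finset.sum_le_sum fun x _ => ?_
    have h3 := abs_sub_le_mul (H.multiplier j x) (y := 2 * fd h j v x ^ 2)
      (Y := 2 * fd h j v x ^ 2) (by rw [abs_of_nonneg (by positivity)])
    -- The drift of `G` is bounded but not small. Since `1 ≤ s * ε`, Young's inequality with weight
    -- `s` splits the cross term into `ε |∇v|²` and `s² ε v²`, and both are negligible against the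
    -- main terms.
    have h4 := neg_le_mul_of_abs_le (H.multiplier_drift j x)
      (y := 2 * fd h j v x * v (x + ev j))
      (Y := ε * fd h j v x ^ 2 + s ^ 2 * ε * v (x + ev j) ^ 2) (by
        have hε := H.eps_pos
        have hs := H.s_pos
        have := two_abs_mul_le (fd h j v x) (s * v (x + ev j))
        have h5 : |2 * fd h j v x * v (x + ev j)| * s
            ≤ fd h j v x ^ 2 + (s * v (x + ev j)) ^ 2 := by
          rw [show 2 * fd h j v x * (s * v (x + ev j)) = (2 * fd h j v x * v (x + ev j)) * s by
            ring, abs_mul, abs_of_pos hs] at this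
          exact this
        have h6 := mul_le_mul_of_nonneg_left h5 hε.le
        have h7 := mul_le_mul_of_nonneg_left H.inv_le
          (abs_nonneg (2 * fd h j v x * v (x + ev j)))
        linarith)
    linarith
  refine le_trans (le_of_eq ?_) (Finset.sum_le_sum fun j _ => h1 j)
  rw [Finset.sum_comm]
  refine Finset.sum_congr rfl fun x _ => ?_
  simp only [Finset.sum_sub_distrib, ← Finset.mul_sum, Finset.sum_const, Finset.card_univ,
    Fintype.card_fin, nsmul_eq_mul]
  ring

/-- The combinatorial constant of the quadratic form estimate. -/
def formConst (d : ℕ) : ℝ := (12 * d ^ 2) * 3 ^ d + 4 + d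

/-- The leading gradient coefficient is `-2 + 4 = 2`, from the divergence term and from the
multiplier. The leading coefficient of `v²` is `6 - 4 = 2`, from the potential term and from the
multiplier. The multiplier trades part of the surplus in `v²` for a positive gradient term. -/
theorem quadratic_form_lower (H : CoeffBounds h s lam ε C K α B a b μ G Φ) (hh : h ≠ 0)
    (hlam : 0 ≤ lam) (hv : ∀ x, x ∉ D → v x = 0) :
    ∑ x ∈ fatten D, (∑ j, s * (2 * lam * Φ x * gam a b x * a j x
          - formConst d * (C * (Φ x + K * ε) + K * ε)) * fd h j v x ^ 2
        + s ^ 3 * (2 * lam * Φ x ^ 3 * gam a b x ^ 2 - formConst d * (C * Φ x ^ 3 + K * ε))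
          * v x ^ 2)
      ≤ -2 * ∑ x ∈ fatten D, symPart h α μ v x * multPart h B G v x := by
  rw [sum_symPart_mul_multPart hv hh]
  have h1 := Finset.sum_le_sum fun j (_ : j ∈ Finset.univ) => Finset.sum_le_sum
    fun k (_ : k ∈ Finset.univ) => principal_lower H hv j k
  have h2 := potential_lower (v := v) (D := D) H
  have h3 := multiplier_lower H hv
  have h4 : ∑ x ∈ fatten D, -2 * ((s ^ 3 * (2 * lam * Φ x ^ 3 * gam a b x ^ 2)
      + s ^ 3 * (K * ε)) * v x ^ 2) ≤ - 2 * ∑ x ∈ fatten D, μ x * G x * v x ^ 2 := by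
    rw [Finset.mul_sum]
    refine Finset.sum_le_sum fun x _ => ?_
    have := mul_le_mul_of_nonneg_right (abs_le.1 (H.potential_multiplier x)).2 (sq_nonneg (v x))
    linarith
  have h5 := sum_nbhdGrad_le H hv
  refine le_trans ?_ (le_trans (add_le_add (add_le_add (add_le_add h1 h2) h3) h4) (le_of_eq (by ring)))
  have h6 : ∑ j, ∑ k, ∑ x ∈ fatten D,
      (-2 * (s * (lam * Φ x * (a j x * (a k x * b k x ^ 2)))) * fd h j v x ^ 2
        + 4 * s * (lam * Φ x * ((a j x * b j x) * (a k x * b k x))) * cfd h j v x * cfd h k v x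
        - 12 * (s * (C * Φ x + K * ε)) * nbhdGrad h v x)
      = ∑ x ∈ fatten D, (-2 * s * (lam * Φ x * gam a b x) * (∑ j, a j x * fd h j v x ^ 2)
        + 4 * s * (lam * Φ x) * (∑ j, a j x * b j x * cfd h j v x) ^ 2)
        - 12 * d ^ 2 * s * ∑ x ∈ fatten D, (C * Φ x + K * ε) * nbhdGrad h v x := by
    have : ∀ j : Fin d, ∑ k, ∑ x ∈ fatten D,
      (-2 * (s * (lam * Φ x * (a j x * (a k x * b k x ^ 2)))) * fd h j v x ^ 2
        + 4 * s * (lam * Φ x * ((a j x * b j x) * (a k x * b k x))) * cfd h j v x * cfd h k v x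
        - 12 * (s * (C * Φ x + K * ε)) * nbhdGrad h v x)
      = ∑ x ∈ fatten D, ∑ k,
      (-2 * (s * (lam * Φ x * (a j x * (a k x * b k x ^ 2)))) * fd h j v x ^ 2
        + 4 * s * (lam * Φ x * ((a j x * b j x) * (a k x * b k x))) * cfd h j v x * cfd h k v x
        - 12 * (s * (C * Φ x + K * ε)) * nbhdGrad h v x) := fun j => Finset.sum_comm
    simp only [this]
    rw [Finset.sum_comm, Finset.mul_sum, ← Finset.sum_sub_distrib]
    refine Finset.sum_congr rfl fun x _ => ?_
    simp only [Finset.sum_sub_distrib, Finset.sum_add_distrib, Finset.sum_const, Finset.card_univ,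
      Fintype.card_fin, nsmul_eq_mul]
    have e1 : ∑ j, ∑ k, -2 * (s * (lam * Φ x * (a j x * (a k x * b k x ^ 2)))) * fd h j v x ^ 2
        = -2 * s * (lam * Φ x * gam a b x) * (∑ j, a j x * fd h j v x ^ 2) := by
      rw [Finset.mul_sum]
      refine Finset.sum_congr rfl fun j _ => ?_
      simp only [gam, Finset.mul_sum, Finset.sum_mul]
      exact Finset.sum_congr rfl fun k _ => by ring
    have e2 : ∑ j, ∑ k, 4 * s * (lam * Φ x * ((a j x * b j x) * (a k x * b k x)))
        * cfd h j v x * cfd h k v x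
        = 4 * s * (lam * Φ x) * (∑ j, a j x * b j x * cfd h j v x) ^ 2 := by
      rw [sq, Finset.sum_mul_sum, Finset.mul_sum]
      refine Finset.sum_congr rfl fun j _ => ?_
      rw [Finset.mul_sum]
      exact Finset.sum_congr rfl fun k _ => by ring
    rw [e1, e2]
    ring
  rw [h6]
  have hs := H.s_pos
  have hε := H.eps_pos
  have h7 := mul_le_mul_of_nonneg_left h5 (by positivity : 0 ≤ 12 * (d : ℝ) ^ 2 * s)
  refine le_trans ?_ (add_le_add (add_le_add (add_le_add (sub_le_sub le_rfl h7) le_rfl) le_rfl)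
    le_rfl)
  rw [← mul_assoc, Finset.mul_sum (s := fatten D), ← Finset.sum_sub_distrib, ← Finset.sum_add_distrib,
    ← Finset.sum_add_distrib, ← Finset.sum_add_distrib]
  refine Finset.sum_le_sum fun x _ => ?_
  have e1 : ∑ j, s * (2 * lam * Φ x * gam a b x * a j x
          - formConst d * (C * (Φ x + K * ε) + K * ε)) * fd h j v x ^ 2
      = 2 * s * (lam * Φ x * gam a b x) * (∑ j, a j x * fd h j v x ^ 2)
        - formConst d * (s * (C * (Φ x + K * ε) + K * ε)) * ∑ j, fd h j v x ^ 2 := by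
    rw [Finset.mul_sum, Finset.mul_sum, ← Finset.sum_sub_distrib]
    exact Finset.sum_congr rfl fun j _ => by ring
  rw [e1]
  have hE : 0 ≤ ∑ j, fd h j v x ^ 2 := Finset.sum_nonneg fun j _ => sq_nonneg _
  -- The leading Hessian contribution is a square and is simply dropped.
  have hsq : 0 ≤ 4 * s * (lam * Φ x) * (∑ j, a j x * b j x * cfd h j v x) ^ 2 := by
    have := H.Φ_pos x; positivity
  set E := ∑ j, fd h j v x ^ 2
  have hC := H.C_nonneg
  have hK := H.K_nonneg
  have hΦ := H.Φ_pos x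
  have i1 : 0 ≤ s * (C * (Φ x + K * ε)) * E := by positivity
  have i2 : 0 ≤ s * (K * ε) * E := by positivity
  have i3 : 0 ≤ s ^ 3 * (C * Φ x ^ 3) * v x ^ 2 := by positivity
  have i4 : 0 ≤ s ^ 3 * (K * ε) * v x ^ 2 := by positivity
  have hd : (0 : ℝ) ≤ d := Nat.cast_nonneg d
  have i5 := mul_nonneg hd i1
  have i6 := mul_nonneg hd i2
  have i7 := mul_nonneg hd i3
  have i8 : 0 ≤ (12 * (d : ℝ) ^ 2) * 3 ^ d * (s ^ 3 * (C * Φ x ^ 3) * v x ^ 2) := by positivity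
  have i9 : 0 ≤ (12 * (d : ℝ) ^ 2) * 3 ^ d * (s ^ 3 * (K * ε) * v x ^ 2) := by positivity
  -- Gradient errors: `12 d² 3^d` from the principal part, `3` from the multiplier and `1` from the
  -- potential drift. Errors in `v²`: `2` from the potential, `d` from the multiplier drift and `2`
  -- from the product of potential and multiplier.
  unfold formConst
  linarith

end Lower

/-! ### Hyperbolic functions at the small scale `δ = sh`. -/

section Hyperbolic

lemma lipschitz_of_deriv_bound {f f' : ℝ → ℝ} {M L t t' : ℝ} (hf : ∀ x, HasDerivAt f (f' x) x)
    (hb : ∀ x, |x| ≤ M → |f' x| ≤ L) (ht : |t| ≤ M) (ht' : |t'| ≤ M) :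
    |f t' - f t| ≤ L * |t' - t| :=
  Convex.norm_image_sub_le_of_norm_hasDerivWithin_le (s := Set.Icc (-M) M) (f' := f')
    (fun x _ => (hf x).hasDerivWithinAt) (fun x hx => hb x (abs_le.2 hx)) (convex_Icc _ _)
    (abs_le.1 ht) (abs_le.1 ht')

lemma abs_sinh_le_cosh {x M : ℝ} (hx : |x| ≤ M) : |Real.sinh x| ≤ Real.cosh M := by
  have h1 : |Real.sinh x| ≤ Real.cosh x := by
    rw [abs_le]; constructor
    · have := Real.cosh_add_sinh x; have := Real.exp_pos x; linarith
    · exact (Real.sinh_lt_cosh x).le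
  refine h1.trans (Real.cosh_le_cosh.2 ?_)
  rwa [abs_of_nonneg ((abs_nonneg x).trans hx)]

lemma abs_scaled_le {δ M t : ℝ} (h0 : 0 < δ) (h1 : δ ≤ 1) (ht : |t| ≤ M) : |δ * t| ≤ M := by
  rw [abs_mul, abs_of_pos h0]
  have := mul_le_mul_of_nonneg_right h1 (abs_nonneg t)
  linarith

lemma cosh_scaled_lipschitz {δ M t t' : ℝ} (h0 : 0 < δ) (h1 : δ ≤ 1) (ht : |t| ≤ M)
    (ht' : |t'| ≤ M) :
    |Real.cosh (δ * t') - Real.cosh (δ * t)| ≤ δ * Real.cosh M * |t' - t| := by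
  refine (lipschitz_of_deriv_bound (f := Real.cosh) Real.hasDerivAt_cosh
    (fun x hx => abs_sinh_le_cosh hx) (abs_scaled_le h0 h1 ht) (abs_scaled_le h0 h1 ht')).trans ?_
  rw [← mul_sub, abs_mul, abs_of_pos h0]
  exact le_of_eq (by ring)

lemma cosh_scaled_sub_one {δ M t : ℝ} (h0 : 0 < δ) (h1 : δ ≤ 1) (ht : |t| ≤ M) :
    |Real.cosh (δ * t) - 1| ≤ δ * (Real.cosh M * M) := by
  have := cosh_scaled_lipschitz h0 h1 (t := 0) (by simpa using (abs_nonneg t).trans ht) ht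
  simp only [mul_zero, Real.cosh_zero, sub_zero] at this
  refine this.trans ?_
  rw [mul_assoc]
  have := Real.cosh_pos M
  gcongr

/-- The derivative of `sinh (δt)/δ - t` is `cosh (δt) - 1`, already known to be `O(δ)`. The
quadratic case below repeats the step, with this function as the derivative. Lipschitz bounds are
needed, not just sup bounds, because difference quotients of the coefficients must be expanded too.
-/
lemma sinh_scaled_lipschitz {δ M t t' : ℝ} (h0 : 0 < δ) (h1 : δ ≤ 1) (ht : |t| ≤ M)
    (ht' : |t'| ≤ M) :
    |(Real.sinh (δ * t') / δ - t') - (Real.sinh (δ * t) / δ - t)|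
      ≤ δ * (Real.cosh M * M) * |t' - t| := by
  refine lipschitz_of_deriv_bound (f := fun t => Real.sinh (δ * t) / δ - t)
    (f' := fun t => Real.cosh (δ * t) - 1) (fun x => ?_)
    (fun x hx => cosh_scaled_sub_one h0 h1 hx) ht ht'
  have h2 := (((hasDerivAt_id x).const_mul δ).sinh.div_const δ).sub (hasDerivAt_id x)
  refine h2.congr_deriv ?_
  simp only [id, mul_one]
  field_simp

lemma sinh_scaled_sub {δ M t : ℝ} (h0 : 0 < δ) (h1 : δ ≤ 1) (ht : |t| ≤ M) :
    |Real.sinh (δ * t) / δ - t| ≤ δ * (Real.cosh M * M * M) := by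
  have := sinh_scaled_lipschitz h0 h1 (t := 0) (by simpa using (abs_nonneg t).trans ht) ht
  simp only [mul_zero, Real.sinh_zero, sub_zero, zero_div] at this
  refine this.trans ?_
  have h3 : 0 ≤ M := (abs_nonneg t).trans ht
  have := Real.cosh_pos M
  rw [mul_assoc]
  gcongr

lemma cosh_quadratic_lipschitz {δ M t t' : ℝ} (h0 : 0 < δ) (h1 : δ ≤ 1) (ht : |t| ≤ M)
    (ht' : |t'| ≤ M) :
    |((Real.cosh (δ * t') - 1) / δ ^ 2 - t' ^ 2 / 2)
        - ((Real.cosh (δ * t) - 1) / δ ^ 2 - t ^ 2 / 2)|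
      ≤ δ * (Real.cosh M * M * M) * |t' - t| := by
  refine lipschitz_of_deriv_bound (f := fun t => (Real.cosh (δ * t) - 1) / δ ^ 2 - t ^ 2 / 2)
    (f' := fun t => Real.sinh (δ * t) / δ - t) (fun x => ?_)
    (fun x hx => sinh_scaled_sub h0 h1 hx) ht ht'
  have h2 := ((((hasDerivAt_id x).const_mul δ).cosh.sub_const 1).div_const (δ ^ 2)).sub
    (((hasDerivAt_id x).pow 2).div_const 2)
  refine h2.congr_deriv ?_
  simp only [id, mul_one]
  field_simp
  simp
  ring

lemma cosh_quadratic_sub {δ M t : ℝ} (h0 : 0 < δ) (h1 : δ ≤ 1) (ht : |t| ≤ M) :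
    |(Real.cosh (δ * t) - 1) / δ ^ 2 - t ^ 2 / 2| ≤ δ * (Real.cosh M * M * M * M) := by
  have := cosh_quadratic_lipschitz h0 h1 (t := 0) (by simpa using (abs_nonneg t).trans ht) ht
  simp only [mul_zero, Real.cosh_zero, sub_zero, zero_div, sub_self] at this
  norm_num at this
  refine this.trans ?_
  have h3 : 0 ≤ M := (abs_nonneg t).trans ht
  have := Real.cosh_pos M
  rw [mul_assoc]
  gcongr

end Hyperbolic

/-! ### A calculus of bounded, negligible, regular and graded functions of the parameters. -/

/-- The unit vector `e_k` of `ℝ^d`. -/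
abbrev uv (k : Fin d) : Pt d := EuclideanSpace.single k (1 : ℝ)

/-- Parameters: convexification parameter, mesh size, Carleman parameter and base point. -/
structure Param (d : ℕ) where
  lam : ℝ
  h : ℝ
  s : ℝ
  y : Pt d

namespace Param

/-- Admissible parameters. -/
structure Valid (p : Param d) : Prop where
  lam : 1 ≤ p.lam
  h : 0 < p.h
  s : 1 ≤ p.s
  sh : p.s * p.h ≤ 1

/-- The small quantity `s h + 1 / s`. -/
def eps (p : Param d) : ℝ := p.s * p.h + 1 / p.s

/-- Shift of the base point by one mesh step. -/
def up (k : Fin d) (p : Param d) : Param d := { p with y := p.y + p.h • uv k }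

/-- Backward shift of the base point by one mesh step. -/
def dn (k : Fin d) (p : Param d) : Param d := { p with y := p.y - p.h • uv k }

lemma Valid.up {p : Param d} (hp : p.Valid) (k : Fin d) : (p.up k).Valid :=
  ⟨hp.lam, hp.h, hp.s, hp.sh⟩

lemma Valid.dn {p : Param d} (hp : p.Valid) (k : Fin d) : (p.dn k).Valid :=
  ⟨hp.lam, hp.h, hp.s, hp.sh⟩

@[simp] lemma lam_up (p : Param d) (k) : (p.up k).lam = p.lam := rfl
@[simp] lemma lam_dn (p : Param d) (k) : (p.dn k).lam = p.lam := rfl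
@[simp] lemma h_up (p : Param d) (k) : (p.up k).h = p.h := rfl
@[simp] lemma h_dn (p : Param d) (k) : (p.dn k).h = p.h := rfl
@[simp] lemma s_up (p : Param d) (k) : (p.up k).s = p.s := rfl
@[simp] lemma s_dn (p : Param d) (k) : (p.dn k).s = p.s := rfl
@[simp] lemma eps_up (p : Param d) (k) : (p.up k).eps = p.eps := rfl
@[simp] lemma eps_dn (p : Param d) (k) : (p.dn k).eps = p.eps := rfl
@[simp] lemma up_dn (p : Param d) (k) : (p.dn k).up k = p := by
  cases p; simp [Param.up, Param.dn]
lemma up_up_comm (p : Param d) (j k) : (p.up j).up k = (p.up k).up j := by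
  cases p; simp only [Param.up, Param.mk.injEq, true_and]; abel
lemma dn_up_comm (p : Param d) (j k) : (p.dn k).up j = (p.up j).dn k := by
  cases p; simp only [Param.up, Param.dn, Param.mk.injEq, true_and]; abel

lemma Valid.s_pos {p : Param d} (hp : p.Valid) : 0 < p.s := by linarith [hp.s]

lemma Valid.h_le_sh {p : Param d} (hp : p.Valid) : p.h ≤ p.s * p.h := by
  have := mul_le_mul_of_nonneg_right hp.s hp.h.le; linarith

lemma Valid.sh_pos {p : Param d} (hp : p.Valid) : 0 < p.s * p.h := mul_pos hp.s_pos hp.h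

lemma Valid.sh_le_eps {p : Param d} (hp : p.Valid) : p.s * p.h ≤ p.eps := by
  have := one_div_pos.2 hp.s_pos
  unfold Param.eps; linarith

lemma Valid.h_le_eps {p : Param d} (hp : p.Valid) : p.h ≤ p.eps := hp.h_le_sh.trans hp.sh_le_eps

lemma Valid.eps_pos {p : Param d} (hp : p.Valid) : 0 < p.eps := hp.h.trans_le hp.h_le_eps

lemma Valid.eps_le {p : Param d} (hp : p.Valid) : p.eps ≤ 2 := by
  have h1 : 1 / p.s ≤ 1 := by rw [div_le_one hp.s_pos]; exact hp.s
  have := hp.sh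
  unfold Param.eps; linarith

end Param

/-- Functions bounded for each value of the convexification parameter. -/
def Bd (f : Param d → ℝ) : Prop :=
  ∃ K : ℝ → ℝ, (∀ l, 0 ≤ K l) ∧ ∀ p, p.Valid → |f p| ≤ K p.lam

/-- Functions negligible for each value of the convexification parameter. -/
def Neg (f : Param d → ℝ) : Prop :=
  ∃ K : ℝ → ℝ, (∀ l, 0 ≤ K l) ∧ ∀ p, p.Valid → |f p| ≤ K p.lam * p.eps

/-- Bounded functions varying slowly in the base point. -/
def Rg (f : Param d → ℝ) : Prop :=
  Bd f ∧ ∃ K : ℝ → ℝ, (∀ l, 0 ≤ K l) ∧ ∀ p, p.Valid → ∀ k, |f (p.up k) - f p| ≤ K p.lam * p.h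

/-- The forward difference quotient in the base point. -/
def fdP (j : Fin d) (f : Param d → ℝ) (p : Param d) : ℝ := (f (p.up j) - f p) / p.h

/-- The average in the base point. -/
def avP (j : Fin d) (f : Param d → ℝ) (p : Param d) : ℝ := (f p + f (p.up j)) / 2

section Classes

variable {f g f₁ g₁ : Param d → ℝ}

lemma Bd.congr (hf : Bd f) (hfg : ∀ p, p.Valid → g p = f p) : Bd g := by
  obtain ⟨K, h0, hK⟩ := hf
  exact ⟨K, h0, fun p hp => by rw [hfg p hp]; exact hK p hp⟩

lemma Bd.add (hf : Bd f) (hg : Bd g) : Bd fun p => f p + g p := by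
  obtain ⟨K, h0, hK⟩ := hf
  obtain ⟨L, h1, hL⟩ := hg
  exact ⟨fun l => K l + L l, fun l => add_nonneg (h0 l) (h1 l), fun p hp =>
    (abs_add_le _ _).trans (add_le_add (hK p hp) (hL p hp))⟩

lemma Bd.mul (hf : Bd f) (hg : Bd g) : Bd fun p => f p * g p := by
  obtain ⟨K, h0, hK⟩ := hf
  obtain ⟨L, h1, hL⟩ := hg
  exact ⟨fun l => K l * L l, fun l => mul_nonneg (h0 l) (h1 l), fun p hp => by
    rw [abs_mul]; exact mul_le_mul (hK p hp) (hL p hp) (abs_nonneg _) (h0 _)⟩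

lemma Bd.const (c : ℝ) : Bd fun _ : Param d => c :=
  ⟨fun _ => |c|, fun _ => abs_nonneg _, fun _ _ => le_rfl⟩

lemma Bd.dn (hf : Bd f) (k : Fin d) : Bd fun p => f (p.dn k) := by
  obtain ⟨K, h0, hK⟩ := hf
  exact ⟨K, h0, fun p hp => hK _ (hp.dn k)⟩

lemma Bd.sum {ι : Type*} (s : Finset ι) {F : ι → Param d → ℝ} (hF : ∀ i, Bd (F i)) :
    Bd fun p => ∑ i ∈ s, F i p := by
  classical
  induction s using Finset.induction_on with
  | empty => simpa using Bd.const 0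
  | insert i s hi ih => simpa [Finset.sum_insert hi] using (hF i).add ih

lemma Neg.congr (hf : Neg f) (hfg : ∀ p, p.Valid → g p = f p) : Neg g := by
  obtain ⟨K, h0, hK⟩ := hf
  exact ⟨K, h0, fun p hp => by rw [hfg p hp]; exact hK p hp⟩

lemma Neg.add (hf : Neg f) (hg : Neg g) : Neg fun p => f p + g p := by
  obtain ⟨K, h0, hK⟩ := hf
  obtain ⟨L, h1, hL⟩ := hg
  refine ⟨fun l => K l + L l, fun l => add_nonneg (h0 l) (h1 l), fun p hp =>
    (abs_add_le _ _).trans ?_⟩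
  rw [add_mul]
  exact add_le_add (hK p hp) (hL p hp)

lemma Neg.bd (hf : Neg f) : Bd f := by
  obtain ⟨K, h0, hK⟩ := hf
  exact ⟨fun l => K l * 2, fun l => mul_nonneg (h0 l) (by norm_num), fun p hp =>
    (hK p hp).trans (mul_le_mul_of_nonneg_left hp.eps_le (h0 _))⟩

lemma Bd.mul_neg (hf : Bd f) (hg : Neg g) : Neg fun p => f p * g p := by
  obtain ⟨K, h0, hK⟩ := hf
  obtain ⟨L, h1, hL⟩ := hg
  refine ⟨fun l => K l * L l, fun l => mul_nonneg (h0 l) (h1 l), fun p hp => ?_⟩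
  rw [abs_mul, mul_assoc]
  exact mul_le_mul (hK p hp) (hL p hp) (abs_nonneg _) (h0 _)

lemma Neg.up (hf : Neg f) (k : Fin d) : Neg fun p => f (p.up k) := by
  obtain ⟨K, h0, hK⟩ := hf
  exact ⟨K, h0, fun p hp => hK _ (hp.up k)⟩

lemma Neg.dn (hf : Neg f) (k : Fin d) : Neg fun p => f (p.dn k) := by
  obtain ⟨K, h0, hK⟩ := hf
  exact ⟨K, h0, fun p hp => hK _ (hp.dn k)⟩

lemma Neg.zero : Neg fun _ : Param d => 0 := ⟨fun _ => 0, fun _ => le_rfl, fun p _ => by simp⟩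

lemma Neg.sum {ι : Type*} (s : Finset ι) {F : ι → Param d → ℝ} (hF : ∀ i, Neg (F i)) :
    Neg fun p => ∑ i ∈ s, F i p := by
  classical
  induction s using Finset.induction_on with
  | empty => simpa using Neg.zero
  | insert i s hi ih => simpa [Finset.sum_insert hi] using (hF i).add ih

/-- A bound by a multiple of `h` is negligible. -/
lemma neg_of_le_h {K : ℝ → ℝ} (h0 : ∀ l, 0 ≤ K l)
    (hK : ∀ p : Param d, p.Valid → |f p| ≤ K p.lam * p.h) : Neg f :=
  ⟨K, h0, fun p hp => (hK p hp).trans (mul_le_mul_of_nonneg_left hp.h_le_eps (h0 _))⟩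

/-- A bound by a multiple of `s h` is negligible. -/
lemma neg_of_le_sh {K : ℝ → ℝ} (h0 : ∀ l, 0 ≤ K l)
    (hK : ∀ p : Param d, p.Valid → |f p| ≤ K p.lam * (p.s * p.h)) : Neg f :=
  ⟨K, h0, fun p hp => (hK p hp).trans (mul_le_mul_of_nonneg_left hp.sh_le_eps (h0 _))⟩

lemma Bd.of_neg_sub (hg : Bd g) (hfg : Neg fun p => f p - g p) : Bd f :=
  (hfg.bd.add hg).congr fun p _ => by ring

/-- Products of functions known up to negligible errors. -/
lemma Neg.mul_sub_mul (hf : Neg fun p => f p - f₁ p) (hg : Neg fun p => g p - g₁ p)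
    (hf₁ : Bd f₁) (hg₁ : Bd g₁) : Neg fun p => f p * g p - f₁ p * g₁ p :=
  (((hg₁.of_neg_sub hg).mul_neg hf).add (hf₁.mul_neg hg)).congr fun p _ => by ring

lemma Rg.bd (hf : Rg f) : Bd f := hf.1

lemma Rg.congr (hf : Rg f) (hfg : ∀ p, p.Valid → g p = f p) : Rg g := by
  obtain ⟨h1, K, h0, hK⟩ := hf
  exact ⟨h1.congr hfg, K, h0, fun p hp k => by
    rw [hfg p hp, hfg _ (hp.up k)]; exact hK p hp k⟩

lemma Rg.add (hf : Rg f) (hg : Rg g) : Rg fun p => f p + g p := by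
  obtain ⟨hf', K, h0, hK⟩ := hf
  obtain ⟨hg', L, h1, hL⟩ := hg
  refine ⟨hf'.add hg', fun l => K l + L l, fun l => add_nonneg (h0 l) (h1 l), fun p hp k => ?_⟩
  have := add_le_add (hK p hp k) (hL p hp k)
  rw [add_mul]
  refine le_trans ?_ this
  rw [add_sub_add_comm]
  exact abs_add_le _ _

lemma Rg.mul (hf : Rg f) (hg : Rg g) : Rg fun p => f p * g p := by
  obtain ⟨⟨F, hF0, hF⟩, K, h0, hK⟩ := hf
  obtain ⟨⟨G, hG0, hG⟩, L, h1, hL⟩ := hg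
  refine ⟨Bd.mul ⟨F, hF0, hF⟩ ⟨G, hG0, hG⟩, fun l => K l * G l + F l * L l, fun l =>
    add_nonneg (mul_nonneg (h0 l) (hG0 l)) (mul_nonneg (hF0 l) (h1 l)), fun p hp k => ?_⟩
  have e : f (p.up k) * g (p.up k) - f p * g p
      = (f (p.up k) - f p) * g (p.up k) + f p * (g (p.up k) - g p) := by ring
  rw [e]
  refine (abs_add_le _ _).trans ?_
  rw [abs_mul, abs_mul]
  have i1 := mul_le_mul (hK p hp k) (hG _ (hp.up k)) (abs_nonneg _)
    (mul_nonneg (h0 _) hp.h.le)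
  have i2 := mul_le_mul (hF p hp) (hL p hp k) (abs_nonneg _) (hF0 _)
  simp only [Param.lam_up] at i1
  linarith

lemma Rg.of_lam {c : ℝ → ℝ} : Rg fun p : Param d => c p.lam :=
  ⟨⟨fun l => |c l|, fun _ => abs_nonneg _, fun _ _ => le_rfl⟩, fun _ => 0, fun _ => le_rfl,
    fun p _ k => by simp⟩

lemma Rg.sum {ι : Type*} (s : Finset ι) {F : ι → Param d → ℝ} (hF : ∀ i, Rg (F i)) :
    Rg fun p => ∑ i ∈ s, F i p := by
  classical
  induction s using Finset.induction_on with
  | empty => simpa using Rg.of_lam (c := fun _ => 0)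
  | insert i s hi ih => simpa [Finset.sum_insert hi] using (hF i).add ih

lemma Rg.up (hf : Rg f) (k : Fin d) : Neg fun p => f (p.up k) - f p := by
  obtain ⟨-, K, h0, hK⟩ := hf
  exact neg_of_le_h h0 fun p hp => hK p hp k

lemma Rg.dn (hf : Rg f) (k : Fin d) : Neg fun p => f (p.dn k) - f p :=
  (((Bd.const (-1)).mul_neg (hf.up k)).dn k).congr fun p _ => by simp

lemma Rg.fdP (hf : Rg f) (k : Fin d) : Bd (fdP k f) := by
  obtain ⟨-, K, h0, hK⟩ := hf
  refine ⟨K, h0, fun p hp => ?_⟩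
  rw [DiscreteCarleman.fdP, abs_div, abs_of_pos hp.h, div_le_iff₀ hp.h]
  exact hK p hp k

lemma fdP_mul (j : Fin d) (p : Param d) :
    fdP j (fun p => f p * g p) p = fdP j f p * g (p.up j) + f p * fdP j g p := by
  simp only [fdP, div_eq_mul_inv]; ring

lemma fdP_avP (j k : Fin d) (p : Param d) : fdP k (avP j f) p = avP j (fdP k f) p := by
  simp only [fdP, avP, Param.up_up_comm p j k, Param.h_up]
  ring

lemma fdP_sum {ι : Type*} (s : Finset ι) (F : ι → Param d → ℝ) (k : Fin d) (p : Param d) :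
    fdP k (fun p => ∑ i ∈ s, F i p) p = ∑ i ∈ s, fdP k (F i) p := by
  simp only [fdP, ← Finset.sum_sub_distrib, Finset.sum_div]

lemma fdP_add (k : Fin d) (p : Param d) :
    fdP k (fun p => f p + g p) p = fdP k f p + fdP k g p := by
  simp only [fdP]; ring

lemma fdP_dn (j k : Fin d) (p : Param d) :
    fdP k (fun p => f (p.dn j)) p = fdP k f (p.dn j) := by
  simp only [fdP, Param.dn_up_comm, Param.h_dn]

end Classes

/-- Functions bounded by `C W^i`, with `C` independent of the convexification parameter, up to
negligible errors. -/
def Gr (W : Param d → ℝ) (i : ℕ) (f : Param d → ℝ) : Prop :=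
  ∃ C : ℝ, 0 ≤ C ∧ ∃ K : ℝ → ℝ, (∀ l, 0 ≤ K l) ∧
    ∀ p, p.Valid → |f p| ≤ C * W p ^ i + K p.lam * p.eps

section Graded

variable {W f g m m₁ : Param d → ℝ} {i j : ℕ}

lemma Gr.congr (hf : Gr W i f) (hfg : ∀ p, p.Valid → g p = f p) : Gr W i g := by
  obtain ⟨C, hC, K, h0, hK⟩ := hf
  exact ⟨C, hC, K, h0, fun p hp => by rw [hfg p hp]; exact hK p hp⟩

lemma Gr.add (hf : Gr W i f) (hg : Gr W i g) : Gr W i fun p => f p + g p := by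
  obtain ⟨C, hC, K, h0, hK⟩ := hf
  obtain ⟨C', hC', K', h0', hK'⟩ := hg
  refine ⟨C + C', add_nonneg hC hC', fun l => K l + K' l, fun l => add_nonneg (h0 l) (h0' l),
    fun p hp => (abs_add_le _ _).trans ((add_le_add (hK p hp) (hK' p hp)).trans
      (le_of_eq (by ring)))⟩

lemma Neg.gr (hf : Neg f) (i : ℕ) : Gr W i f := by
  obtain ⟨K, h0, hK⟩ := hf
  exact ⟨0, le_rfl, K, h0, fun p hp => by simpa using hK p hp⟩

lemma Gr.bd (hW : Bd W) (hf : Gr W i f) : Bd f := by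
  obtain ⟨C, hC, K, h0, hK⟩ := hf
  obtain ⟨L, hL0, hL⟩ := hW
  refine ⟨fun l => C * L l ^ i + K l * 2, fun l => add_nonneg (mul_nonneg hC (pow_nonneg (hL0 l) i))
    (mul_nonneg (h0 l) (by norm_num)), fun p hp => (hK p hp).trans (add_le_add ?_ ?_)⟩
  · refine mul_le_mul_of_nonneg_left ((le_abs_self _).trans ?_) hC
    rw [abs_pow]
    exact pow_le_pow_left₀ (abs_nonneg _) (hL p hp) i
  · exact mul_le_mul_of_nonneg_left hp.eps_le (h0 _)

/-- Only the product of the two leading bounds enters the constant independent of `λ`. In every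
cross term one factor is `O(ε)` and the other is bounded for each `λ`, so the cross terms go into
the `λ`-dependent error. -/
lemma Gr.mul (hW0 : ∀ p, p.Valid → 0 ≤ W p) (hW : Bd W) (hf : Gr W i f) (hg : Gr W j g) :
    Gr W (i + j) fun p => f p * g p := by
  obtain ⟨L, hL0, hL⟩ := hg.bd hW
  obtain ⟨C, hC, K, h0, hK⟩ := hf
  obtain ⟨M, hM0, hM⟩ := hW
  obtain ⟨C', hC', K', h0', hK'⟩ := hg
  refine ⟨C * C', mul_nonneg hC hC', fun l => C * M l ^ i * K' l + K l * L l, fun l =>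
    add_nonneg (mul_nonneg (mul_nonneg hC (pow_nonneg (hM0 l) i)) (h0' l))
      (mul_nonneg (h0 l) (hL0 l)), fun p hp => ?_⟩
  rw [abs_mul]
  have i0 : 0 ≤ C * W p ^ i := mul_nonneg hC (pow_nonneg (hW0 p hp) i)
  have ie := hp.eps_pos.le
  have i1 := mul_le_mul_of_nonneg_right (hK p hp) (abs_nonneg (g p))
  have i2 := mul_le_mul_of_nonneg_left (hK' p hp) i0
  have i3 := mul_le_mul_of_nonneg_left (hL p hp) (mul_nonneg (h0 p.lam) ie)
  have i4 : C * W p ^ i ≤ C * M p.lam ^ i := mul_le_mul_of_nonneg_left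
    (pow_le_pow_left₀ (hW0 p hp) ((le_abs_self _).trans (hM p hp)) i) hC
  have i5 := mul_le_mul_of_nonneg_right i4 (mul_nonneg (h0' p.lam) ie)
  rw [pow_add]
  linarith

lemma Gr.pow_self (W : Param d → ℝ) (hW0 : ∀ p, p.Valid → 0 ≤ W p) (i : ℕ) : Gr W i fun p => W p ^ i :=
  ⟨1, zero_le_one, fun _ => 0, fun _ => le_rfl, fun p hp => by
    rw [abs_of_nonneg (pow_nonneg (hW0 p hp) i)]; simp⟩

lemma Gr.of_bound {C : ℝ} (hC : ∀ p, p.Valid → |f p| ≤ C) : Gr W 0 f :=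
  ⟨|C|, abs_nonneg _, fun _ => 0, fun _ => le_rfl, fun p hp => by
    simpa using (hC p hp).trans (le_abs_self C)⟩

lemma Gr.zero : Gr W i fun _ => 0 :=
  ⟨0, le_rfl, fun _ => 0, fun _ => le_rfl, fun p _ => by simp⟩

lemma Gr.sum {ι : Type*} (s : Finset ι) {F : ι → Param d → ℝ} (hF : ∀ l, Gr W i (F l)) :
    Gr W i fun p => ∑ l ∈ s, F l p := by
  classical
  induction s using Finset.induction_on with
  | empty => simpa using Gr.zero
  | insert a s ha ih => simpa [Finset.sum_insert ha] using (hF a).add ih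

lemma Rg.pow (hf : Rg f) (i : ℕ) : Rg fun p => f p ^ i := by
  induction i with
  | zero => simpa using Rg.of_lam (c := fun _ => 1)
  | succ n ih => simpa only [pow_succ] using ih.mul hf

lemma Gr.comp {τ : Param d → Param d} (hτ : ∀ p : Param d, p.Valid → (τ p).Valid)
    (hlam : ∀ p, (τ p).lam = p.lam) (heps : ∀ p, (τ p).eps = p.eps)
    (hW : Neg fun p => W (τ p) ^ i - W p ^ i) (hf : Gr W i f) : Gr W i fun p => f (τ p) := by
  obtain ⟨C, hC, K, h0, hK⟩ := hf
  obtain ⟨L, hL0, hL⟩ := hW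
  refine ⟨C, hC, fun l => K l + C * L l, fun l => add_nonneg (h0 l) (mul_nonneg hC (hL0 l)),
    fun p hp => (hK _ (hτ p hp)).trans ?_⟩
  have := mul_le_mul_of_nonneg_left ((le_abs_self _).trans (hL p hp)) hC
  rw [hlam, heps]
  linarith

lemma Gr.up (hW : Rg W) (hf : Gr W i f) (k : Fin d) : Gr W i fun p => f (p.up k) :=
  hf.comp (fun _ hp => hp.up k) (fun _ => rfl) (fun _ => rfl) ((hW.pow i).up k)

lemma Gr.dn (hW : Rg W) (hf : Gr W i f) (k : Fin d) : Gr W i fun p => f (p.dn k) :=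
  hf.comp (fun _ hp => hp.dn k) (fun _ => rfl) (fun _ => rfl) ((hW.pow i).dn k)

lemma Gr.const (c : ℝ) : Gr W 0 fun _ => c := Gr.of_bound (C := |c|) fun _ _ => le_rfl

/-- Shifting a function which is regular up to graded errors. -/
lemma Gr.up_sub (hW : Rg W) (hm : Rg m) (hf : Gr W i fun p => f p - m p)
    (k : Fin d) : Gr W i fun p => f (p.up k) - m p :=
  ((hf.up hW k).add ((hm.up k).gr i)).congr fun p _ => by ring

lemma Gr.dn_sub (hW : Rg W) (hm : Rg m) (hf : Gr W i fun p => f p - m p)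
    (k : Fin d) : Gr W i fun p => f (p.dn k) - m p :=
  ((hf.dn hW k).add ((hm.dn k).gr i)).congr fun p _ => by ring

lemma Gr.avP_sub (hW0 : ∀ p, p.Valid → 0 ≤ W p) (hW : Rg W) (hm : Rg m) (hf : Gr W i fun p => f p - m p)
    (k : Fin d) : Gr W i fun p => avP k f p - m p :=
  (((Gr.const (1 / 2)).mul hW0 hW.bd (hf.add (hf.up_sub hW hm k))).congr
    fun p _ => by unfold avP; ring : Gr W (0 + i) _) |> (by simpa only [zero_add] using ·)

lemma Neg.avP_sub (hm : Rg m) (hf : Neg fun p => f p - m p)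
    (k : Fin d) : Neg fun p => avP k f p - m p :=
  ((Bd.const (1 / 2)).mul_neg (hf.add ((hf.up k).add (hm.up k)))).congr
    fun p _ => by unfold avP; ring

/-- Product of a function known up to graded errors with one known up to negligible errors. -/
lemma Gr.mul_sub_mul (hW0 : ∀ p, p.Valid → 0 ≤ W p) (hW : Bd W) (hf : Gr W i fun p => f p - m p)
    (hm : Bd m) (hg : Neg fun p => g p - m₁ p) (hm₁ : Gr W j m₁) :
    Gr W (i + j) fun p => f p * g p - m p * m₁ p := by
  have hgr : Gr W j g := (hm₁.add (hg.gr j)).congr fun p _ => by ring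
  exact ((hf.mul hW0 hW hgr).add ((hm.mul_neg hg).gr _)).congr fun p _ => by ring

end Graded

/-! ### The phase, the weight and the difference quotients of the weight. -/

/-- A globally defined phase `β` with its first and second partial derivatives and Lipschitz
diffusion coefficients `σ`, all bounded by a common constant. -/
structure Phase (d : ℕ) where
  β : Pt d → ℝ
  b : Fin d → Pt d → ℝ
  bb : Fin d → Fin d → Pt d → ℝ
  σ : Fin d → Pt d → ℝ
  bound : ℝ
  hasDeriv : ∀ k y t, HasDerivAt (fun t : ℝ => β (y + t • uv k)) (b k (y + t • uv k)) t
  hasDeriv_b : ∀ j k y t, HasDerivAt (fun t : ℝ => b k (y + t • uv j)) (bb j k (y + t • uv j)) t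
  β_le : ∀ y, |β y| ≤ bound
  b_le : ∀ k y, |b k y| ≤ bound
  bb_le : ∀ j k y, |bb j k y| ≤ bound
  σ_le : ∀ k y, |σ k y| ≤ bound
  bb_lip : ∀ j k l y (t : ℝ), 0 ≤ t → |bb j k (y + t • uv l) - bb j k y| ≤ bound * t
  σ_lip : ∀ k l y (t : ℝ), 0 ≤ t → |σ k (y + t • uv l) - σ k y| ≤ bound * t

lemma exists_slope {f f' : ℝ → ℝ} (hf : ∀ t, HasDerivAt f (f' t) t) {h : ℝ} (hh : 0 < h) :
    ∃ t, 0 < t ∧ t < h ∧ f h - f 0 = h * f' t := by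
  obtain ⟨t, ht, h1⟩ := exists_hasDerivAt_eq_slope f f' hh
    (fun t _ => (hf t).continuousAt.continuousWithinAt) (fun t _ => hf t)
  refine ⟨t, ht.1, ht.2, ?_⟩
  rw [h1, sub_zero]
  field_simp

namespace Phase

variable (P : Phase d)

lemma bound_nonneg : 0 ≤ P.bound := (abs_nonneg _).trans (P.β_le 0)

/-- The Carleman weight `φ = e^{λβ}`. -/
def ph (p : Param d) : ℝ := Real.exp (p.lam * P.β p.y)

/-- `Φ = λφ`. -/
def Ph (p : Param d) : ℝ := p.lam * P.ph p

/-- The phase gradient. -/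
def B1 (k : Fin d) (p : Param d) : ℝ := P.b k p.y

/-- The phase Hessian. -/
def B2 (j k : Fin d) (p : Param d) : ℝ := P.bb j k p.y

/-- The diffusion coefficient on the edge in direction `k` issued from the base point. -/
def A (k : Fin d) (p : Param d) : ℝ := P.σ k (p.y + (p.h / 2) • uv k)

/-- The difference quotient of the weight. -/
def q (k : Fin d) : Param d → ℝ := fdP k P.ph

/-- `sinh θ / (s h)`. -/
def sh (k : Fin d) (p : Param d) : ℝ := Real.sinh (p.s * p.h * P.q k p) / (p.s * p.h)

/-- `cosh θ`. -/
def ch (k : Fin d) (p : Param d) : ℝ := Real.cosh (p.s * p.h * P.q k p)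

/-- `(cosh θ - 1) / (s h)²`. -/
def c2 (k : Fin d) (p : Param d) : ℝ := (Real.cosh (p.s * p.h * P.q k p) - 1) / (p.s * p.h) ^ 2

/-- Transport coefficient, divided by `s`. -/
def Bh (k : Fin d) (p : Param d) : ℝ := P.A k p * P.sh k p

/-- Diffusion coefficient of the symmetric part. -/
def al (k : Fin d) (p : Param d) : ℝ := P.A k p * P.ch k p

/-- Potential of the symmetric part, divided by `s²`. -/
def mu (p : Param d) : ℝ := ∑ j, (P.A j p * P.c2 j p + P.A j (p.dn j) * P.c2 j (p.dn j))

/-- `∑ a_k b_k²`. -/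
def gm (p : Param d) : ℝ := ∑ k, P.A k p * P.B1 k p ^ 2

/-- Zeroth order coefficient of the multiplier, divided by `s`. -/
def Gh (p : Param d) : ℝ := 2 * p.lam * P.Ph p * P.gm p

lemma ph_pos (p : Param d) : 0 < P.ph p := Real.exp_pos _

lemma ph_bd : Bd P.ph := by
  refine ⟨fun l => Real.exp (l * P.bound), fun l => (Real.exp_pos _).le, fun p hp => ?_⟩
  rw [abs_of_pos (P.ph_pos p)]
  refine Real.exp_le_exp.2 (mul_le_mul_of_nonneg_left ((le_abs_self _).trans (P.β_le _)) ?_)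
  linarith [hp.lam]

lemma lam_bd : Bd fun p : Param d => p.lam := (Rg.of_lam (c := fun l => l)).bd

lemma Ph_bd : Bd P.Ph := lam_bd.mul P.ph_bd

lemma Ph_nonneg (p : Param d) (hp : p.Valid) : 0 ≤ P.Ph p :=
  mul_nonneg (by linarith [hp.lam]) (P.ph_pos p).le

lemma B1_bd (k) : Bd (P.B1 k) := ⟨fun _ => P.bound, fun _ => P.bound_nonneg, fun _ _ => P.b_le _ _⟩

lemma B2_bd (j k) : Bd (P.B2 j k) :=
  ⟨fun _ => P.bound, fun _ => P.bound_nonneg, fun _ _ => P.bb_le _ _ _⟩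

lemma A_bd (k) : Bd (P.A k) := ⟨fun _ => P.bound, fun _ => P.bound_nonneg, fun _ _ => P.σ_le _ _⟩

lemma B2_rg (j k) : Rg (P.B2 j k) :=
  ⟨P.B2_bd j k, fun _ => P.bound, fun _ => P.bound_nonneg, fun p hp l =>
    P.bb_lip j k l p.y p.h hp.h.le⟩

lemma B1_rg (k) : Rg (P.B1 k) := by
  refine ⟨P.B1_bd k, fun _ => P.bound, fun _ => P.bound_nonneg, fun p hp l => ?_⟩
  obtain ⟨t, -, -, ht⟩ := exists_slope (P.hasDeriv_b l k p.y) hp.h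
  simp only [zero_smul, add_zero] at ht
  change |P.b k (p.y + p.h • uv l) - P.b k p.y| ≤ _
  rw [ht, abs_mul, abs_of_pos hp.h, mul_comm]
  exact mul_le_mul_of_nonneg_right (P.bb_le _ _ _) hp.h.le

lemma abs_A_up_sub {p : Param d} (hp : p.Valid) (j k) :
    |P.A k (p.up j) - P.A k p| ≤ P.bound * p.h := by
  have := P.σ_lip k j (p.y + (p.h / 2) • uv k) p.h hp.h.le
  rwa [add_right_comm] at this

lemma A_rg (k) : Rg (P.A k) :=
  ⟨P.A_bd k, fun _ => P.bound, fun _ => P.bound_nonneg, fun _ hp l => P.abs_A_up_sub hp l k⟩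

lemma hasDeriv_ph (k : Fin d) (l : ℝ) (y : Pt d) (t : ℝ) :
    HasDerivAt (fun t : ℝ => Real.exp (l * P.β (y + t • uv k)))
      (l * Real.exp (l * P.β (y + t • uv k)) * P.b k (y + t • uv k)) t := by
  refine (((P.hasDeriv k y t).const_mul l).exp).congr_deriv ?_
  ring

lemma ph_rg : Rg P.ph := by
  refine ⟨P.ph_bd, ?_⟩
  obtain ⟨K, h0, hK⟩ := P.ph_bd
  refine ⟨fun l => |l| * K l * P.bound, fun l => mul_nonneg (mul_nonneg (abs_nonneg _) (h0 l))
    P.bound_nonneg, fun p hp k => ?_⟩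
  obtain ⟨t, -, -, ht⟩ := exists_slope (P.hasDeriv_ph k p.lam p.y) hp.h
  simp only [zero_smul, add_zero] at ht
  change |Real.exp (p.lam * P.β (p.y + p.h • uv k)) - Real.exp (p.lam * P.β p.y)| ≤ _
  rw [ht, abs_mul, abs_of_pos hp.h, mul_comm]
  refine mul_le_mul_of_nonneg_right ?_ hp.h.le
  rw [abs_mul, abs_mul]
  exact mul_le_mul (mul_le_mul_of_nonneg_left (hK { p with y := p.y + t • uv k }
    ⟨hp.lam, hp.h, hp.s, hp.sh⟩) (abs_nonneg _)) (P.b_le _ _) (abs_nonneg _)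
    (mul_nonneg (abs_nonneg _) (h0 _))

lemma lam_rg : Rg fun p : Param d => p.lam := Rg.of_lam (c := fun l => l)

lemma Ph_rg : Rg P.Ph := lam_rg.mul P.ph_rg

lemma gm_rg : Rg P.gm := Rg.sum _ fun k => (P.A_rg k).mul ((P.B1_rg k).pow 2)

/-- The first derivatives of the weight. -/
def f1 (k : Fin d) (p : Param d) : ℝ := P.Ph p * P.B1 k p

/-- The second derivatives of the weight. -/
def f2 (j k : Fin d) (p : Param d) : ℝ :=
  p.lam * P.Ph p * (P.B1 j p * P.B1 k p) + P.Ph p * P.B2 j k p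

lemma f1_rg (k) : Rg (P.f1 k) := P.Ph_rg.mul (P.B1_rg k)

lemma f2_rg (j k) : Rg (P.f2 j k) :=
  ((lam_rg.mul P.Ph_rg).mul ((P.B1_rg j).mul (P.B1_rg k))).add (P.Ph_rg.mul (P.B2_rg j k))

lemma q_neg (k) : Neg fun p => P.q k p - P.f1 k p := by
  obtain ⟨-, K, h0, hK⟩ := P.f1_rg k
  refine neg_of_le_h h0 fun p hp => ?_
  obtain ⟨t, t0, t1, ht⟩ := exists_slope (P.hasDeriv_ph k p.lam p.y) hp.h
  simp only [zero_smul, add_zero] at ht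
  -- The derivatives of the weight do not involve the mesh size, and regularity holds for every
  -- admissible mesh size. It may therefore be applied with mesh size `t < h`, which reaches the
  -- intermediate point of the mean value theorem.
  have h1 : P.q k p = P.f1 k (Param.up k { p with h := t }) := by
    change (Real.exp (p.lam * P.β (p.y + p.h • uv k)) - Real.exp (p.lam * P.β p.y)) / p.h = _
    rw [ht, mul_div_cancel_left₀ _ hp.h.ne']; rfl
  have h2 := hK { p with h := t } ⟨hp.lam, t0, hp.s, by
    have := mul_le_mul_of_nonneg_left t1.le hp.s_pos.le; exact this.trans hp.sh⟩ k
  rw [h1]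
  exact h2.trans (mul_le_mul_of_nonneg_left t1.le (h0 _))

lemma hasDeriv_f1 (j k : Fin d) (p : Param d) (t : ℝ) :
    HasDerivAt (fun t : ℝ => P.f1 k { p with y := p.y + t • uv j })
      (P.f2 j k { p with y := p.y + t • uv j }) t := by
  refine (((P.hasDeriv_ph j p.lam p.y t).const_mul p.lam).mul
    (P.hasDeriv_b j k p.y t)).congr_deriv ?_
  simp only [f2, Ph, ph, B1, B2]
  ring

/-- The mixed second difference is a value of `∂_j∂_kφ` at an intermediate point: the mean value
theorem is applied in direction `k` to the increment of the weight along `e_j`, and then in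
direction `j` to its first derivative. -/
lemma fdP_q_neg (j k) : Neg fun p => fdP j (P.q k) p - P.f2 j k p := by
  obtain ⟨-, K, h0, hK⟩ := P.f2_rg j k
  refine neg_of_le_h (K := fun l => 2 * K l) (fun l => mul_nonneg (by norm_num) (h0 l))
    fun p hp => ?_
  obtain ⟨t, t0, t1, ht⟩ := exists_slope (fun t =>
    (P.hasDeriv_ph k p.lam (p.y + p.h • uv j) t).sub (P.hasDeriv_ph k p.lam p.y t)) hp.h
  obtain ⟨r, r0, r1, hr⟩ := exists_slope (P.hasDeriv_f1 j k { p with y := p.y + t • uv k }) hp.h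
  simp only [zero_smul, add_zero, Pi.sub_apply] at ht hr
  have h1 : fdP j (P.q k) p
      = P.f2 j k (Param.up j { (Param.up k { p with h := t }) with h := r }) := by
    have e1 : fdP j (P.q k) p = (Real.exp (p.lam * P.β (p.y + p.h • uv j + p.h • uv k))
        - Real.exp (p.lam * P.β (p.y + p.h • uv k))
        - (Real.exp (p.lam * P.β (p.y + p.h • uv j)) - Real.exp (p.lam * P.β p.y)))
        / (p.h * p.h) := by
      simp only [fdP, q, ph, Param.up]
      have := hp.h.ne'
      field_simp
      ring
    have e2 : P.f1 k { lam := p.lam, h := p.h, s := p.s, y := p.y + t • uv k + p.h • uv j }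
        - P.f1 k { lam := p.lam, h := p.h, s := p.s, y := p.y + t • uv k }
        = p.lam * Real.exp (p.lam * P.β (p.y + p.h • uv j + t • uv k))
            * P.b k (p.y + p.h • uv j + t • uv k)
          - p.lam * Real.exp (p.lam * P.β (p.y + t • uv k)) * P.b k (p.y + t • uv k) := by
      rw [add_right_comm p.y (t • uv k)]; rfl
    rw [e1, ht, ← e2, hr, ← mul_assoc, mul_div_cancel_left₀ _ (mul_pos hp.h hp.h).ne']
    rfl
  have sh' : ∀ t, t < p.h → p.s * t ≤ 1 := fun t t1 =>
    (mul_le_mul_of_nonneg_left t1.le hp.s_pos.le).trans hp.sh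
  have h2 := hK { p with h := t } ⟨hp.lam, t0, hp.s, sh' t t1⟩ k
  have h3 := hK { (Param.up k { p with h := t }) with h := r } ⟨hp.lam, r0, hp.s, sh' r r1⟩ j
  rw [h1]
  have i1 := mul_le_mul_of_nonneg_left t1.le (h0 p.lam)
  have i2 := mul_le_mul_of_nonneg_left r1.le (h0 p.lam)
  have i3 := abs_sub_le (P.f2 j k (Param.up j { (Param.up k { p with h := t }) with h := r }))
    (P.f2 j k (Param.up k { p with h := t })) (P.f2 j k p)
  refine i3.trans ?_
  refine (add_le_add (h3.trans i2) (h2.trans i1)).trans (le_of_eq (by ring))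

lemma q_bd (k) : Bd (P.q k) := (P.f1_rg k).bd.of_neg_sub (P.q_neg k)

lemma fdP_q_bd (j k) : Bd (fdP j (P.q k)) := (P.f2_rg j k).bd.of_neg_sub (P.fdP_q_neg j k)

/-- Difference quotients of a function of `q` that is Lipschitz with small constant. -/
lemma neg_of_scaled {F : ℝ → ℝ → ℝ} {L : ℝ → ℝ} (hL : ∀ M, 0 ≤ M → 0 ≤ L M)
    (hF : ∀ δ M t t', 0 < δ → δ ≤ 1 → |t| ≤ M → |t'| ≤ M →
      |F δ t' - F δ t| ≤ δ * L M * |t' - t|) (j k : Fin d) :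
    Neg (fdP j fun p => F (p.s * p.h) (P.q k p)) := by
  obtain ⟨K, h0, hK⟩ := P.q_bd k
  obtain ⟨R, hR0, hR⟩ := P.fdP_q_bd j k
  refine neg_of_le_sh (K := fun l => L (K l) * R l) (fun l => mul_nonneg (hL _ (h0 l)) (hR0 l))
    fun p hp => ?_
  have h1 := hF (p.s * p.h) (K p.lam) (P.q k p) (P.q k (p.up j)) hp.sh_pos hp.sh (hK p hp)
    (hK _ (hp.up j))
  have h2 := hR p hp
  rw [fdP, abs_div, abs_of_pos hp.h, div_le_iff₀ hp.h] at h2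
  rw [fdP, abs_div, abs_of_pos hp.h, div_le_iff₀ hp.h]
  refine h1.trans ((mul_le_mul_of_nonneg_left h2
    (mul_nonneg hp.sh_pos.le (hL _ (h0 p.lam)))).trans (le_of_eq (by ring)))

lemma neg_of_scaled_sub {F : ℝ → ℝ → ℝ} {L : ℝ → ℝ} (hL : ∀ M, 0 ≤ M → 0 ≤ L M)
    (hF : ∀ δ M t, 0 < δ → δ ≤ 1 → |t| ≤ M → |F δ t| ≤ δ * L M) (k : Fin d) :
    Neg fun p => F (p.s * p.h) (P.q k p) := by
  obtain ⟨K, h0, hK⟩ := P.q_bd k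
  refine neg_of_le_sh (K := fun l => L (K l)) (fun l => hL _ (h0 l)) fun p hp => ?_
  exact (hF _ _ _ hp.sh_pos hp.sh (hK p hp)).trans (le_of_eq (by ring))

lemma cosh_mul_nonneg {M : ℝ} (hM : 0 ≤ M) : 0 ≤ Real.cosh M * M :=
  mul_nonneg (Real.cosh_pos M).le hM

lemma sh_neg (k) : Neg fun p => P.sh k p - P.f1 k p :=
  ((P.neg_of_scaled_sub (F := fun δ t => Real.sinh (δ * t) / δ - t)
    (L := fun M => Real.cosh M * M * M) (fun _ hM => mul_nonneg (cosh_mul_nonneg hM) hM)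
    (fun _ _ _ h0 h1 => sinh_scaled_sub h0 h1) k).add (P.q_neg k)).congr fun p _ => by
      simp only [sh]; ring

lemma fdP_sh_neg (j k) : Neg fun p => fdP j (P.sh k) p - P.f2 j k p :=
  ((P.neg_of_scaled (F := fun δ t => Real.sinh (δ * t) / δ - t)
    (L := fun M => Real.cosh M * M) (fun _ hM => cosh_mul_nonneg hM)
    (fun _ _ _ _ h0 h1 => sinh_scaled_lipschitz h0 h1) j k).add (P.fdP_q_neg j k)).congr
      fun p _ => by simp only [sh, fdP, Param.s_up, Param.h_up]; ring

lemma ch_neg (k) : Neg fun p => P.ch k p - 1 :=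
  P.neg_of_scaled_sub (F := fun δ t => Real.cosh (δ * t) - 1)
    (L := fun M => Real.cosh M * M) (fun _ hM => cosh_mul_nonneg hM)
    (fun _ _ _ h0 h1 => cosh_scaled_sub_one h0 h1) k

lemma fdP_ch_neg (j k) : Neg (fdP j (P.ch k)) :=
  P.neg_of_scaled (F := fun δ t => Real.cosh (δ * t))
    (L := fun M => Real.cosh M) (fun M _ => (Real.cosh_pos M).le)
    (fun _ _ _ _ h0 h1 => cosh_scaled_lipschitz h0 h1) j k

lemma c2_neg (k) : Neg fun p => P.c2 k p - P.f1 k p ^ 2 / 2 :=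
  ((P.neg_of_scaled_sub (F := fun δ t => (Real.cosh (δ * t) - 1) / δ ^ 2 - t ^ 2 / 2)
    (L := fun M => Real.cosh M * M * M * M)
    (fun _ hM => mul_nonneg (mul_nonneg (cosh_mul_nonneg hM) hM) hM)
    (fun _ _ _ h0 h1 => cosh_quadratic_sub h0 h1) k).add ((Bd.const (1 / 2)).mul_neg
      ((P.q_neg k).mul_sub_mul (P.q_neg k) (P.f1_rg k).bd (P.f1_rg k).bd))).congr fun p _ => by
      simp only [c2]; ring

/-- Modulo the hyperbolic remainder, `c2` is `q²/2`, whose difference quotient is exactly `fdP q`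
times the average of `q`. -/
lemma fdP_c2_neg (j k) : Neg fun p => fdP j (P.c2 k) p - P.f2 j k p * P.f1 k p := by
  have h1 := P.neg_of_scaled (F := fun δ t => (Real.cosh (δ * t) - 1) / δ ^ 2 - t ^ 2 / 2)
    (L := fun M => Real.cosh M * M * M) (fun _ hM => mul_nonneg (cosh_mul_nonneg hM) hM)
    (fun _ _ _ _ h0 h1 => cosh_quadratic_lipschitz h0 h1) j k
  have h2 := (P.fdP_q_neg j k).mul_sub_mul ((P.q_neg k).avP_sub (P.f1_rg k) j)
    (P.f2_rg j k).bd (P.f1_rg k).bd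
  refine (h1.add h2).congr fun p _ => ?_
  simp only [c2, fdP, avP, Param.s_up, Param.h_up]
  ring

end Phase

/-! ### Principal parts of the coefficients of the conjugated operator. -/

namespace Phase

variable (P : Phase d)

variable {P} in
lemma gr_mul {i j : ℕ} {f g : Param d → ℝ} (hf : Gr P.Ph i f) (hg : Gr P.Ph j g) :
    Gr P.Ph (i + j) fun p => f p * g p := hf.mul P.Ph_nonneg P.Ph_bd hg

variable {P} in
/-- Multiplication by a function of degree zero. -/
lemma gr_mul_left {i : ℕ} {f g : Param d → ℝ} (hf : Gr P.Ph 0 f) (hg : Gr P.Ph i g) :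
    Gr P.Ph i fun p => f p * g p := by simpa only [zero_add] using gr_mul hf hg

variable {P} in
lemma gr_mul_right {i : ℕ} {f g : Param d → ℝ} (hf : Gr P.Ph i f) (hg : Gr P.Ph 0 g) :
    Gr P.Ph i fun p => f p * g p := by simpa only [add_zero] using gr_mul hf hg

lemma A_gr (k) : Gr P.Ph 0 (P.A k) := Gr.of_bound fun _ _ => P.σ_le _ _

lemma B1_gr (k) : Gr P.Ph 0 (P.B1 k) := Gr.of_bound fun _ _ => P.b_le _ _

lemma B2_gr (j k) : Gr P.Ph 0 (P.B2 j k) := Gr.of_bound fun _ _ => P.bb_le _ _ _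

lemma fdP_A_gr (j k) : Gr P.Ph 0 (fdP j (P.A k)) := by
  refine Gr.of_bound (C := P.bound) fun p hp => ?_
  rw [fdP, abs_div, abs_of_pos hp.h, div_le_iff₀ hp.h]
  exact P.abs_A_up_sub hp j k

lemma Ph_gr : Gr P.Ph 1 P.Ph := by simpa only [pow_one] using Gr.pow_self P.Ph P.Ph_nonneg 1

lemma f1_gr (k) : Gr P.Ph 1 (P.f1 k) := gr_mul_right P.Ph_gr (P.B1_gr k)

lemma gm_gr : Gr P.Ph 0 P.gm :=
  Gr.sum _ fun k => gr_mul_left (P.A_gr k)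
    ((gr_mul_left (P.B1_gr k) (P.B1_gr k)).congr fun p _ => by ring)

/-- Principal part of the Hessian of the weight. -/
def h0 (j k : Fin d) (p : Param d) : ℝ := p.lam * P.Ph p * (P.B1 j p * P.B1 k p)

lemma h0_rg (j k) : Rg (P.h0 j k) :=
  (lam_rg.mul P.Ph_rg).mul ((P.B1_rg j).mul (P.B1_rg k))

lemma f2_gr (j k) : Gr P.Ph 1 fun p => P.f2 j k p - P.h0 j k p :=
  (gr_mul_right P.Ph_gr (P.B2_gr j k)).congr fun p _ => by simp only [f2, h0]; ring

lemma sh_gr (k) : Gr P.Ph 1 (P.sh k) :=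
  ((P.f1_gr k).add ((P.sh_neg k).gr 1)).congr fun p _ => by ring

lemma Bh_neg (k) : Neg fun p => P.Bh k p - P.A k p * P.f1 k p :=
  ((P.A_bd k).mul_neg (P.sh_neg k)).congr fun p _ => by simp only [Bh]; ring

lemma Bh_gr (k) : Gr P.Ph 1 (P.Bh k) := gr_mul_left (P.A_gr k) (P.sh_gr k)

/-- Differentiating the weight twice produces `λΦ b_j b_k`. Differences of the diffusion coefficient
and second derivatives of `β` produce only `O(Φ)`, without the extra `λ`. This gain of one power of
`λ` is what convexification provides. -/
lemma fdP_Bh_gr (j k) : Gr P.Ph 1 fun p => fdP j (P.Bh k) p - P.A k p * P.h0 j k p := by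
  have h1 := gr_mul_left (P.fdP_A_gr j k) ((P.sh_gr k).up P.Ph_rg j)
  have h2 := gr_mul_left (P.A_gr k) (((P.fdP_sh_neg j k).gr 1).add (P.f2_gr j k))
  refine (h1.add h2).congr fun p _ => ?_
  have := fdP_mul (f := P.A k) (g := P.sh k) j p
  change fdP j (P.Bh k) p = _ at this
  rw [this]; ring

lemma al_neg (k) : Neg fun p => P.al k p - P.A k p :=
  ((P.A_bd k).mul_neg (P.ch_neg k)).congr fun p _ => by simp only [al]; ring

lemma fdP_al_gr (j k) : Gr P.Ph 0 (fdP j (P.al k)) := by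
  have hch : Gr P.Ph 0 (P.ch k) :=
    ((Gr.const 1).add ((P.ch_neg k).gr 0)).congr fun p _ => by ring
  refine ((gr_mul_left (P.fdP_A_gr j k) (hch.up P.Ph_rg j)).add
    (gr_mul_left (P.A_gr k) ((P.fdP_ch_neg j k).gr 0))).congr fun p _ => ?_
  exact fdP_mul (f := P.A k) (g := P.ch k) j p

/-- Each of the two edges in direction `j` at a vertex contributes about `a_j (Φ b_j)² / 2`. -/
lemma mu_neg : Neg fun p => P.mu p - P.Ph p ^ 2 * P.gm p := by
  have h1 : ∀ j, Neg fun p => P.A j p * P.c2 j p - P.A j p * (P.f1 j p ^ 2 / 2) := fun j =>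
    ((P.A_bd j).mul_neg (P.c2_neg j)).congr fun p _ => by ring
  have h2 : ∀ j, Rg fun p => P.A j p * (P.f1 j p ^ 2 / 2) := fun j =>
    ((P.A_rg j).mul (((P.f1_rg j).pow 2).mul (Rg.of_lam (c := fun _ => 1 / 2)))).congr
      fun p _ => by ring
  refine (Neg.sum Finset.univ fun j => (h1 j).add (((h1 j).dn j).add ((h2 j).dn j))).congr
    fun p _ => ?_
  simp only [mu, gm, f1, Finset.mul_sum, ← Finset.sum_sub_distrib]
  exact Finset.sum_congr rfl fun j _ => by ring

lemma fdP_mu_gr (k) :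
    Gr P.Ph 2 fun p => fdP k P.mu p - 2 * p.lam * P.Ph p ^ 2 * P.gm p * P.B1 k p := by
  have hm : ∀ j, Rg fun p => P.A j p * (P.h0 k j p * P.f1 j p) := fun j =>
    (P.A_rg j).mul ((P.h0_rg k j).mul (P.f1_rg j))
  have hc2 : ∀ j, Gr P.Ph 2 (P.c2 j) := fun j =>
    (((gr_mul (P.f1_gr j) (gr_mul_right (P.f1_gr j) (Gr.const (1 / 2)))).add
      ((P.c2_neg j).gr 2)).congr fun p _ => by ring)
  have h1 : ∀ j, Gr P.Ph 2 fun p => fdP k (fun p => P.A j p * P.c2 j p) p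
      - P.A j p * (P.h0 k j p * P.f1 j p) := by
    intro j
    have i1 := gr_mul_left (P.fdP_A_gr k j) ((hc2 j).up P.Ph_rg k)
    have i2 := gr_mul_left (P.A_gr j) (((P.fdP_c2_neg k j).gr 2).add
      (gr_mul (P.f2_gr k j) (P.f1_gr j)))
    refine (i1.add i2).congr fun p _ => ?_
    rw [fdP_mul]; ring
  refine (Gr.sum Finset.univ fun j => (h1 j).add ((h1 j).dn_sub P.Ph_rg (hm j) j |>.congr
    (g := fun p => fdP k (fun p => P.A j p * P.c2 j p) (p.dn j)
      - P.A j p * (P.h0 k j p * P.f1 j p)) ?_)).congr fun p _ => ?_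
  · intro p _; rfl
  have e : fdP k P.mu p = ∑ j, (fdP k (fun p => P.A j p * P.c2 j p) p
      + fdP k (fun p => P.A j p * P.c2 j p) (p.dn j)) := by
    unfold mu
    rw [fdP_sum]
    refine Finset.sum_congr rfl fun j _ => ?_
    rw [fdP_add, ← fdP_dn]
  rw [e]
  simp only [gm, f1, h0, Finset.mul_sum, Finset.sum_mul, ← Finset.sum_sub_distrib]
  exact Finset.sum_congr rfl fun j _ => by ring

/-- When the product is differentiated, only the transport factor contributes at order `λΦ`; the
difference quotient of `al` is bounded uniformly in `λ`, up to negligible terms. -/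
lemma divergence_gr (j k) :
    Gr P.Ph 1 fun p => fdP k (fun p => avP j (P.Bh k) p * avP k (P.al j) p) (p.dn k)
      - p.lam * P.Ph p * (P.A j p * (P.A k p * P.B1 k p ^ 2)) := by
  have hm : Rg fun p => P.A k p * P.h0 k k p := (P.A_rg k).mul (P.h0_rg k k)
  have h1 : Gr P.Ph 1 fun p => avP j (fdP k (P.Bh k)) p - P.A k p * P.h0 k k p :=
    (P.fdP_Bh_gr k k).avP_sub P.Ph_nonneg P.Ph_rg hm j
  have h2 : Neg fun p => avP k (P.al j) (p.up k) - P.A j p :=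
    ((((P.al_neg j).avP_sub (P.A_rg j) k).up k).add ((P.A_rg j).up k)).congr fun p _ => by ring
  have h3 := h1.mul_sub_mul P.Ph_nonneg P.Ph_bd hm.bd h2 (P.A_gr j)
  have h4 : Gr P.Ph 1 (avP j (P.Bh k)) :=
    (gr_mul_left (Gr.const (1 / 2)) ((P.Bh_gr k).add ((P.Bh_gr k).up P.Ph_rg j))).congr
      fun p _ => by simp only [avP]; ring
  have h5 : Gr P.Ph 0 (avP k (fdP k (P.al j))) :=
    (gr_mul_left (Gr.const (1 / 2)) ((P.fdP_al_gr k j).add ((P.fdP_al_gr k j).up P.Ph_rg k))).congr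
      fun p _ => by simp only [avP]; ring
  have h6 : Gr P.Ph 1 fun p => fdP k (fun p => avP j (P.Bh k) p * avP k (P.al j) p) p
      - p.lam * P.Ph p * (P.A j p * (P.A k p * P.B1 k p ^ 2)) := by
    refine (h3.add (gr_mul_right h4 h5)).congr fun p _ => ?_
    rw [fdP_mul, fdP_avP, fdP_avP]
    simp only [h0]; ring
  have h7 : Rg fun p => p.lam * P.Ph p * (P.A j p * (P.A k p * P.B1 k p ^ 2)) :=
    (lam_rg.mul P.Ph_rg).mul ((P.A_rg j).mul ((P.A_rg k).mul ((P.B1_rg k).pow 2)))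
  exact h6.dn_sub P.Ph_rg h7 k

lemma drift_gr (j k) : Gr P.Ph 1 fun p => avP j (P.Bh k) p * fdP k (P.al j) p := by
  have h4 : Gr P.Ph 1 (avP j (P.Bh k)) :=
    (gr_mul_left (Gr.const (1 / 2)) ((P.Bh_gr k).add ((P.Bh_gr k).up P.Ph_rg j))).congr
      fun p _ => by simp only [avP]; ring
  exact gr_mul_right h4 (P.fdP_al_gr k j)

/-- Principal part of the Hessian form. -/
def tau (j k : Fin d) (p : Param d) : ℝ :=
  p.lam * P.Ph p * ((P.A j p * P.B1 j p) * (P.A k p * P.B1 k p))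

lemma tau_rg (j k) : Rg (P.tau j k) :=
  (lam_rg.mul P.Ph_rg).mul (((P.A_rg j).mul (P.B1_rg j)).mul ((P.A_rg k).mul (P.B1_rg k)))

lemma hessian_gr (j k) : Gr P.Ph 1 fun p => P.al j p * fdP j (P.Bh k) p - P.tau j k p := by
  have hm : Rg fun p => P.A k p * P.h0 j k p := (P.A_rg k).mul (P.h0_rg j k)
  refine ((P.fdP_Bh_gr j k).mul_sub_mul P.Ph_nonneg P.Ph_bd hm.bd (P.al_neg j) (P.A_gr j)).congr
    fun p _ => ?_
  simp only [tau, h0]; ring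

lemma hessian_sub_gr (j k) :
    Gr P.Ph 1 fun p => P.al j p * fdP j (P.Bh k) (p.dn k) - P.tau j k p := by
  have hm : Rg fun p => P.A k p * P.h0 j k p := (P.A_rg k).mul (P.h0_rg j k)
  refine (((P.fdP_Bh_gr j k).dn_sub P.Ph_rg hm k).mul_sub_mul P.Ph_nonneg P.Ph_bd hm.bd
    (P.al_neg j) (P.A_gr j)).congr fun p _ => ?_
  simp only [tau, h0]; ring

/-- The factor `3` is `1 + 2`: the derivative falls once on `Bh`, which is linear in `Φ`, and once
on `mu`, which is quadratic in `Φ`. Summing `a_k b_k²` over `k` supplies the second factor `gm`. -/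
lemma potential_gr :
    Gr P.Ph 3 fun p => ∑ k, fdP k (fun p => P.Bh k p * avP k P.mu p) (p.dn k)
      - 3 * p.lam * P.Ph p ^ 3 * P.gm p ^ 2 := by
  have hmm : Rg fun p => P.Ph p ^ 2 * P.gm p := (P.Ph_rg.pow 2).mul P.gm_rg
  have h1 : ∀ k, Gr P.Ph 3 fun p => fdP k (fun p => P.Bh k p * avP k P.mu p) p
      - 3 * p.lam * P.Ph p ^ 3 * P.gm p * (P.A k p * P.B1 k p ^ 2) := by
    intro k
    have hm : Rg fun p => P.A k p * P.h0 k k p := (P.A_rg k).mul (P.h0_rg k k)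
    have i1 : Neg fun p => avP k P.mu (p.up k) - P.Ph p ^ 2 * P.gm p :=
      (((P.mu_neg.avP_sub hmm k).up k).add (hmm.up k)).congr fun p _ => by ring
    have i2 := (P.fdP_Bh_gr k k).mul_sub_mul P.Ph_nonneg P.Ph_bd hm.bd i1
      (gr_mul_right (Gr.pow_self P.Ph P.Ph_nonneg 2) P.gm_gr)
    have hm2 : Rg fun p => 2 * p.lam * P.Ph p ^ 2 * P.gm p * P.B1 k p :=
      (((Rg.of_lam (c := fun l => 2 * l)).mul (P.Ph_rg.pow 2)).mul P.gm_rg).mul (P.B1_rg k)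
    have i3 := (P.fdP_mu_gr k).avP_sub P.Ph_nonneg P.Ph_rg hm2 k
    have i4 := i3.mul_sub_mul P.Ph_nonneg P.Ph_bd hm2.bd (P.Bh_neg k)
      (gr_mul_left (P.A_gr k) (P.f1_gr k))
    refine (i2.add i4).congr fun p _ => ?_
    rw [fdP_mul, fdP_avP]
    simp only [h0, f1]; ring
  have h2 : ∀ k, Rg fun p => 3 * p.lam * P.Ph p ^ 3 * P.gm p * (P.A k p * P.B1 k p ^ 2) := fun k =>
    (((Rg.of_lam (c := fun l => 3 * l)).mul (P.Ph_rg.pow 3)).mul P.gm_rg).mul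
      ((P.A_rg k).mul ((P.B1_rg k).pow 2))
  refine (Gr.sum Finset.univ fun k => (h1 k).dn_sub P.Ph_rg (h2 k) k).congr fun p _ => ?_
  rw [Finset.sum_sub_distrib, ← Finset.mul_sum]
  simp only [gm]
  ring

lemma potential_drift_bd (k) : Bd fun p => P.Bh k p * fdP k P.mu p := by
  have hm2 : Rg fun p => 2 * p.lam * P.Ph p ^ 2 * P.gm p * P.B1 k p :=
    (((Rg.of_lam (c := fun l => 2 * l)).mul (P.Ph_rg.pow 2)).mul P.gm_rg).mul (P.B1_rg k)
  exact ((P.Bh_gr k).bd P.Ph_bd).mul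
    ((((P.fdP_mu_gr k).bd P.Ph_bd).add hm2.bd).congr fun p _ => by ring)

lemma Gh_rg : Rg P.Gh :=
  ((Rg.of_lam (c := fun l => 2 * l)).mul P.Ph_rg).mul P.gm_rg

lemma multiplier_neg (j) :
    Neg fun p => P.al j p * P.Gh p - 2 * p.lam * P.Ph p * P.gm p * P.A j p :=
  (P.Gh_rg.bd.mul_neg (P.al_neg j)).congr fun p _ => by simp only [Gh]; ring

lemma al_bd (j) : Bd (P.al j) := (P.A_bd j).of_neg_sub (P.al_neg j)

lemma multiplier_drift_bd (j) : Bd fun p => P.al j p * fdP j P.Gh p :=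
  (P.al_bd j).mul (P.Gh_rg.fdP j)

lemma potential_multiplier_neg :
    Neg fun p => P.mu p * P.Gh p - 2 * p.lam * P.Ph p ^ 3 * P.gm p ^ 2 :=
  (P.Gh_rg.bd.mul_neg P.mu_neg).congr fun p _ => by simp only [Gh]; ring

end Phase

/-! ### Uniform constants and restriction of the symbol calculus to the lattice. -/

lemma Gr.uniform {W : Param d → ℝ} (hW0 : ∀ p, p.Valid → 0 ≤ W p) {i : ℕ} {ι : Type*} [Fintype ι]
    {F : ι → Param d → ℝ} (hF : ∀ l, Gr W i (F l)) :
    ∃ C₀ : ℝ, 0 ≤ C₀ ∧ ∃ K₀ : ℝ → ℝ, (∀ l, 0 ≤ K₀ l) ∧ ∀ C, C₀ ≤ C → ∀ K : ℝ → ℝ,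
      (∀ l, K₀ l ≤ K l) → ∀ l p, p.Valid → |F l p| ≤ C * W p ^ i + K p.lam * p.eps := by
  choose C hC K hK0 hK using hF
  refine ⟨∑ l, C l, Finset.sum_nonneg fun l _ => hC l, fun r => ∑ l, K l r,
    fun r => Finset.sum_nonneg fun l _ => hK0 l r, fun C' hC' K' hK' l p hp => ?_⟩
  refine (hK l p hp).trans (add_le_add (mul_le_mul_of_nonneg_right ?_ (pow_nonneg (hW0 p hp) i))
    (mul_le_mul_of_nonneg_right ?_ hp.eps_pos.le))
  · exact (Finset.single_le_sum (f := C) (fun l _ => hC l) (Finset.mem_univ l)).trans hC'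
  · exact (Finset.single_le_sum (f := fun l => K l p.lam) (fun l _ => hK0 l _)
      (Finset.mem_univ l)).trans (hK' _)

lemma Neg.uniform {ι : Type*} [Fintype ι] {F : ι → Param d → ℝ} (hF : ∀ l, Neg (F l)) :
    ∃ K₀ : ℝ → ℝ, (∀ l, 0 ≤ K₀ l) ∧ ∀ K : ℝ → ℝ,
      (∀ l, K₀ l ≤ K l) → ∀ l p, p.Valid → |F l p| ≤ K p.lam * p.eps := by
  choose K hK0 hK using hF
  refine ⟨fun r => ∑ l, K l r,
    fun r => Finset.sum_nonneg fun l _ => hK0 l r, fun K' hK' l p hp => ?_⟩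
  exact (hK l p hp).trans (mul_le_mul_of_nonneg_right ((Finset.single_le_sum
    (f := fun l => K l p.lam) (fun l _ => hK0 l _) (Finset.mem_univ l)).trans (hK' _)) hp.eps_pos.le)

lemma Bd.uniform {ι : Type*} [Fintype ι] {F : ι → Param d → ℝ} (hF : ∀ l, Bd (F l)) :
    ∃ K₀ : ℝ → ℝ, (∀ l, 0 ≤ K₀ l) ∧ ∀ K : ℝ → ℝ,
      (∀ l, K₀ l ≤ K l) → ∀ l p, p.Valid → |F l p| ≤ K p.lam := by
  choose K hK0 hK using hF
  refine ⟨fun r => ∑ l, K l r,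
    fun r => Finset.sum_nonneg fun l _ => hK0 l r, fun K' hK' l p hp => ?_⟩
  exact (hK l p hp).trans ((Finset.single_le_sum
    (f := fun l => K l p.lam) (fun l _ => hK0 l _) (Finset.mem_univ l)).trans (hK' _))

/-- The mesh point with lattice index `x`. -/
def toPt (h : ℝ) (x : Lat d) : Pt d := WithLp.toLp 2 fun i => h * (x i : ℝ)

@[simp] lemma toPt_apply (h : ℝ) (x : Lat d) (i : Fin d) : toPt h x i = h * (x i : ℝ) := rfl

lemma toPt_add_ev (h : ℝ) (x : Lat d) (k : Fin d) : toPt h (x + ev k) = toPt h x + h • uv k := by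
  ext i
  rcases eq_or_ne i k with rfl | hi
  · simp [ev]; ring
  · simp [ev, hi]

lemma toPt_sub_ev (h : ℝ) (x : Lat d) (k : Fin d) : toPt h (x - ev k) = toPt h x - h • uv k := by
  rw [eq_sub_iff_add_eq, ← toPt_add_ev, sub_add_cancel]

/-- The parameter attached to a lattice point. -/
def lp (lam h s : ℝ) (x : Lat d) : Param d := ⟨lam, h, s, toPt h x⟩

section lp
variable (lam h s : ℝ)

lemma lp_add (x : Lat d) (k) : lp lam h s (x + ev k) = (lp lam h s x).up k := by
  simp only [lp, Param.up, toPt_add_ev]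

lemma lp_sub (x : Lat d) (k) : lp lam h s (x - ev k) = (lp lam h s x).dn k := by
  simp only [lp, Param.dn, toPt_sub_ev]

lemma fd_lp (f : Param d → ℝ) (k) (x : Lat d) :
    fd h k (fun x => f (lp lam h s x)) x = fdP k f (lp lam h s x) := by
  simp only [fd, fdP, lp_add]; rfl

lemma av_lp (f : Param d → ℝ) (k) (x : Lat d) :
    av k (fun x => f (lp lam h s x)) x = avP k f (lp lam h s x) := by
  simp only [av, avP, lp_add]

lemma fd_const_mul (c : ℝ) (f : Lat d → ℝ) (k) (x : Lat d) :
    fd h k (fun x => c * f x) x = c * fd h k f x := by simp only [fd]; ring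

lemma av_const_mul (c : ℝ) (f : Lat d → ℝ) (k : Fin d) (x : Lat d) :
    av k (fun x => c * f x) x = c * av k f x := by simp only [av]; ring

end lp

/-- Regularity controls only single coordinate steps, so the offset is reached one coordinate at a
time, in at most `d` steps. -/
lemma Rg.offset {f : Param d → ℝ} (hf : Rg f) :
    ∃ K : ℝ → ℝ, (∀ l, 0 ≤ K l) ∧ ∀ lam h s (x z : Lat d), (lp lam h s x).Valid →
      (∀ i, |z i| ≤ 1) → |f (lp lam h s (x - z)) - f (lp lam h s x)|
        ≤ K lam * (lp lam h s x).eps := by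
  classical
  obtain ⟨-, K, h0, hK⟩ := hf
  refine ⟨fun l => d * K l, fun l => mul_nonneg (Nat.cast_nonneg d) (h0 l),
    fun lam h s x z hp hz => ?_⟩
  have hval : ∀ y : Lat d, (lp lam h s y).Valid := fun y => ⟨hp.lam, hp.h, hp.s, hp.sh⟩
  have step : ∀ (y : Lat d) k, |f (lp lam h s (y + ev k)) - f (lp lam h s y)| ≤ K lam * h :=
    fun y k => by rw [lp_add]; exact hK _ (hval y) k
  have key : ∀ S : Finset (Fin d), |f (lp lam h s (x - ∑ i ∈ S, z i • ev i))
      - f (lp lam h s x)| ≤ S.card * (K lam * h) := by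
    intro S
    induction S using Finset.induction_on with
    | empty => simp
    | insert i S hi ih =>
      rw [Finset.sum_insert hi, Finset.card_insert_of_notMem hi]
      set w := x - ∑ i ∈ S, z i • ev i with hw
      have e : x - (z i • ev i + ∑ i ∈ S, z i • ev i) = w - z i • ev i := by rw [hw]; abel
      rw [e]
      have hzi : z i = -1 ∨ z i = 0 ∨ z i = 1 := by have := abs_le.1 (hz i); omega
      have h1 : |f (lp lam h s (w - z i • ev i)) - f (lp lam h s w)| ≤ K lam * h := by
        rcases hzi with h1 | h1 | h1
        · rw [h1, neg_one_smul, sub_neg_eq_add]; exact step w i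
        · rw [h1, zero_smul, sub_zero, sub_self, abs_zero]
          exact mul_nonneg (h0 _) hp.h.le
        · rw [h1, one_smul, abs_sub_comm]
          simpa using step (w - ev i) i
      have := abs_sub_le (f (lp lam h s (w - z i • ev i))) (f (lp lam h s w)) (f (lp lam h s x))
      push_cast
      linarith
  have h2 := key Finset.univ
  have e : ∑ i, z i • ev i = z := by
    ext i
    simp [ev, Finset.sum_apply, Pi.single_apply]
  rw [e, Finset.card_univ, Fintype.card_fin] at h2
  refine h2.trans ?_
  rw [← mul_assoc]
  exact mul_le_mul_of_nonneg_left hp.h_le_eps (mul_nonneg (Nat.cast_nonneg d) (h0 _))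

lemma abs_mul_le_of {c r X : ℝ} (hc : 0 ≤ c) (h : |r| ≤ X) : |c * r| ≤ c * X := by
  rw [abs_mul, abs_of_nonneg hc]; exact mul_le_mul_of_nonneg_left h hc

namespace Phase
variable (P : Phase d)

/-- The order of the quantifiers matters: `C` is chosen before `lam`, which allows `lam` to be taken
large against it, while `K` may depend on `lam`. -/
theorem exists_coeffBounds : ∃ C : ℝ, ∃ K : ℝ → ℝ, ∀ lam h s : ℝ,
    1 ≤ lam → 0 < h → 1 ≤ s → s * h ≤ 1 →
    CoeffBounds h s lam (s * h + 1 / s) C (K lam) (fun k x => P.al k (lp lam h s x))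
      (fun k x => s * P.Bh k (lp lam h s x)) (fun k x => P.A k (lp lam h s x))
      (fun k x => P.B1 k (lp lam h s x)) (fun x => s ^ 2 * P.mu (lp lam h s x))
      (fun x => s * P.Gh (lp lam h s x)) (fun x => P.Ph (lp lam h s x)) := by
  obtain ⟨C1, c1, K1, k1, H1⟩ := Gr.uniform P.Ph_nonneg
    (fun l : Fin d × Fin d => P.divergence_gr l.1 l.2)
  obtain ⟨C2, c2, K2, k2, H2⟩ := Gr.uniform P.Ph_nonneg
    (fun l : Fin d × Fin d => P.drift_gr l.1 l.2)
  obtain ⟨C3, c3, K3, k3, H3⟩ := Gr.uniform P.Ph_nonneg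
    (fun l : Fin d × Fin d => P.hessian_gr l.1 l.2)
  obtain ⟨C4, c4, K4, k4, H4⟩ := Gr.uniform P.Ph_nonneg
    (fun l : Fin d × Fin d => P.hessian_sub_gr l.1 l.2)
  obtain ⟨C5, c5, K5, k5, H5⟩ := Gr.uniform P.Ph_nonneg (fun _ : Unit => P.potential_gr)
  obtain ⟨K6, k6, H6⟩ := Neg.uniform (fun l : Fin d × Fin d => (P.tau_rg l.1 l.2).dn l.1)
  obtain ⟨K7, k7, H7⟩ := Bd.uniform (fun k : Fin d => P.potential_drift_bd k)
  obtain ⟨K8, k8, H8⟩ := Neg.uniform (fun k : Fin d => P.multiplier_neg k)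
  obtain ⟨K9, k9, H9⟩ := Bd.uniform (fun k : Fin d => P.multiplier_drift_bd k)
  obtain ⟨K10, k10, H10⟩ := Neg.uniform (fun _ : Unit => P.potential_multiplier_neg)
  obtain ⟨K11, k11, H11⟩ := P.Ph_rg.offset
  set C := C1 + C2 + C3 + C4 + C5 with hC
  set K : ℝ → ℝ := fun l => K1 l + K2 l + K3 l + K4 l + K5 l + K6 l + K7 l + K8 l + K9 l + K10 l
    + K11 l with hK
  have hKi : ∀ l, K1 l ≤ K l ∧ K2 l ≤ K l ∧ K3 l ≤ K l ∧ K4 l ≤ K l ∧ K5 l ≤ K l ∧ K6 l ≤ K l ∧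
      K7 l ≤ K l ∧ K8 l ≤ K l ∧ K9 l ≤ K l ∧ K10 l ≤ K l ∧ K11 l ≤ K l := by
    intro l
    have := k1 l; have := k2 l; have := k3 l; have := k4 l; have := k5 l; have := k6 l
    have := k7 l; have := k8 l; have := k9 l; have := k10 l; have := k11 l
    simp only [hK]
    refine ⟨?_, ?_, ?_, ?_, ?_, ?_, ?_, ?_, ?_, ?_, ?_⟩ <;> linarith
  specialize H1 C (by linarith) K fun l => (hKi l).1
  specialize H2 C (by linarith) K fun l => (hKi l).2.1
  specialize H3 C (by linarith) K fun l => (hKi l).2.2.1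
  specialize H4 C (by linarith) K fun l => (hKi l).2.2.2.1
  specialize H5 C (by linarith) K fun l => (hKi l).2.2.2.2.1
  specialize H6 K fun l => (hKi l).2.2.2.2.2.1
  specialize H7 K fun l => (hKi l).2.2.2.2.2.2.1
  specialize H8 K fun l => (hKi l).2.2.2.2.2.2.2.1
  specialize H9 K fun l => (hKi l).2.2.2.2.2.2.2.2.1
  specialize H10 K fun l => (hKi l).2.2.2.2.2.2.2.2.2.1
  refine ⟨C, K, fun lam h s hlam hh hs hsh => ?_⟩
  have hv : ∀ x : Lat d, (lp lam h s x).Valid := fun x => ⟨hlam, hh, hs, hsh⟩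
  have hs0 : 0 < s := by linarith
  have hK0 : 0 ≤ K lam := (k1 lam).trans (hKi lam).1
  have heps : 0 < s * h + 1 / s := by positivity
  refine ⟨by positivity, hK0, hs0, ?_, fun x => mul_pos (show 0 < lam by linarith) (P.ph_pos _),
    fun x z hz => ?_, fun j k x => ?_, fun j k x => ?_, fun j k x => ?_, fun j k x => ?_,
    fun j k x => ?_, fun x => ?_, fun k x => ?_, fun j x => ?_, fun j x => ?_, fun x => ?_⟩
  · have : s * (s * h + 1 / s) = s * (s * h) + 1 := by field_simp
    rw [this]
    have : 0 ≤ s * (s * h) := by positivity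
    linarith
  · have h1 := (le_abs_self _).trans (H11 lam h s x z (hv x) hz)
    have h2 := mul_le_mul_of_nonneg_right (hKi lam).2.2.2.2.2.2.2.2.2.2 heps.le
    have : (lp lam h s x).eps = s * h + 1 / s := rfl
    rw [this] at h1
    linarith
  · have := abs_mul_le_of hs0.le (H1 (j, k) _ (hv x))
    rw [pow_one] at this
    refine le_of_eq_of_le (congrArg _ ?_) this
    simp only [av_const_mul, av_lp, lp_sub, fdP, Param.up_dn, Param.h_dn]
    simp only [lp]
    ring
  · have := abs_mul_le_of hs0.le (H2 (j, k) _ (hv x))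
    rw [pow_one] at this
    refine le_of_eq_of_le (congrArg _ ?_) this
    simp only [av_const_mul, av_lp, fd_lp]
    ring
  · have := abs_mul_le_of hs0.le (H3 (j, k) _ (hv x))
    rw [pow_one] at this
    refine le_of_eq_of_le (congrArg _ ?_) this
    simp only [fd_const_mul, fd_lp, tau]
    simp only [lp]
    ring
  · have := abs_mul_le_of hs0.le (H4 (j, k) _ (hv x))
    rw [pow_one] at this
    refine le_of_eq_of_le (congrArg _ ?_) this
    simp only [fd_const_mul, fd_lp, tau, lp_sub]
    simp only [lp]
    ring
  · have := H6 (j, k) _ (hv x)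
    simp only [lp_sub]
    exact this
  · have := abs_mul_le_of (pow_nonneg hs0.le 3) (H5 () _ (hv x))
    refine le_of_eq_of_le (congrArg _ ?_) this
    simp only [av_const_mul, av_lp, lp_sub, fdP, Param.up_dn, Param.h_dn, gam, gm]
    simp only [lp]
    rw [mul_sub, Finset.mul_sum]
    congr 1
    exact Finset.sum_congr rfl fun k _ => by ring
  -- The powers combine as `s · s² · h² = s (sh)²`, and `(sh)² ≤ sh` because `sh ≤ 1`.
  · have h1 := abs_mul_le_of (by positivity : 0 ≤ s * (s * h) ^ 2) (H7 k _ (hv x))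
    refine (le_of_eq_of_le (congrArg _ ?_) h1).trans ?_
    · simp only [fd_const_mul, fd_lp]; ring
    · have h2 : (s * h) ^ 2 ≤ s * h + 1 / s := by
        have : 0 < 1 / s := by positivity
        have h3 : 0 < s * h := by positivity
        nlinarith
      have h4 := mul_le_mul_of_nonneg_left (mul_le_mul_of_nonneg_left h2 hK0) hs0.le
      have : (lp lam h s x).lam = lam := rfl
      rw [this]
      linarith
  · have := abs_mul_le_of hs0.le (H8 j _ (hv x))
    refine le_of_eq_of_le (congrArg _ ?_) this
    simp only [gam, gm]
    simp only [lp]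
    ring
  · have := abs_mul_le_of hs0.le (H9 j _ (hv x))
    refine le_of_eq_of_le (congrArg _ ?_) this
    simp only [fd_const_mul, fd_lp]; ring
  · have := abs_mul_le_of (pow_nonneg hs0.le 3) (H10 () _ (hv x))
    refine le_of_eq_of_le (congrArg _ ?_) this
    simp only [gam, gm]
    simp only [lp]
    ring

end Phase

/-! ### Coercivity on the cube, conjugation and the lattice Carleman estimate. -/

/-- The closed unit cube. -/
def ccube (d : ℕ) : Set (Pt d) := {x | ∀ i, 0 ≤ x i ∧ x i ≤ 1}

/-- The discrete divergence form operator on the lattice. -/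
def latLap (h : ℝ) (a : Fin d → Lat d → ℝ) (u : Lat d → ℝ) (x : Lat d) : ℝ :=
  ∑ k, (a k x * fd h k u x - a k (x - ev k) * fd h k u (x - ev k)) / h

namespace Phase
variable (P : Phase d)

/-- Nondegeneracy of the phase on the cube and ellipticity of the coefficients. -/
structure Nondegenerate (a₀ g₀ : ℝ) : Prop where
  a_pos : 0 < a₀
  g_pos : 0 < g₀
  le_σ : ∀ k y, a₀ ≤ P.σ k y
  le_grad : ∀ y ∈ ccube d, g₀ ≤ ∑ k, P.b k y ^ 2

variable {P}

lemma Nondegenerate.le_gm {a₀ g₀ : ℝ} (H : P.Nondegenerate a₀ g₀) {p : Param d}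
    (hp : p.y ∈ ccube d) : a₀ * g₀ ≤ P.gm p := by
  refine (mul_le_mul_of_nonneg_left (H.le_grad _ hp) H.a_pos.le).trans ?_
  rw [Finset.mul_sum]
  exact Finset.sum_le_sum fun k _ => mul_le_mul_of_nonneg_right (H.le_σ _ _) (sq_nonneg _)

/-- All edges touching `D` issue from points of the closed cube. -/
def InCube (h : ℝ) (D : Finset (Lat d)) : Prop :=
  ∀ x, x ∈ D ∨ (∃ j, x + ev j ∈ D) → toPt h x ∈ ccube d

-- First `lam` is taken so large that `2λm` exceeds the errors independent of `λ` by `1`. What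
-- remains is at least `Φ` or `Φ³`, hence at least `2c`, and for small `ε` the other errors consume
-- at most `c`.
variable (P) in
lemma exists_form_lower {a₀ g₀ : ℝ} (H : P.Nondegenerate a₀ g₀) :
    ∃ lam₀ : ℝ, 1 ≤ lam₀ ∧ ∀ lam, lam₀ ≤ lam → ∃ ε₀ c : ℝ, 0 < ε₀ ∧ 0 < c ∧
      ∀ h s : ℝ, 0 < h → 1 ≤ s → s * h ≤ 1 → s * h + 1 / s ≤ ε₀ →
      ∀ (D : Finset (Lat d)) (v : Lat d → ℝ), InCube h D → (∀ x, x ∉ D → v x = 0) →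
      c * ∑ x ∈ fatten D, (s * ∑ j, fd h j v x ^ 2 + s ^ 3 * v x ^ 2)
        ≤ -2 * ∑ x ∈ fatten D,
          symPart h (fun k x => P.al k (lp lam h s x)) (fun x => s ^ 2 * P.mu (lp lam h s x)) v x
          * multPart h (fun k x => s * P.Bh k (lp lam h s x))
            (fun x => s * P.Gh (lp lam h s x)) v x := by
  obtain ⟨C, K, hCK⟩ := P.exists_coeffBounds
  set F := formConst d with hF
  have hF0 : 0 ≤ F := by rw [hF]; unfold formConst; positivity
  have ha := H.a_pos
  have hg := H.g_pos
  set γ := a₀ * g₀ with hγ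
  have hγ0 : 0 < γ := by positivity
  -- This bounds from below both `γ a_j`, the gradient weight, and `γ²`, the weight of `v²`.
  set m := min (γ * a₀) (γ ^ 2) with hm
  have hm0 : 0 < m := lt_min (by positivity) (by positivity)
  refine ⟨max 1 ((F * C + 1) / (2 * m)), le_max_left _ _, fun lam hlam => ?_⟩
  have hlam1 : 1 ≤ lam := (le_max_left _ _).trans hlam
  have hlam2 : F * C + 1 ≤ 2 * lam * m := by
    have := (le_max_right _ _).trans hlam
    rw [div_le_iff₀ (by positivity)] at this
    linarith
  set φ₀ := lam * Real.exp (-(lam * P.bound)) with hφ₀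
  have hφpos : 0 < φ₀ := by have := Real.exp_pos (-(lam * P.bound)); positivity
  set c := min φ₀ (φ₀ ^ 3) / 2 with hc
  have hc0 : 0 < c := by have := lt_min hφpos (pow_pos hφpos 3); positivity
  set R := F * ((|C| + 1) * |K lam|) with hR
  have hR0 : 0 ≤ R := by positivity
  refine ⟨c / (R + 1), c, by positivity, hc0, fun h s hh hs hsh hε D v hD hv => ?_⟩
  have HC := hCK lam h s hlam1 hh hs hsh
  refine le_trans ?_ (quadratic_form_lower HC hh.ne' (by linarith) hv)
  rw [Finset.mul_sum]
  refine Finset.sum_le_sum fun x _ => ?_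
  have hs0 : 0 < s := by linarith
  have hC0 := HC.C_nonneg
  have hK0 := HC.K_nonneg
  set ε := s * h + 1 / s with hε'
  have hε0 : 0 < ε := HC.eps_pos
  have hRε : F * ((C + 1) * K lam) * ε ≤ c := by
    rw [le_div_iff₀ (by positivity)] at hε
    have : R = F * ((C + 1) * K lam) := by rw [hR, abs_of_nonneg hC0, abs_of_nonneg hK0]
    rw [← this]
    linarith [mul_comm ε R]
  have hΦ : φ₀ ≤ P.Ph (lp lam h s x) := by
    refine mul_le_mul_of_nonneg_left (Real.exp_le_exp.2 ?_) (by linarith : (0 : ℝ) ≤ lam)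
    have := mul_le_mul_of_nonneg_left (abs_le.1 (P.β_le (lp lam h s x).y)).1
      (by linarith : (0 : ℝ) ≤ lam)
    rw [mul_neg] at this
    exact this
  set Φ := P.Ph (lp lam h s x) with hΦdef
  have hΦ0 : 0 < Φ := hφpos.trans_le hΦ
  have hgam : gam (fun k x => P.A k (lp lam h s x)) (fun k x => P.B1 k (lp lam h s x)) x
      = P.gm (lp lam h s x) := rfl
  rw [hgam, mul_add, Finset.mul_sum, Finset.mul_sum]
  refine add_le_add (Finset.sum_le_sum fun j _ => ?_) ?_
  · by_cases hE : fd h j v x = 0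
    · simp [hE]
    -- The gradient of the phase is nondegenerate only on the cube. This suffices, because the
    -- quadratic form has no contribution from edges that do not touch `D`.
    have hx : toPt h x ∈ ccube d := by
      apply hD
      by_contra hcon
      push Not at hcon
      exact hE (by simp [fd, hv x hcon.1, hv _ (hcon.2 j)])
    have h1 : γ ≤ P.gm (lp lam h s x) := H.le_gm hx
    have h2 : a₀ ≤ P.A j (lp lam h s x) := H.le_σ _ _
    have h3 : m ≤ P.gm (lp lam h s x) * P.A j (lp lam h s x) :=
      (min_le_left _ _).trans (mul_le_mul h1 h2 ha.le (hγ0.le.trans h1))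
    rw [← mul_assoc]
    refine mul_le_mul_of_nonneg_right ?_ (sq_nonneg _)
    rw [mul_comm c]
    refine mul_le_mul_of_nonneg_left ?_ hs0.le
    have h4 := mul_le_mul_of_nonneg_left h3 (by positivity : 0 ≤ 2 * lam * Φ)
    have h5 := mul_le_mul_of_nonneg_right hlam2 hΦ0.le
    have h6 : 2 * c ≤ φ₀ := by rw [hc]; linarith [min_le_left φ₀ (φ₀ ^ 3)]
    linarith
  · by_cases hE : v x = 0
    · simp [hE]
    have hx : toPt h x ∈ ccube d := by
      apply hD
      by_contra hcon
      push Not at hcon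
      exact hE (hv x hcon.1)
    have h1 : γ ≤ P.gm (lp lam h s x) := H.le_gm hx
    have h3 : m ≤ P.gm (lp lam h s x) ^ 2 :=
      (min_le_right _ _).trans (pow_le_pow_left₀ hγ0.le h1 2)
    rw [← mul_assoc]
    refine mul_le_mul_of_nonneg_right ?_ (sq_nonneg _)
    rw [mul_comm c]
    refine mul_le_mul_of_nonneg_left ?_ (pow_nonneg hs0.le 3)
    have hΦ3 : φ₀ ^ 3 ≤ Φ ^ 3 := pow_le_pow_left₀ hφpos.le hΦ 3
    have h4 := mul_le_mul_of_nonneg_left h3 (by positivity : 0 ≤ 2 * lam * Φ ^ 3)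
    have h5 := mul_le_mul_of_nonneg_right hlam2 (by positivity : 0 ≤ Φ ^ 3)
    have h6 : 2 * c ≤ φ₀ ^ 3 := by rw [hc]; linarith [min_le_right φ₀ (φ₀ ^ 3)]
    have h7 : 0 ≤ F * (C * K lam * ε) := by positivity
    linarith

variable (P)

/-- The Carleman weight `e^{sφ}` on the lattice. -/
def wt (lam h s : ℝ) (x : Lat d) : ℝ := Real.exp (s * P.ph (lp lam h s x))

lemma wt_pos (lam h s : ℝ) (x : Lat d) : 0 < P.wt lam h s x := Real.exp_pos _

lemma wt_ratio (lam : ℝ) {h : ℝ} (hh : h ≠ 0) (s : ℝ) (x : Lat d) (k : Fin d) :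
    P.wt lam h s x = P.wt lam h s (x + ev k) *
      (Real.cosh (s * h * P.q k (lp lam h s x)) - Real.sinh (s * h * P.q k (lp lam h s x))) ∧
    P.wt lam h s (x + ev k) = P.wt lam h s x *
      (Real.cosh (s * h * P.q k (lp lam h s x)) + Real.sinh (s * h * P.q k (lp lam h s x))) := by
  have e : s * h * P.q k (lp lam h s x)
      = s * P.ph (lp lam h s (x + ev k)) - s * P.ph (lp lam h s x) := by
    rw [lp_add]
    simp only [q, fdP]
    simp only [lp]
    field_simp
  rw [Real.cosh_sub_sinh, Real.cosh_add_sinh, e]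
  unfold wt
  rw [← Real.exp_add, ← Real.exp_add]
  constructor <;> congr 1 <;> ring

/-- On each edge the ratio of the weights is `cosh θ ± sinh θ`. The `cosh` part gives the symmetric
operator and its potential; the `sinh` part gives the transport operator and its divergence. The
divergence, and the multiplier that was added to `Y`, are collected as a zeroth order term on the
right. -/
lemma conjugation (lam : ℝ) {h s : ℝ} (hh : h ≠ 0) (hs : s ≠ 0) (u : Lat d → ℝ) (x : Lat d) :
    symPart h (fun k x => P.al k (lp lam h s x)) (fun x => s ^ 2 * P.mu (lp lam h s x))
        (fun x => P.wt lam h s x * u x) x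
      - multPart h (fun k x => s * P.Bh k (lp lam h s x))
        (fun x => s * P.Gh (lp lam h s x)) (fun x => P.wt lam h s x * u x) x
      = P.wt lam h s x * latLap h (fun k x => P.A k (lp lam h s x)) u x
        + s * (∑ k, fdP k (P.Bh k) ((lp lam h s x).dn k) - P.Gh (lp lam h s x))
          * (P.wt lam h s x * u x) := by
  have key : ∀ k : Fin d,
      (P.al k (lp lam h s x) * fd h k (fun x => P.wt lam h s x * u x) x
        - P.al k (lp lam h s (x - ev k)) * fd h k (fun x => P.wt lam h s x * u x) (x - ev k)) / h
      + s ^ 2 * (P.A k (lp lam h s x) * P.c2 k (lp lam h s x)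
        + P.A k ((lp lam h s x).dn k) * P.c2 k ((lp lam h s x).dn k)) * (P.wt lam h s x * u x)
      - transport h k (fun x => s * P.Bh k (lp lam h s x)) (fun x => P.wt lam h s x * u x) x
      = P.wt lam h s x * ((P.A k (lp lam h s x) * fd h k u x
          - P.A k (lp lam h s (x - ev k)) * fd h k u (x - ev k)) / h)
        + s * fdP k (P.Bh k) ((lp lam h s x).dn k) * (P.wt lam h s x * u x) := by
    intro k
    have r1 := (P.wt_ratio lam hh s x k).1
    have r2 := (P.wt_ratio lam hh s (x - ev k) k).2
    rw [sub_add_cancel] at r2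
    rw [← lp_sub]
    simp only [fdP, lp_sub, Param.up_dn]
    simp only [← lp_sub]
    have e1 : ∀ y : Lat d, (lp lam h s y).h = h := fun _ => rfl
    have e2 : ∀ y : Lat d, (lp lam h s y).s = s := fun _ => rfl
    simp only [transport, fd, al, Bh, ch, sh, c2, sub_add_cancel, e1, e2]
    set c := Real.cosh (s * h * P.q k (lp lam h s x))
    set sn := Real.sinh (s * h * P.q k (lp lam h s x))
    set c' := Real.cosh (s * h * P.q k (lp lam h s (x - ev k)))
    set sn' := Real.sinh (s * h * P.q k (lp lam h s (x - ev k)))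
    have t1 : P.wt lam h s x * u (x + ev k) = P.wt lam h s (x + ev k) * u (x + ev k) * (c - sn) := by
      rw [r1]; ring
    have t2 : P.wt lam h s x * u (x - ev k)
        = P.wt lam h s (x - ev k) * u (x - ev k) * (c' + sn') := by
      rw [r2]; ring
    generalize P.A k (lp lam h s x) = a1 at *
    generalize P.A k (lp lam h s (x - ev k)) = a2 at *
    have t3 : P.wt lam h s x * ((a1 * ((u (x + ev k) - u x) / h)
          - a2 * ((u x - u (x - ev k)) / h)) / h)
        = (a1 * ((P.wt lam h s x * u (x + ev k) - P.wt lam h s x * u x) / h)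
          - a2 * ((P.wt lam h s x * u x - P.wt lam h s x * u (x - ev k)) / h)) / h := by ring
    rw [t3, t1, t2]
    generalize P.wt lam h s x * u x = v0
    generalize P.wt lam h s (x + ev k) * u (x + ev k) = v1
    generalize P.wt lam h s (x - ev k) * u (x - ev k) = v2
    field_simp
    ring
  have := Finset.sum_congr rfl fun k (_ : k ∈ Finset.univ) => key k
  simp only [Finset.sum_add_distrib, Finset.sum_sub_distrib, ← Finset.mul_sum,
    ← Finset.sum_mul] at this
  simp only [← Finset.sum_add_distrib (s := Finset.univ)] at this
  unfold symPart multPart latLap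
  simp only [mu]
  linarith

end Phase

/-- Squared difference quotients on all edges at a vertex. -/
def starGrad (h : ℝ) (v : Lat d → ℝ) (x : Lat d) : ℝ :=
  ∑ j, (fd h j v x ^ 2 + fd h j v (x - ev j) ^ 2)

lemma starGrad_nonneg (h : ℝ) (v : Lat d → ℝ) (x : Lat d) : 0 ≤ starGrad h v x :=
  Finset.sum_nonneg fun _ _ => by positivity

lemma sum_abs_fd_sq_le (h : ℝ) (v : Lat d → ℝ) (x : Lat d) :
    (∑ j, (|fd h j v x| + |fd h j v (x - ev j)|)) ^ 2 ≤ 2 * d * starGrad h v x := by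
  have h1 := sq_sum_le_card_mul_sum_sq (s := Finset.univ)
    (f := fun j => |fd h j v x| + |fd h j v (x - ev j)|)
  rw [Finset.card_univ, Fintype.card_fin] at h1
  refine h1.trans ?_
  unfold starGrad
  rw [mul_comm 2 (d : ℝ), mul_assoc, Finset.mul_sum (a := (2 : ℝ))]
  refine mul_le_mul_of_nonneg_left (Finset.sum_le_sum fun j _ => ?_) (Nat.cast_nonneg d)
  have := sq_nonneg (|fd h j v x| - |fd h j v (x - ev j)|)
  have e1 := sq_abs (fd h j v x)
  have e2 := sq_abs (fd h j v (x - ev j))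
  linarith

/-- Where `v` vanishes, both factors reduce to first differences on the adjacent edges. The
divergence costs `1/h` and the transport coefficient costs `s`; the product is the weight `s/h` that
turns `h^d` into `s h^(d-1)` in the boundary integral. -/
lemma abs_symPart_mul_multPart_le {h s K : ℝ} (hh : 0 < h) (hs : 0 < s) (hK : 0 ≤ K)
    {α B : Fin d → Lat d → ℝ} {μ G v : Lat d → ℝ} (hα : ∀ k x, |α k x| ≤ K)
    (hB : ∀ k x, |B k x| ≤ s * K) {x : Lat d} (hx : v x = 0) :
    |symPart h α μ v x * multPart h B G v x| ≤ 2 * d * K ^ 2 * (s / h) * starGrad h v x := by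
  set R := ∑ j, (|fd h j v x| + |fd h j v (x - ev j)|) with hR
  have h1 : |symPart h α μ v x| ≤ K / h * R := by
    unfold symPart
    rw [hx, mul_zero, add_zero, hR, Finset.mul_sum]
    refine (Finset.abs_sum_le_sum_abs _ _).trans (Finset.sum_le_sum fun j _ => ?_)
    rw [abs_div, abs_of_pos hh, div_mul_eq_mul_div]
    refine div_le_div_of_nonneg_right ((abs_sub _ _).trans ?_) hh.le
    rw [abs_mul, abs_mul, mul_add]
    exact add_le_add (mul_le_mul_of_nonneg_right (hα _ _) (abs_nonneg _))
      (mul_le_mul_of_nonneg_right (hα _ _) (abs_nonneg _))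
  have h2 : |multPart h B G v x| ≤ s * K * R := by
    unfold multPart transport
    rw [hx, mul_zero, add_zero, hR, Finset.mul_sum]
    refine (Finset.abs_sum_le_sum_abs _ _).trans (Finset.sum_le_sum fun j _ => ?_)
    refine (abs_add_le _ _).trans ?_
    rw [abs_mul, abs_mul, mul_add]
    exact add_le_add (mul_le_mul_of_nonneg_right (hB _ _) (abs_nonneg _))
      (mul_le_mul_of_nonneg_right (hB _ _) (abs_nonneg _))
  rw [abs_mul]
  have hR0 : 0 ≤ R := Finset.sum_nonneg fun _ _ => by positivity
  have h3 := mul_le_mul h1 h2 (abs_nonneg _) (by positivity)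
  have h4 := mul_le_mul_of_nonneg_left (sum_abs_fd_sq_le h v x)
    (by positivity : 0 ≤ K ^ 2 * (s / h))
  refine h3.trans ((le_of_eq ?_).trans (h4.trans (le_of_eq ?_)))
  · rw [← hR]; field_simp
  · ring

namespace Phase
variable (P : Phase d)

theorem lattice_carleman {a₀ g₀ : ℝ} (H : P.Nondegenerate a₀ g₀) :
    ∃ lam₀ : ℝ, 1 ≤ lam₀ ∧ ∀ lam, lam₀ ≤ lam → ∃ s₀ ε₀ C : ℝ, 1 ≤ s₀ ∧ 0 < ε₀ ∧ ε₀ ≤ 1 ∧ 0 < C ∧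
      ∀ h s : ℝ, 0 < h → s₀ ≤ s → s * h ≤ ε₀ →
      ∀ (D : Finset (Lat d)) (u : Lat d → ℝ), InCube h D → (∀ x, x ∉ D → u x = 0) →
      ∑ x ∈ fatten D, (s * ∑ j, fd h j (fun x => P.wt lam h s x * u x) x ^ 2
          + s ^ 3 * (P.wt lam h s x * u x) ^ 2)
        ≤ C * (∑ x ∈ D, (P.wt lam h s x * latLap h (fun k x => P.A k (lp lam h s x)) u x) ^ 2
          + s / h * ∑ x ∈ fatten D \ D, starGrad h (fun x => P.wt lam h s x * u x) x) := by
  obtain ⟨lam₀, hlam₀, hform⟩ := P.exists_form_lower H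
  refine ⟨lam₀, hlam₀, fun lam hlam => ?_⟩
  obtain ⟨ε₁, c, hε₁, hc, hlow⟩ := hform lam hlam
  have hlam1 : 1 ≤ lam := hlam₀.trans hlam
  obtain ⟨K1, k1, H1⟩ := Bd.uniform (fun k : Fin d => P.al_bd k)
  obtain ⟨K2, k2, H2⟩ := Bd.uniform (fun k : Fin d => (P.Bh_gr k).bd P.Ph_bd)
  have hzero : Bd fun p => ∑ k, fdP k (P.Bh k) (p.dn k) - P.Gh p := by
    have hb : ∀ k, Bd (fdP k (P.Bh k)) := fun k =>
      (((P.fdP_Bh_gr k k).bd P.Ph_bd).add ((P.A_rg k).mul (P.h0_rg k k)).bd).congr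
        fun p _ => by ring
    exact ((Bd.sum Finset.univ fun k => (hb k).dn k).add
      ((Bd.const (-1)).mul P.Gh_rg.bd)).congr fun p _ => by ring
  obtain ⟨K3, k3, H3⟩ := hzero
  set K := K1 lam + K2 lam with hK
  have hK0 : 0 ≤ K := add_nonneg (k1 lam) (k2 lam)
  set L := K3 lam with hL
  have hL0 : 0 ≤ L := k3 lam
  -- The summand `2 / ε₁` gives `1/s ≤ ε₁/2`, the other half being left for `sh`. The summand
  -- `2L²/c` lets `s³ v²` absorb the squared zeroth order term of the conjugation, which is of size
  -- `s² L² v²`.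
  refine ⟨1 + 2 / ε₁ + L ^ 2 * 2 / c, min 1 (ε₁ / 2), (2 + 8 * d * K ^ 2) / c + 1, ?_, ?_,
    min_le_left _ _, by positivity, fun h s hh hs hsh D u hD hu => ?_⟩
  · have : 0 ≤ 2 / ε₁ + L ^ 2 * 2 / c := by positivity
    linarith
  · exact lt_min one_pos (by positivity)
  have hp1 : 0 < 2 / ε₁ := by positivity
  have hp2 : 0 ≤ L ^ 2 * 2 / c := by positivity
  have hs1 : 1 ≤ s := by linarith
  have hs0 : 0 < s := by linarith
  have hsh1 : s * h ≤ 1 := hsh.trans (min_le_left _ _)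
  have hε : s * h + 1 / s ≤ ε₁ := by
    have i1 : s * h ≤ ε₁ / 2 := hsh.trans (min_le_right _ _)
    have i2 : 1 / s ≤ ε₁ / 2 := by
      rw [div_le_iff₀ hs0]
      have : 2 / ε₁ ≤ s := by linarith
      rw [div_le_iff₀ hε₁] at this
      linarith
    linarith
  have hsL : 2 * L ^ 2 ≤ c * s := by
    have : L ^ 2 * 2 / c ≤ s := by linarith
    rw [div_le_iff₀ hc] at this
    linarith
  have hval : ∀ x : Lat d, (lp lam h s x).Valid := fun x => ⟨hlam1, hh, hs1, hsh1⟩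
  set v : Lat d → ℝ := fun x => P.wt lam h s x * u x with hv
  have hv0 : ∀ x, x ∉ D → v x = 0 := fun x hx => by simp [hv, hu x hx]
  have h1 := hlow h s hh hs1 hsh1 hε D v hD hv0
  set S := symPart h (fun k x => P.al k (lp lam h s x)) (fun x => s ^ 2 * P.mu (lp lam h s x)) v
  set Y := multPart h (fun k x => s * P.Bh k (lp lam h s x)) (fun x => s * P.Gh (lp lam h s x)) v
  have hsplit := Finset.sum_sdiff (f := fun x => S x * Y x) (subset_fatten D)
  have hext : -∑ x ∈ fatten D \ D, S x * Y x
      ≤ 2 * d * K ^ 2 * (s / h) * ∑ x ∈ fatten D \ D, starGrad h v x := by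
    rw [Finset.mul_sum, ← Finset.sum_neg_distrib]
    refine Finset.sum_le_sum fun x hx => (neg_le_abs _).trans ?_
    refine abs_symPart_mul_multPart_le hh hs0 hK0 (fun k x => ?_) (fun k x => ?_)
      (hv0 x (Finset.mem_sdiff.1 hx).2)
    · have := H1 K1 (fun _ => le_rfl) k _ (hval x)
      have h3 : K1 (lp lam h s x).lam = K1 lam := rfl
      linarith [k2 lam]
    · refine abs_mul_le_of hs0.le ?_
      have := H2 K2 (fun _ => le_rfl) k _ (hval x)
      have h3 : K2 (lp lam h s x).lam = K2 lam := rfl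
      linarith [k1 lam]
  have hSY : -4 * ∑ x ∈ D, S x * Y x
      ≤ 2 * ∑ x ∈ D, (P.wt lam h s x * latLap h (fun k x => P.A k (lp lam h s x)) u x) ^ 2
        + c * ∑ x ∈ fatten D, s ^ 3 * v x ^ 2 := by
    have hmono : ∑ x ∈ D, s ^ 3 * v x ^ 2 ≤ ∑ x ∈ fatten D, s ^ 3 * v x ^ 2 :=
      Finset.sum_le_sum_of_subset_of_nonneg (subset_fatten D) fun x _ _ => by positivity
    refine le_trans ?_ (add_le_add le_rfl (mul_le_mul_of_nonneg_left hmono hc.le))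
    rw [Finset.mul_sum, Finset.mul_sum, Finset.mul_sum, ← Finset.sum_add_distrib]
    refine Finset.sum_le_sum fun x _ => ?_
    have e := P.conjugation lam hh.ne' hs0.ne' u x
    have h4 := H3 _ (hval x)
    set Z := ∑ k, fdP k (P.Bh k) ((lp lam h s x).dn k) - P.Gh (lp lam h s x)
    set T := P.wt lam h s x * latLap h (fun k x => P.A k (lp lam h s x)) u x
    have e' : S x - Y x = T + s * Z * v x := e
    have h5 : Z ^ 2 ≤ L ^ 2 := by
      rw [← sq_abs Z]; exact pow_le_pow_left₀ (abs_nonneg _) h4 2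
    have h6 : 2 * (s * Z * v x) ^ 2 ≤ c * (s ^ 3 * v x ^ 2) := by
      have i1 := mul_le_mul_of_nonneg_right h5 (by positivity : 0 ≤ 2 * s ^ 2 * v x ^ 2)
      have i2 := mul_le_mul_of_nonneg_right hsL (by positivity : 0 ≤ s ^ 2 * v x ^ 2)
      linarith
    -- This is `-4SY = (S - Y)² - (S + Y)²`. It returns the conjugated operator, and hence the
    -- source.
    have h7 : -4 * (S x * Y x) ≤ (S x - Y x) ^ 2 := by linarith [sq_nonneg (S x + Y x)]
    have h8 : (T + s * Z * v x) ^ 2 ≤ 2 * T ^ 2 + 2 * (s * Z * v x) ^ 2 := by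
      linarith [sq_nonneg (T - s * Z * v x)]
    rw [e'] at h7
    linarith
  have hE0 : 0 ≤ ∑ x ∈ fatten D, s * ∑ j, fd h j v x ^ 2 := Finset.sum_nonneg fun x _ =>
    mul_nonneg hs0.le (Finset.sum_nonneg fun j _ => sq_nonneg _)
  rw [Finset.sum_add_distrib] at h1 ⊢
  set E := ∑ x ∈ fatten D, s * ∑ j, fd h j v x ^ 2
  set V := ∑ x ∈ fatten D, s ^ 3 * v x ^ 2
  set Q1 := ∑ x ∈ D, (P.wt lam h s x * latLap h (fun k x => P.A k (lp lam h s x)) u x) ^ 2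
  have hQ1 : 0 ≤ Q1 := Finset.sum_nonneg fun _ _ => sq_nonneg _
  set Q2 := ∑ x ∈ fatten D \ D, starGrad h v x
  have hQ2 : 0 ≤ s / h * Q2 := mul_nonneg (by positivity)
    (Finset.sum_nonneg fun x _ => starGrad_nonneg h v x)
  have h9 : c * (E + V) ≤ 2 * Q1 + 8 * d * K ^ 2 * (s / h * Q2) := by
    have := mul_nonneg hc.le hE0
    linarith
  have h10 : c * (E + V) ≤ (2 + 8 * d * K ^ 2) * (Q1 + s / h * Q2) := by
    have i1 : 0 ≤ 8 * d * K ^ 2 * Q1 := by positivity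
    linarith
  have h11 : E + V ≤ (2 + 8 * d * K ^ 2) / c * (Q1 + s / h * Q2) := by
    rw [div_mul_eq_mul_div, le_div_iff₀ hc]
    linarith
  linarith

end Phase

/-! ### Interior indices, midpoint weights and return from `v` to `u`. -/

lemma meshSize_pos (N : ℕ) : 0 < meshSize N := by unfold meshSize; positivity

lemma meshSize_mul (N : ℕ) : meshSize N * ((N : ℝ) + 1) = 1 := by
  unfold meshSize; field_simp

/-- Indices of the interior mesh points. -/
def box (d N : ℕ) : Finset (Lat d) := Finset.Icc (fun _ => 1) (fun _ => (N : ℤ))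

lemma mem_box {N : ℕ} {x : Lat d} : x ∈ box d N ↔ ∀ i, 1 ≤ x i ∧ x i ≤ N := by
  simp only [box, Finset.mem_Icc, Pi.le_def, forall_and]

lemma toPt_mem_ccube {N : ℕ} {x : Lat d} (hx : ∀ i, 0 ≤ x i ∧ x i ≤ N + 1) :
    toPt (meshSize N) x ∈ ccube d := by
  intro i
  have h0 := meshSize_pos N
  have h1 : (0 : ℝ) ≤ x i := by exact_mod_cast (hx i).1
  have h2 : (x i : ℝ) ≤ N + 1 := by exact_mod_cast (hx i).2
  refine ⟨mul_nonneg h0.le h1, ?_⟩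
  rw [toPt_apply, ← meshSize_mul N]
  exact mul_le_mul_of_nonneg_left h2 h0.le

lemma ev_bounds (k i : Fin d) : 0 ≤ ev k i ∧ ev k i ≤ 1 := by
  unfold ev
  rcases eq_or_ne i k with rfl | h
  · simp
  · simp [Pi.single_eq_of_ne h]

lemma inCube_box (N : ℕ) : Phase.InCube (meshSize N) (box d N) := by
  rintro x (hx | ⟨j, hx⟩)
  · rw [mem_box] at hx
    exact toPt_mem_ccube fun i => by have := hx i; omega
  · rw [mem_box] at hx
    refine toPt_mem_ccube fun i => ?_
    have h1 := hx i
    have h2 := ev_bounds j i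
    simp only [Pi.add_apply] at h1
    omega

namespace Phase
variable (P : Phase d)

/-- The squared weight at the midpoint of an edge. -/
def we (lam h s : ℝ) (k : Fin d) (x : Lat d) : ℝ :=
  Real.exp (2 * s * P.ph ⟨lam, h, s, toPt h x + (h / 2) • uv k⟩)

lemma we_pos (lam h s : ℝ) (k : Fin d) (x : Lat d) : 0 < P.we lam h s k x := Real.exp_pos _

/-- On short edges the weights at the midpoint and at the end points are comparable. -/
lemma exists_weight_comparison (lam : ℝ) (hlam : 1 ≤ lam) :
    ∃ K : ℝ, 0 ≤ K ∧ ∀ h s : ℝ, 0 < h → 1 ≤ s → s * h ≤ 1 → ∀ (k : Fin d) (x : Lat d),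
      |P.ph (lp lam h s (x + ev k)) - P.ph (lp lam h s x)| ≤ K * h ∧
      |P.ph ⟨lam, h, s, toPt h x + (h / 2) • uv k⟩ - P.ph (lp lam h s x)| ≤ K * h ∧
      |P.ph ⟨lam, h, s, toPt h x + (h / 2) • uv k⟩ - P.ph (lp lam h s (x + ev k))| ≤ 2 * K * h := by
  obtain ⟨-, K, h0, hK⟩ := P.ph_rg
  refine ⟨K lam, h0 lam, fun h s hh hs hsh k x => ?_⟩
  have h1 := hK (lp lam h s x) ⟨hlam, hh, hs, hsh⟩ k
  rw [← lp_add] at h1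
  -- The midpoint is one step away on the mesh of size `h / 2`, so the same regularity bound
  -- applies.
  have h2 := hK ⟨lam, h / 2, s, toPt h x⟩ ⟨hlam, half_pos hh, hs, by
    have : s * (h / 2) = s * h / 2 := by ring
    simp only [this]
    have : 0 ≤ s * h := by positivity
    linarith⟩ k
  have h3 : |P.ph ⟨lam, h, s, toPt h x + (h / 2) • uv k⟩ - P.ph (lp lam h s x)|
      ≤ K lam * (h / 2) := h2
  have h4 : 0 ≤ K lam * h := mul_nonneg (h0 _) hh.le
  have h5 : |P.ph (lp lam h s (x + ev k)) - P.ph (lp lam h s x)| ≤ K lam * h := h1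
  refine ⟨h5, by linarith, ?_⟩
  have := abs_sub_le (P.ph ⟨lam, h, s, toPt h x + (h / 2) • uv k⟩) (P.ph (lp lam h s x))
    (P.ph (lp lam h s (x + ev k)))
  rw [abs_sub_comm (P.ph (lp lam h s x))] at this
  linarith

/-- By the discrete product rule, the weighted difference of `u` is the difference of `v` minus
`(e^θ - 1)/h` times `v` at the base vertex, with `|θ| ≤ K s h`. The correction is thus of size `s
|v|`. Multiplied by the prefactor `s`, its square is covered by `s³ v²`. -/
lemma edge_estimate {s h K φ₀ φ₁ φm u₀ u₁ : ℝ} (hh : 0 < h) (hs : 0 < s)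
    (hK1 : 2 * K * (s * h) ≤ 1) (h1 : |φ₁ - φ₀| ≤ K * h)
    (h3 : |φm - φ₁| ≤ 2 * K * h) :
    Real.exp (2 * s * φm) * ((u₁ - u₀) / h) ^ 2
      ≤ Real.exp 2 * (2 * ((Real.exp (s * φ₁) * u₁ - Real.exp (s * φ₀) * u₀) / h) ^ 2
        + 8 * K ^ 2 * (s ^ 2 * (Real.exp (s * φ₀) * u₀) ^ 2)) := by
  have hK0 : 0 ≤ K := by
    have := (abs_nonneg _).trans h1
    exact nonneg_of_mul_nonneg_left this hh
  have i1 : Real.exp (2 * s * φm) ≤ Real.exp 2 * Real.exp (s * φ₁) ^ 2 := by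
    rw [← Real.exp_nat_mul, ← Real.exp_add, Real.exp_le_exp]
    have := mul_le_mul_of_nonneg_left ((le_abs_self _).trans h3) hs.le
    push_cast
    linarith
  set θ := s * (φ₁ - φ₀) with hθ
  have hθ1 : |θ| ≤ K * (s * h) := by
    rw [hθ, abs_mul, abs_of_pos hs]
    have := mul_le_mul_of_nonneg_left h1 hs.le
    linarith
  have hKs : 0 ≤ K * (s * h) := by positivity
  have hθ2 : |Real.exp θ - 1| ≤ 2 * |θ| := Real.abs_exp_sub_one_le (by linarith)
  have e1 : Real.exp (s * φ₁) * ((u₁ - u₀) / h)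
      = (Real.exp (s * φ₁) * u₁ - Real.exp (s * φ₀) * u₀) / h
        - (Real.exp θ - 1) / h * (Real.exp (s * φ₀) * u₀) := by
    have : Real.exp (s * φ₁) = Real.exp θ * Real.exp (s * φ₀) := by
      rw [← Real.exp_add]; congr 1; rw [hθ]; ring
    rw [this]; ring
  have i2 : ((Real.exp θ - 1) / h) ^ 2 ≤ 4 * K ^ 2 * s ^ 2 := by
    have : |(Real.exp θ - 1) / h| ≤ 2 * K * s := by
      rw [abs_div, abs_of_pos hh, div_le_iff₀ hh]
      linarith
    rw [← sq_abs]
    refine (pow_le_pow_left₀ (abs_nonneg _) this 2).trans (le_of_eq (by ring))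
  set v0 := Real.exp (s * φ₀) * u₀
  set E := (Real.exp (s * φ₁) * u₁ - v0) / h
  have i3 : (Real.exp (s * φ₁) * ((u₁ - u₀) / h)) ^ 2
      ≤ 2 * E ^ 2 + 8 * K ^ 2 * (s ^ 2 * v0 ^ 2) := by
    rw [e1]
    have j1 := mul_le_mul_of_nonneg_right i2 (sq_nonneg v0)
    have j2 := sq_nonneg (E + (Real.exp θ - 1) / h * v0)
    linarith
  calc Real.exp (2 * s * φm) * ((u₁ - u₀) / h) ^ 2
      ≤ Real.exp 2 * Real.exp (s * φ₁) ^ 2 * ((u₁ - u₀) / h) ^ 2 :=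
        mul_le_mul_of_nonneg_right i1 (sq_nonneg _)
    _ = Real.exp 2 * (Real.exp (s * φ₁) * ((u₁ - u₀) / h)) ^ 2 := by ring
    _ ≤ _ := mul_le_mul_of_nonneg_left i3 (Real.exp_pos _).le

lemma boundary_weight {s h K φ φm : ℝ} (hs : 0 < s)
    (hK1 : 2 * K * (s * h) ≤ 1) (h3 : |φm - φ| ≤ 2 * K * h) :
    Real.exp (s * φ) ^ 2 ≤ Real.exp 2 * Real.exp (2 * s * φm) := by
  rw [← Real.exp_nat_mul, ← Real.exp_add, Real.exp_le_exp]
  rw [abs_sub_comm] at h3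
  have := mul_le_mul_of_nonneg_left ((le_abs_self _).trans h3) hs.le
  push_cast
  linarith

/-- The boundary density at a vertex: squared conormal derivatives on the edges at the vertex. -/
def bdens (lam h s : ℝ) (k : Fin d) (u : Lat d → ℝ) (x : Lat d) : ℝ :=
  P.we lam h s k x * (P.A k (lp lam h s x) * fd h k u x) ^ 2
    + P.we lam h s k (x - ev k)
      * (P.A k (lp lam h s (x - ev k)) * fd h k u (x - ev k)) ^ 2

lemma bdens_nonneg (lam h s : ℝ) (k : Fin d) (u : Lat d → ℝ) (x : Lat d) :
    0 ≤ P.bdens lam h s k u x :=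
  add_nonneg (mul_nonneg (P.we_pos _ _ _ _ _).le (sq_nonneg _))
    (mul_nonneg (P.we_pos _ _ _ _ _).le (sq_nonneg _))

/-- The left-hand side of the Carleman estimate, up to the factor `h^d`. -/
def latLhs (lam h s : ℝ) (D : Finset (Lat d)) (u : Lat d → ℝ) : ℝ :=
  s ^ 3 * ∑ x ∈ D, (P.wt lam h s x * u x) ^ 2
    + s * ∑ k, ∑ x ∈ fatten D, P.we lam h s k x * fd h k u x ^ 2

/-- The boundary term of the Carleman estimate, up to the factor `h^d`. -/
def latBdry (lam h s : ℝ) (D : Finset (Lat d)) (u : Lat d → ℝ) : ℝ :=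
  s / h * ∑ k, ∑ x ∈ fatten D \ D, P.bdens lam h s k u x

theorem lattice_carleman_edges {a₀ g₀ : ℝ} (H : P.Nondegenerate a₀ g₀) :
    ∃ lam₀ : ℝ, 1 ≤ lam₀ ∧ ∀ lam, lam₀ ≤ lam → ∃ s₀ ε₀ C : ℝ, 1 ≤ s₀ ∧ 0 < ε₀ ∧ 0 < C ∧
      ∀ h s : ℝ, 0 < h → s₀ ≤ s → s * h ≤ ε₀ →
      ∀ (D : Finset (Lat d)) (u : Lat d → ℝ), InCube h D → (∀ x, x ∉ D → u x = 0) →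
      P.latLhs lam h s D u
        ≤ C * (∑ x ∈ D, (P.wt lam h s x * latLap h (fun k x => P.A k (lp lam h s x)) u x) ^ 2
          + P.latBdry lam h s D u) := by
  obtain ⟨lam₀, hlam₀, hcar⟩ := P.lattice_carleman H
  refine ⟨lam₀, hlam₀, fun lam hlam => ?_⟩
  obtain ⟨s₀, ε₁, C, hs₀, hε₁, hε₁1, hC, hmain⟩ := hcar lam hlam
  obtain ⟨K, hK, hcomp⟩ := P.exists_weight_comparison lam (hlam₀.trans hlam)
  have ha := H.a_pos
  set e2 := Real.exp 2 with he2
  have he2p : 0 < e2 := Real.exp_pos 2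
  set C1 := 1 + e2 * (2 + 8 * K ^ 2 * d) with hC1
  set C2 := 1 + e2 / a₀ ^ 2 with hC2
  refine ⟨s₀, min ε₁ (1 / (2 * K + 1)), C1 * (C * C2), hs₀, lt_min hε₁ (by positivity),
    by positivity, fun h s hh hs hsh D u hD hu => ?_⟩
  have hsh1 := hsh.trans (min_le_left _ _)
  have hs1 : 1 ≤ s := hs₀.trans hs
  have hs0 : 0 < s := by linarith
  have hKsh : 2 * K * (s * h) ≤ 1 := by
    have h1 := hsh.trans (min_le_right _ _)
    rw [le_div_iff₀ (by positivity)] at h1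
    have : 0 < s * h := by positivity
    linarith
  have hcomp' := hcomp h s hh hs1 (hsh1.trans hε₁1)
  have hm := hmain h s hh hs hsh1 D u hD hu
  set v : Lat d → ℝ := fun x => P.wt lam h s x * u x with hv
  set X := ∑ x ∈ fatten D, (s * ∑ j, fd h j v x ^ 2 + s ^ 3 * v x ^ 2) with hX
  have hlhs : P.latLhs lam h s D u ≤ C1 * X := by
    have i1 : s ^ 3 * ∑ x ∈ D, (P.wt lam h s x * u x) ^ 2 ≤ ∑ x ∈ fatten D, s ^ 3 * v x ^ 2 := by
      rw [Finset.mul_sum]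
      exact Finset.sum_le_sum_of_subset_of_nonneg (subset_fatten D) fun x _ _ => by positivity
    have i2 : s * ∑ k, ∑ x ∈ fatten D, P.we lam h s k x * fd h k u x ^ 2
        ≤ e2 * (2 * ∑ x ∈ fatten D, s * ∑ j, fd h j v x ^ 2
          + 8 * K ^ 2 * d * ∑ x ∈ fatten D, s ^ 3 * v x ^ 2) := by
      have j1 : ∀ k, ∑ x ∈ fatten D, P.we lam h s k x * fd h k u x ^ 2
          ≤ ∑ x ∈ fatten D, e2 * (2 * fd h k v x ^ 2 + 8 * K ^ 2 * (s ^ 2 * v x ^ 2)) := fun k =>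
        Finset.sum_le_sum fun x _ =>
          edge_estimate hh hs0 hKsh (hcomp' k x).1 (hcomp' k x).2.2
      refine (mul_le_mul_of_nonneg_left (Finset.sum_le_sum fun k _ => j1 k) hs0.le).trans
        (le_of_eq ?_)
      rw [Finset.sum_comm]
      simp only [Finset.mul_sum, ← Finset.sum_add_distrib]
      refine Finset.sum_congr rfl fun x _ => ?_
      simp only [mul_add, Finset.sum_add_distrib, Finset.sum_const, Finset.card_univ,
        Fintype.card_fin, nsmul_eq_mul]
      congr 1
      · rw [Finset.mul_sum]
        exact Finset.sum_congr rfl fun j _ => by ring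
      · ring
    unfold latLhs
    rw [hX, Finset.sum_add_distrib]
    set E := ∑ x ∈ fatten D, s * ∑ j, fd h j v x ^ 2
    set V := ∑ x ∈ fatten D, s ^ 3 * v x ^ 2
    have hE : 0 ≤ E := Finset.sum_nonneg fun x _ =>
      mul_nonneg hs0.le (Finset.sum_nonneg fun j _ => sq_nonneg _)
    have hV : 0 ≤ V := Finset.sum_nonneg fun x _ => by positivity
    have j1 : 0 ≤ e2 * (8 * K ^ 2 * d) * E := by positivity
    have j2 : 0 ≤ e2 * 2 * V := by positivity
    rw [hC1]
    linarith
  have hbd : s / h * ∑ x ∈ fatten D \ D, starGrad h v x ≤ C2 * P.latBdry lam h s D u := by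
    unfold latBdry
    rw [mul_left_comm]
    refine mul_le_mul_of_nonneg_left ?_ (by positivity)
    rw [Finset.sum_comm, Finset.mul_sum]
    refine Finset.sum_le_sum fun x hx => ?_
    have hxD := (Finset.mem_sdiff.1 hx).2
    unfold starGrad
    rw [Finset.mul_sum]
    refine Finset.sum_le_sum fun j _ => ?_
    have hux := hu x hxD
    -- Because `u` vanishes at `x`, differences of `v` on the edges at `x` are exact multiples of
    -- those of `u`; no zeroth order correction enters the boundary term.
    have t1 : fd h j v x = P.wt lam h s (x + ev j) * fd h j u x := by
      simp only [fd, hv, hux]; ring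
    have t2 : fd h j v (x - ev j) = P.wt lam h s (x - ev j) * fd h j u (x - ev j) := by
      simp only [fd, hv, sub_add_cancel, hux]; ring
    have w1 : P.wt lam h s (x + ev j) ^ 2 ≤ e2 * P.we lam h s j x :=
      boundary_weight hs0 hKsh (hcomp' j x).2.2
    have w2 : P.wt lam h s (x - ev j) ^ 2 ≤ e2 * P.we lam h s j (x - ev j) := by
      refine boundary_weight hs0 hKsh (((hcomp' j (x - ev j)).2.1).trans ?_)
      have : 0 ≤ K * h := by positivity
      linarith
    have ha2 : ∀ y, 1 ≤ P.A j (lp lam h s y) ^ 2 / a₀ ^ 2 := fun y => by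
      rw [le_div_iff₀ (by positivity), one_mul]
      exact pow_le_pow_left₀ ha.le (H.le_σ _ _) 2
    have gen : ∀ (w W a f : ℝ), 0 ≤ W → w ^ 2 ≤ e2 * W → 1 ≤ a ^ 2 / a₀ ^ 2 →
        (w * f) ^ 2 ≤ C2 * (W * (a * f) ^ 2) := by
      intro w W a f hW h1 h2
      have k1 := mul_le_mul_of_nonneg_right h1 (sq_nonneg f)
      have k2 := mul_le_mul_of_nonneg_left h2 (by positivity : 0 ≤ e2 * W * f ^ 2)
      have k3 : 0 ≤ W * (a * f) ^ 2 := by positivity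
      have k4 : e2 * W * f ^ 2 * (a ^ 2 / a₀ ^ 2) = e2 / a₀ ^ 2 * (W * (a * f) ^ 2) := by ring
      rw [hC2]
      linarith
    rw [t1, t2]
    unfold bdens
    rw [mul_add]
    exact add_le_add (gen _ _ _ _ (P.we_pos _ _ _ _ _).le w1 (ha2 _))
      (gen _ _ _ _ (P.we_pos _ _ _ _ _).le w2 (ha2 _))
  set Q := ∑ x ∈ D, (P.wt lam h s x * latLap h (fun k x => P.A k (lp lam h s x)) u x) ^ 2
  have hQ : 0 ≤ Q := Finset.sum_nonneg fun _ _ => sq_nonneg _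
  have hC2' : 1 ≤ C2 := by
    have : 0 ≤ e2 / a₀ ^ 2 := by positivity
    linarith
  have k1 : X ≤ C * (C2 * (Q + P.latBdry lam h s D u)) := by
    refine hm.trans (mul_le_mul_of_nonneg_left ?_ hC.le)
    have := mul_le_mul_of_nonneg_right hC2' hQ
    linarith
  have k2 := mul_le_mul_of_nonneg_left k1 (by positivity : 0 ≤ C1)
  linarith

end Phase

/-! ### Bounded potentials, with thresholds independent of their bound. -/

lemma meshSize_le_one (N : ℕ) : meshSize N ≤ 1 := by
  unfold meshSize
  rw [div_le_one (by positivity)]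
  have : (0 : ℝ) ≤ N := Nat.cast_nonneg N
  linarith

namespace Phase
variable (P : Phase d)

/-- The weighted source term of the Carleman estimate, up to the factor `h^d`. -/
def latSource (lam h s : ℝ) (D : Finset (Lat d)) (q u : Lat d → ℝ) : ℝ :=
  ∑ x ∈ D, (P.wt lam h s x * (-latLap h (fun k x => P.A k (lp lam h s x)) u x + q x * u x)) ^ 2

lemma latSource_nonneg (lam h s : ℝ) (D : Finset (Lat d)) (q u : Lat d → ℝ) :
    0 ≤ P.latSource lam h s D q u := Finset.sum_nonneg fun _ _ => sq_nonneg _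

lemma latBdry_nonneg (lam : ℝ) {h s : ℝ} (hh : 0 < h) (hs : 0 ≤ s) (D : Finset (Lat d))
    (u : Lat d → ℝ) : 0 ≤ P.latBdry lam h s D u :=
  mul_nonneg (by positivity) (Finset.sum_nonneg fun _ _ => Finset.sum_nonneg fun _ _ =>
    P.bdens_nonneg _ _ _ _ _ _)

/-- Absorption of a bounded potential for large `s`. -/
lemma absorb_potential {lam h s C M : ℝ} {D : Finset (Lat d)} {q u : Lat d → ℝ}
    (hh : 0 < h) (hs : 1 ≤ s) (hC : 0 ≤ C) (hsM : 4 * C * M ^ 2 ≤ s) (hq : ∀ x ∈ D, |q x| ≤ M)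
    (hmain : P.latLhs lam h s D u
        ≤ C * (∑ x ∈ D, (P.wt lam h s x * latLap h (fun k x => P.A k (lp lam h s x)) u x) ^ 2
          + P.latBdry lam h s D u)) :
    P.latLhs lam h s D u ≤ 4 * C * (P.latSource lam h s D q u + P.latBdry lam h s D u) := by
  have h1 : ∑ x ∈ D, (P.wt lam h s x * latLap h (fun k x => P.A k (lp lam h s x)) u x) ^ 2
      ≤ 2 * P.latSource lam h s D q u + 2 * M ^ 2 * ∑ x ∈ D, (P.wt lam h s x * u x) ^ 2 := by
    unfold latSource
    rw [Finset.mul_sum, Finset.mul_sum, ← Finset.sum_add_distrib]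
    refine Finset.sum_le_sum fun x hx => ?_
    have i1 : q x ^ 2 ≤ M ^ 2 := by
      rw [← sq_abs]; exact pow_le_pow_left₀ (abs_nonneg _) (hq x hx) 2
    have i2 := mul_le_mul_of_nonneg_right i1 (sq_nonneg (P.wt lam h s x * u x))
    set w := P.wt lam h s x
    set L := latLap h (fun k x => P.A k (lp lam h s x)) u x
    have i3 := sq_nonneg (w * (-L + q x * u x) + w * (q x * u x))
    linarith
  have h2 : s ^ 3 * ∑ x ∈ D, (P.wt lam h s x * u x) ^ 2 ≤ P.latLhs lam h s D u := by
    unfold latLhs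
    have : 0 ≤ s * ∑ k, ∑ x ∈ fatten D, P.we lam h s k x * fd h k u x ^ 2 :=
      mul_nonneg (by linarith) (Finset.sum_nonneg fun _ _ => Finset.sum_nonneg fun _ _ =>
        mul_nonneg (P.we_pos _ _ _ _ _).le (sq_nonneg _))
    linarith
  have hV : 0 ≤ ∑ x ∈ D, (P.wt lam h s x * u x) ^ 2 := Finset.sum_nonneg fun _ _ => sq_nonneg _
  set V := ∑ x ∈ D, (P.wt lam h s x * u x) ^ 2
  have hs3 : s ≤ s ^ 3 := by
    have := mul_le_mul_of_nonneg_left (one_le_pow₀ hs : 1 ≤ s ^ 2) (by linarith : 0 ≤ s)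
    linarith
  have h3 := mul_le_mul_of_nonneg_right (hsM.trans hs3) hV
  have h4 := mul_le_mul_of_nonneg_left h1 hC
  have h5 := mul_nonneg hC (P.latBdry_nonneg lam hh (by linarith : 0 ≤ s) D u)
  linarith

lemma ph_le_one (hβ : ∀ y, P.β y ≤ 0) {p : Param d} (hp : 0 ≤ p.lam) : P.ph p ≤ 1 := by
  unfold ph
  rw [← Real.exp_zero, Real.exp_le_exp]
  exact mul_nonpos_of_nonneg_of_nonpos hp (hβ _)

lemma wt_mono {lam h s s₁ : ℝ} (hs : s ≤ s₁) (x : Lat d) :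
    P.wt lam h s x ≤ P.wt lam h s₁ x :=
  Real.exp_le_exp.2 (mul_le_mul_of_nonneg_right hs (P.ph_pos _).le)

lemma we_mono {lam h s s₁ : ℝ} (hs : s ≤ s₁) (k : Fin d) (x : Lat d) :
    P.we lam h s k x ≤ P.we lam h s₁ k x :=
  Real.exp_le_exp.2 (mul_le_mul_of_nonneg_right (by linarith) (P.ph_pos _).le)

/-- Since `β ≤ 0`, the function `φ` takes values in `(0, 1]`. Raising the Carleman parameter to `s₁`
therefore costs at most `e^{s₁}`, uniformly in the mesh. -/
lemma wt_le (hβ : ∀ y, P.β y ≤ 0) {lam h s s₁ : ℝ} (hlam : 0 ≤ lam) (hs0 : 0 ≤ s) (hs : s ≤ s₁)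
    (x : Lat d) : P.wt lam h s₁ x ≤ Real.exp s₁ * P.wt lam h s x := by
  unfold wt
  rw [← Real.exp_add, Real.exp_le_exp]
  have e : P.ph (lp lam h s₁ x) = P.ph (lp lam h s x) := rfl
  rw [e]
  have h1 := P.ph_le_one hβ (p := lp lam h s x) hlam
  have h2 := (P.ph_pos (lp lam h s x)).le
  have h3 := mul_le_mul_of_nonneg_left h1 (hs0.trans hs)
  have h4 := mul_nonneg hs0 h2
  linarith

lemma we_le (hβ : ∀ y, P.β y ≤ 0) {lam h s s₁ : ℝ} (hlam : 0 ≤ lam) (hs0 : 0 ≤ s) (hs : s ≤ s₁)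
    (k : Fin d) (x : Lat d) : P.we lam h s₁ k x ≤ Real.exp s₁ ^ 2 * P.we lam h s k x := by
  unfold we
  rw [← Real.exp_nat_mul, ← Real.exp_add, Real.exp_le_exp]
  set p : Param d := ⟨lam, h, s, toPt h x + (h / 2) • uv k⟩ with hp
  have e : P.ph ⟨lam, h, s₁, toPt h x + (h / 2) • uv k⟩ = P.ph p := rfl
  rw [e]
  have h1 := P.ph_le_one hβ (p := p) hlam
  have h2 := (P.ph_pos p).le
  have h3 := mul_le_mul_of_nonneg_left h1 (hs0.trans hs)
  have h4 := mul_nonneg hs0 h2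
  push_cast
  linarith

lemma latLhs_mono {lam h s s₁ : ℝ} (hs0 : 0 ≤ s) (hs : s ≤ s₁) (D : Finset (Lat d))
    (u : Lat d → ℝ) : P.latLhs lam h s D u ≤ P.latLhs lam h s₁ D u := by
  unfold latLhs
  refine add_le_add (mul_le_mul (pow_le_pow_left₀ hs0 hs 3) (Finset.sum_le_sum fun x _ => ?_)
    (Finset.sum_nonneg fun _ _ => sq_nonneg _) (pow_nonneg (hs0.trans hs) 3))
    (mul_le_mul hs (Finset.sum_le_sum fun k _ => Finset.sum_le_sum fun x _ =>
      mul_le_mul_of_nonneg_right (P.we_mono hs k x) (sq_nonneg _))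
      (Finset.sum_nonneg fun _ _ => Finset.sum_nonneg fun _ _ =>
        mul_nonneg (P.we_pos _ _ _ _ _).le (sq_nonneg _)) (hs0.trans hs))
  rw [mul_pow, mul_pow]
  exact mul_le_mul_of_nonneg_right (pow_le_pow_left₀ (P.wt_pos _ _ _ _).le (P.wt_mono hs x) 2)
    (sq_nonneg _)

lemma latSource_le (hβ : ∀ y, P.β y ≤ 0) {lam h s s₁ : ℝ} (hlam : 0 ≤ lam) (hs0 : 0 ≤ s)
    (hs : s ≤ s₁) (D : Finset (Lat d)) (q u : Lat d → ℝ) :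
    P.latSource lam h s₁ D q u ≤ Real.exp s₁ ^ 2 * P.latSource lam h s D q u := by
  unfold latSource
  rw [Finset.mul_sum]
  refine Finset.sum_le_sum fun x _ => ?_
  have e : latLap h (fun k x => P.A k (lp lam h s₁ x)) u x
      = latLap h (fun k x => P.A k (lp lam h s x)) u x := rfl
  rw [e, mul_pow, mul_pow, ← mul_assoc, ← mul_pow (Real.exp s₁)]
  exact mul_le_mul_of_nonneg_right (pow_le_pow_left₀ (P.wt_pos _ _ _ _).le
    (P.wt_le hβ hlam hs0 hs x) 2) (sq_nonneg _)

lemma latBdry_le (hβ : ∀ y, P.β y ≤ 0) {lam h s s₁ : ℝ} (hlam : 0 ≤ lam) (hh : 0 < h)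
    (hs1 : 1 ≤ s) (hs : s ≤ s₁) (D : Finset (Lat d)) (u : Lat d → ℝ) :
    P.latBdry lam h s₁ D u ≤ s₁ * Real.exp s₁ ^ 2 * P.latBdry lam h s D u := by
  have hs0 : 0 ≤ s := by linarith
  unfold latBdry
  have h1 : ∑ k, ∑ x ∈ fatten D \ D, P.bdens lam h s₁ k u x
      ≤ Real.exp s₁ ^ 2 * ∑ k, ∑ x ∈ fatten D \ D, P.bdens lam h s k u x := by
    simp only [Finset.mul_sum]
    refine Finset.sum_le_sum fun k _ => Finset.sum_le_sum fun x _ => ?_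
    have e : ∀ y : Lat d, P.A k (lp lam h s₁ y) = P.A k (lp lam h s y) := fun _ => rfl
    unfold bdens
    rw [e, e, mul_add, ← mul_assoc, ← mul_assoc]
    exact add_le_add (mul_le_mul_of_nonneg_right (P.we_le hβ hlam hs0 hs k _) (sq_nonneg _))
      (mul_le_mul_of_nonneg_right (P.we_le hβ hlam hs0 hs k _) (sq_nonneg _))
  have h2 : s₁ / h ≤ s₁ * (s / h) := by
    rw [← mul_div_assoc]
    refine div_le_div_of_nonneg_right ?_ hh.le
    have := mul_le_mul_of_nonneg_left hs1 (hs0.trans hs)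
    linarith
  have h3 : 0 ≤ ∑ k, ∑ x ∈ fatten D \ D, P.bdens lam h s₁ k u x :=
    Finset.sum_nonneg fun _ _ => Finset.sum_nonneg fun _ _ => P.bdens_nonneg _ _ _ _ _ _
  have h4 := mul_le_mul h2 h1 h3 (by have := hs0.trans hs; positivity)
  linarith

lemma one_le_wt {lam h s : ℝ} (hs : 0 ≤ s) (x : Lat d) : 1 ≤ P.wt lam h s x :=
  Real.one_le_exp (mul_nonneg hs (P.ph_pos _).le)

lemma one_le_we {lam h s : ℝ} (hs : 0 ≤ s) (k : Fin d) (x : Lat d) : 1 ≤ P.we lam h s k x :=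
  Real.one_le_exp (mul_nonneg (by linarith) (P.ph_pos _).le)

/-- Quantitative unique continuation across layers on a fixed mesh. -/
lemma layer_bound {a₀ g₀ : ℝ} (H : P.Nondegenerate a₀ g₀) (i₀ : Fin d) (N : ℕ) {M : ℝ}
    (hM : 0 ≤ M) (n : ℕ) :
    ∃ c : ℝ, 0 ≤ c ∧ ∀ (lam s ρ : ℝ) (q u : Lat d → ℝ), 0 ≤ ρ → (∀ x ∈ box d N, |q x| ≤ M) →
      (∀ x, x ∉ box d N → u x = 0) →
      (∀ x ∈ box d N, |-latLap (meshSize N) (fun k x => P.A k (lp lam (meshSize N) s x)) u x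
        + q x * u x| ≤ ρ) →
      (∀ x, x ∉ box d N → x + ev i₀ ∈ box d N →
        |P.A i₀ (lp lam (meshSize N) s x) * fd (meshSize N) i₀ u x| ≤ ρ) →
      ∀ x, x i₀ ≤ (n : ℤ) → |u x| ≤ c * ρ := by
  set h := meshSize N with hh'
  have hh : 0 < h := meshSize_pos N
  have ha := H.a_pos
  have hb := P.bound_nonneg
  induction n with
  | zero =>
    refine ⟨0, le_rfl, fun lam s ρ q u hρ hq hu _ _ x hx => ?_⟩
    rw [hu x (fun hm => by have := (mem_box.1 hm i₀).1; push_cast at hx; omega)]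
    simp
  | succ n ih =>
    obtain ⟨c, hc, ih⟩ := ih
    -- The bracket bounds the flux across the next edge: `1` is for an edge leaving the boundary.
    -- The other terms come from the equation, namely potential and source, then the transverse
    -- fluxes, then the incoming flux.
    set c' := c + h / a₀ * (1 + h * (M * c + 1) + d * (2 * P.bound * (2 * c / h))
      + P.bound * (2 * c / h)) with hc'
    have hcc' : c ≤ c' := by
      rw [hc']
      have : 0 ≤ h / a₀ * (1 + h * (M * c + 1) + d * (2 * P.bound * (2 * c / h))
        + P.bound * (2 * c / h)) := by positivity
      linarith
    refine ⟨c', hc.trans hcc', fun lam s ρ q u hρ hq hu hf hbd x hx => ?_⟩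
    have ihx := ih lam s ρ q u hρ hq hu hf hbd
    rcases lt_or_ge (n : ℤ) (x i₀) with hlt | hle
    swap
    · exact (ihx x hle).trans (mul_le_mul_of_nonneg_right hcc' hρ)
    by_cases hxD : x ∈ box d N
    swap
    · rw [hu x hxD, abs_zero]; exact mul_nonneg (hc.trans hcc') hρ
    set y := x - ev i₀ with hy
    have hyx : y + ev i₀ = x := by rw [hy]; abel
    have hyn : y i₀ ≤ (n : ℤ) := by
      push_cast at hx
      simp only [hy, Pi.sub_apply, ev, Pi.single_eq_same]; omega
    have hAlow : a₀ ≤ P.A i₀ (lp lam h s y) := H.le_σ _ _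
    have hApos := ha.trans_le hAlow
    have hA : ∀ k z, |P.A k (lp lam h s z)| ≤ P.bound := fun k z => P.σ_le _ _
    have red : ∀ R : ℝ, 0 ≤ R → |P.A i₀ (lp lam h s y) * fd h i₀ u y| ≤ R →
        |u x| ≤ c * ρ + h / a₀ * R := by
      intro R hR h1
      rw [abs_mul, abs_of_pos hApos] at h1
      have h2 : a₀ * |fd h i₀ u y| ≤ R :=
        (mul_le_mul_of_nonneg_right hAlow (abs_nonneg _)).trans h1
      have h3 : |fd h i₀ u y| ≤ R / a₀ := by rw [le_div_iff₀ ha]; linarith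
      have h4 : u x = u y + h * fd h i₀ u y := by
        simp only [fd, hyx]; field_simp; ring
      rw [h4]
      refine (abs_add_le _ _).trans (add_le_add (ihx y hyn) ?_)
      rw [abs_mul, abs_of_pos hh, div_mul_eq_mul_div, mul_div_assoc]
      exact mul_le_mul_of_nonneg_left h3 hh.le
    -- At an interior `y`, every edge other than the one to `x` joins points of layers already
    -- bounded, so the equation at `y` determines the flux towards `x`. Otherwise the edge leaves
    -- the boundary and its flux is given directly by the boundary data.
    by_cases hyD : y ∈ box d N
    · have flux : ∀ (k : Fin d) (z : Lat d), z i₀ ≤ (n : ℤ) → (z + ev k) i₀ ≤ (n : ℤ) →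
          |P.A k (lp lam h s z) * fd h k u z| ≤ P.bound * (2 * c / h) * ρ := by
        intro k z h1 h2
        rw [abs_mul, mul_assoc]
        refine mul_le_mul (hA _ _) ?_ (abs_nonneg _) hb
        rw [fd, abs_div, abs_of_pos hh, div_mul_eq_mul_div]
        refine div_le_div_of_nonneg_right ((abs_sub _ _).trans ?_) hh.le
        have := ihx z h1
        have := ihx _ h2
        linarith
      have hsum := hf y hyD
      unfold latLap at hsum
      rw [← Finset.add_sum_erase Finset.univ _ (Finset.mem_univ i₀)] at hsum
      set T := ∑ k ∈ Finset.univ.erase i₀, (P.A k (lp lam h s y) * fd h k u y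
        - P.A k (lp lam h s (y - ev k)) * fd h k u (y - ev k)) / h with hT
      have hTb : |T * h| ≤ d * (2 * P.bound * (2 * c / h)) * ρ := by
        rw [hT, Finset.sum_mul]
        refine (Finset.abs_sum_le_sum_abs _ _).trans ?_
        have : ∀ k ∈ Finset.univ.erase i₀, |(P.A k (lp lam h s y) * fd h k u y
            - P.A k (lp lam h s (y - ev k)) * fd h k u (y - ev k)) / h * h|
            ≤ 2 * P.bound * (2 * c / h) * ρ := by
          intro k hk
          have hne : i₀ ≠ k := (Finset.ne_of_mem_erase hk).symm
          have e0 : ev k i₀ = 0 := by simp [ev, Pi.single_eq_of_ne hne]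
          rw [div_mul_cancel₀ _ hh.ne']
          have f1 := flux k y hyn (by simp only [Pi.add_apply, e0]; omega)
          have f2 := flux k (y - ev k) (by simp only [Pi.sub_apply, e0]; omega)
            (by simpa using hyn)
          refine (abs_sub _ _).trans ?_
          linarith
        refine (Finset.sum_le_sum this).trans ?_
        rw [Finset.sum_const, nsmul_eq_mul, mul_assoc (d : ℝ)]
        refine mul_le_mul_of_nonneg_right ?_ (by positivity)
        have := Finset.card_le_univ (Finset.univ.erase i₀)
        rw [Fintype.card_fin] at this
        exact_mod_cast this
      have f3 := flux i₀ (y - ev i₀)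
        (by simp only [Pi.sub_apply, ev, Pi.single_eq_same]; omega) (by simpa using hyn)
      have f4 : |q y * u y| ≤ M * (c * ρ) := by
        rw [abs_mul]; exact mul_le_mul (hq y hyD) (ihx y hyn) (abs_nonneg _) hM
      set F := P.A i₀ (lp lam h s y) * fd h i₀ u y with hF
      set F' := P.A i₀ (lp lam h s (y - ev i₀)) * fd h i₀ u (y - ev i₀)
      set f := -((F - F') / h + T) + q y * u y with hfdef
      have e : F = h * (q y * u y - f) - T * h + F' := by
        rw [hfdef]; field_simp; ring
      have hFb : |F| ≤ (h * (M * c + 1) + d * (2 * P.bound * (2 * c / h))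
          + P.bound * (2 * c / h)) * ρ := by
        rw [e]
        have j1 : |h * (q y * u y - f)| ≤ h * (M * (c * ρ) + ρ) := by
          rw [abs_mul, abs_of_pos hh]
          exact mul_le_mul_of_nonneg_left ((abs_sub _ _).trans (add_le_add f4 hsum)) hh.le
        have j2 := abs_add_le (h * (q y * u y - f) - T * h) F'
        have j3 := abs_sub (h * (q y * u y - f)) (T * h)
        linarith
      refine (red _ (by positivity) hFb).trans ?_
      rw [hc']
      have : 0 ≤ h / a₀ * ρ := by positivity
      linarith
    · have h1 := red ρ hρ (hbd y hyD (by rw [hyx]; exact hxD))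
      refine h1.trans ?_
      rw [hc']
      have : 0 ≤ h / a₀ * ((h * (M * c + 1) + d * (2 * P.bound * (2 * c / h))
        + P.bound * (2 * c / h)) * ρ) := by positivity
      linarith

/-- All weights lie between `1` and a power of `e^{s₁}`, and `s/h ≥ 1`. The square root of the
right-hand side thus bounds every pointwise source and boundary datum, and `layer_bound` carries
this bound to all of `u`. The constant may depend badly on `N`. -/
lemma fixed_mesh {a₀ g₀ : ℝ} (H : P.Nondegenerate a₀ g₀) (hβ : ∀ y, P.β y ≤ 0) (i₀ : Fin d)
    (N : ℕ) {M : ℝ} (hM : 0 ≤ M) {s₁ : ℝ} (hs₁ : 1 ≤ s₁) {lam : ℝ} (hlam : 0 ≤ lam) :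
    ∃ C : ℝ, 0 ≤ C ∧ ∀ (s : ℝ) (q u : Lat d → ℝ), 1 ≤ s → s ≤ s₁ →
      (∀ x ∈ box d N, |q x| ≤ M) → (∀ x, x ∉ box d N → u x = 0) →
      P.latLhs lam (meshSize N) s (box d N) u
        ≤ C * (P.latSource lam (meshSize N) s (box d N) q u
          + P.latBdry lam (meshSize N) s (box d N) u) := by
  obtain ⟨c, hc, hlayer⟩ := P.layer_bound H i₀ N hM N
  set h := meshSize N with hh'
  have hh : 0 < h := meshSize_pos N
  set w := Real.exp s₁ with hw
  have hw0 : 0 < w := Real.exp_pos _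
  refine ⟨s₁ ^ 3 * ((box d N).card * (w ^ 2 * w ^ 2 * c ^ 2))
    + s₁ * (d * ((fatten (box d N)).card * (w ^ 2 * w ^ 2 * (2 * c / h) ^ 2))), by positivity,
    fun s q u hs hss hq hu => ?_⟩
  have hs0 : 0 ≤ s := by linarith
  set X := P.latSource lam h s (box d N) q u + P.latBdry lam h s (box d N) u with hX
  have hS0 := P.latSource_nonneg lam h s (box d N) q u
  have hB0 := P.latBdry_nonneg lam hh hs0 (box d N) u
  have hX0 : 0 ≤ X := add_nonneg hS0 hB0
  have hρ := Real.sqrt_nonneg X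
  have hρ2 : Real.sqrt X ^ 2 = X := Real.sq_sqrt hX0
  have hub : ∀ x, |u x| ≤ c * Real.sqrt X := by
    intro x
    by_cases hx : x ∈ box d N
    swap
    · rw [hu x hx, abs_zero]; positivity
    refine hlayer lam s (Real.sqrt X) q u hρ hq hu (fun y hy => ?_) (fun y hy hy' => ?_) x
      (mem_box.1 hx i₀).2
    · refine Real.abs_le_sqrt ?_
      refine le_trans ?_ (le_add_of_nonneg_right hB0)
      refine le_trans ?_ (Finset.single_le_sum (f := fun x => (P.wt lam h s x *
        (-latLap h (fun k x => P.A k (lp lam h s x)) u x + q x * u x)) ^ 2)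
        (fun _ _ => sq_nonneg _) hy)
      rw [mul_pow]
      exact le_mul_of_one_le_left (sq_nonneg _) (one_le_pow₀ (P.one_le_wt hs0 y))
    · refine Real.abs_le_sqrt ?_
      refine le_trans ?_ (le_add_of_nonneg_left hS0)
      have hyf : y ∈ fatten (box d N) \ box d N := Finset.mem_sdiff.2
        ⟨mem_fatten hy' fun i => (abs_ev_le i₀ i).trans (by norm_num), hy⟩
      have h1 : P.bdens lam h s i₀ u y ≤ ∑ k, ∑ x ∈ fatten (box d N) \ box d N,
          P.bdens lam h s k u x :=
        (Finset.single_le_sum (f := fun x => P.bdens lam h s i₀ u x)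
          (fun _ _ => P.bdens_nonneg _ _ _ _ _ _) hyf).trans
        (Finset.single_le_sum (f := fun k => ∑ x ∈ fatten (box d N) \ box d N,
          P.bdens lam h s k u x) (fun _ _ => Finset.sum_nonneg fun _ _ =>
            P.bdens_nonneg _ _ _ _ _ _) (Finset.mem_univ i₀))
      have h2 : 1 ≤ s / h := by
        rw [le_div_iff₀ hh, one_mul]; exact (meshSize_le_one N).trans hs
      unfold latBdry
      refine le_trans ?_ (h1.trans (le_mul_of_one_le_left ((P.bdens_nonneg _ _ _ _ _ _).trans h1)
        h2))
      unfold bdens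
      refine le_trans ?_ (le_add_of_nonneg_right (mul_nonneg (P.we_pos _ _ _ _ _).le
        (sq_nonneg _)))
      exact le_mul_of_one_le_left (sq_nonneg _) (P.one_le_we hs0 _ _)
  have hph : ∀ p : Param d, p.lam = lam → s * P.ph p ≤ s₁ := fun p hp => by
    have h1 := P.ph_le_one hβ (p := p) (by rw [hp]; exact hlam)
    have := mul_le_mul_of_nonneg_left h1 hs0
    linarith
  have hww : 1 ≤ w ^ 2 := one_le_pow₀ (Real.one_le_exp (by linarith))
  have hwt : ∀ x, P.wt lam h s x ≤ w := fun x => Real.exp_le_exp.2 (hph _ rfl)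
  have hwe : ∀ k x, P.we lam h s k x ≤ w ^ 2 := fun k x => by
    rw [hw, ← Real.exp_nat_mul]
    refine Real.exp_le_exp.2 ?_
    have := hph ⟨lam, h, s, toPt h x + (h / 2) • uv k⟩ rfl
    push_cast
    linarith
  have hw2 : ∀ T : ℝ, 0 ≤ T → w ^ 2 * T ≤ w ^ 2 * w ^ 2 * T := fun T hT => by
    have := mul_le_mul_of_nonneg_right hww (by positivity : 0 ≤ w ^ 2 * T)
    linarith
  unfold latLhs
  rw [add_mul]
  refine add_le_add ?_ ?_
  · rw [mul_assoc]
    refine mul_le_mul (pow_le_pow_left₀ hs0 hss 3) ?_ (Finset.sum_nonneg fun _ _ => sq_nonneg _)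
      (by positivity)
    rw [mul_assoc, ← nsmul_eq_mul]
    refine Finset.sum_le_card_nsmul _ _ _ fun x _ => ?_
    have h1 : u x ^ 2 ≤ c ^ 2 * X := by
      rw [← sq_abs, ← hρ2, ← mul_pow]
      exact pow_le_pow_left₀ (abs_nonneg _) (hub x) 2
    rw [mul_pow]
    have h2 := mul_le_mul (pow_le_pow_left₀ (P.wt_pos lam h s x).le (hwt x) 2) h1 (sq_nonneg _)
      (by positivity)
    have h3 := hw2 (c ^ 2 * X) (by positivity)
    linarith
  · rw [mul_assoc s₁]
    refine mul_le_mul hss ?_ (Finset.sum_nonneg fun _ _ => Finset.sum_nonneg fun _ _ =>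
        mul_nonneg (P.we_pos _ _ _ _ _).le (sq_nonneg _)) (by positivity)
    have hk : ∀ k : Fin d, ∑ x ∈ fatten (box d N), P.we lam h s k x * fd h k u x ^ 2
        ≤ (fatten (box d N)).card * (w ^ 2 * w ^ 2 * (2 * c / h) ^ 2 * X) := by
      intro k
      rw [← nsmul_eq_mul]
      refine Finset.sum_le_card_nsmul _ _ _ fun x _ => ?_
      have h1 : fd h k u x ^ 2 ≤ (2 * c / h) ^ 2 * X := by
        rw [← sq_abs, ← hρ2, ← mul_pow]
        refine pow_le_pow_left₀ (abs_nonneg _) ?_ 2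
        rw [fd, abs_div, abs_of_pos hh, div_mul_eq_mul_div]
        refine div_le_div_of_nonneg_right ((abs_sub _ _).trans ?_) hh.le
        have := hub x
        have := hub (x + ev k)
        linarith
      have h2 := mul_le_mul (hwe k x) h1 (sq_nonneg _) (by positivity)
      have h3 := hw2 ((2 * c / h) ^ 2 * X) (by positivity)
      linarith
    refine (Finset.sum_le_sum fun k _ => hk k).trans (le_of_eq ?_)
    rw [Finset.sum_const, Finset.card_univ, Fintype.card_fin, nsmul_eq_mul]
    ring

/-- There are three regimes: `s ≥ s₁`, where the potential is absorbed; `s < s₁` with `s₁ h ≤ ε₀`,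
compared with the estimate at `s₁`; and `s₁ h > ε₀`, where only finitely many meshes occur. The
final constant is the sum of the three. -/
theorem lattice_carleman_potential {a₀ g₀ : ℝ} (H : P.Nondegenerate a₀ g₀)
    (hβ : ∀ y, P.β y ≤ 0) (i₀ : Fin d) :
    ∃ lam₀ : ℝ, 1 ≤ lam₀ ∧ ∀ lam, lam₀ ≤ lam → ∃ s₀ ε₀ : ℝ, 1 ≤ s₀ ∧ 0 < ε₀ ∧
      ∀ M : ℝ, 0 ≤ M → ∃ C : ℝ, 0 < C ∧ ∀ (N : ℕ) (s : ℝ) (q u : Lat d → ℝ),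
      s₀ ≤ s → s * meshSize N ≤ ε₀ →
      (∀ x ∈ box d N, |q x| ≤ M) → (∀ x, x ∉ box d N → u x = 0) →
      P.latLhs lam (meshSize N) s (box d N) u
        ≤ C * (P.latSource lam (meshSize N) s (box d N) q u
          + P.latBdry lam (meshSize N) s (box d N) u) := by
  obtain ⟨lam₀, hlam₀, hcar⟩ := P.lattice_carleman_edges H
  refine ⟨lam₀, hlam₀, fun lam hlam => ?_⟩
  obtain ⟨s₀, ε₀, C, hs₀, hε₀, hC, hmain⟩ := hcar lam hlam
  refine ⟨s₀, ε₀, hs₀, hε₀, fun M hM => ?_⟩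
  have hlam0 : 0 ≤ lam := by linarith
  set s₁ := s₀ + 4 * C * M ^ 2 with hs₁
  have hs₀₁ : s₀ ≤ s₁ := by rw [hs₁]; have : 0 ≤ 4 * C * M ^ 2 := by positivity
                            linarith
  have hs₁1 : 1 ≤ s₁ := hs₀.trans hs₀₁
  choose Cf hCf0 hCf using fun N => P.fixed_mesh H hβ i₀ N hM hs₁1 hlam0
  -- The inequality `s₁ h > ε₀` means `N + 1 < s₁ / ε₀`, so all exceptional `N` lie in `Finset.range
  -- n`.
  set n := ⌈s₁ / ε₀⌉₊ with hn
  set C2 := 4 * C * (s₁ * Real.exp s₁ ^ 2) with hC2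
  have hC20 : 0 < C2 := by have := Real.exp_pos s₁; positivity
  have hC3 : 0 ≤ ∑ N ∈ Finset.range n, Cf N := Finset.sum_nonneg fun N _ => hCf0 N
  refine ⟨4 * C + C2 + ∑ N ∈ Finset.range n, Cf N, by positivity,
    fun N s q u hs hsh hq hu => ?_⟩
  set h := meshSize N with hh'
  have hh : 0 < h := meshSize_pos N
  have hs1 : 1 ≤ s := hs₀.trans hs
  have hs0 : 0 ≤ s := by linarith
  set X := P.latSource lam h s (box d N) q u + P.latBdry lam h s (box d N) u with hX
  have hS0 := P.latSource_nonneg lam h s (box d N) q u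
  have hB0 := P.latBdry_nonneg lam hh hs0 (box d N) u
  have hX0 : 0 ≤ X := add_nonneg hS0 hB0
  rcases le_or_gt s₁ s with hle | hlt
  · have := P.absorb_potential (M := M) hh hs1 hC.le (by linarith) hq
      (hmain h s hh hs hsh (box d N) u (inCube_box N) hu)
    refine this.trans (mul_le_mul_of_nonneg_right ?_ hX0)
    linarith
  rcases le_or_gt (s₁ * h) ε₀ with hle | hgt
  · have h1 := P.absorb_potential (M := M) hh hs₁1 hC.le (by linarith) hq
      (hmain h s₁ hh hs₀₁ hle (box d N) u (inCube_box N) hu)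
    have h2 := P.latLhs_mono (lam := lam) (h := h) hs0 hlt.le (box d N) u
    have h3 := P.latSource_le hβ (h := h) hlam0 hs0 hlt.le (box d N) q u
    have h4 := P.latBdry_le hβ hlam0 hh hs1 hlt.le (box d N) u
    have h5 : Real.exp s₁ ^ 2 * P.latSource lam h s (box d N) q u
        ≤ s₁ * Real.exp s₁ ^ 2 * P.latSource lam h s (box d N) q u := by
      rw [mul_assoc s₁]
      exact le_mul_of_one_le_left (by positivity) hs₁1
    have h6 : P.latSource lam h s₁ (box d N) q u + P.latBdry lam h s₁ (box d N) u
        ≤ s₁ * Real.exp s₁ ^ 2 * X := by rw [hX]; linarith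
    have h7 := mul_le_mul_of_nonneg_left h6 (by positivity : 0 ≤ 4 * C)
    refine (h2.trans (h1.trans h7)).trans ?_
    rw [← mul_assoc, ← hC2]
    exact mul_le_mul_of_nonneg_right (by linarith) hX0
  · have hN : N ∈ Finset.range n := by
      rw [Finset.mem_range, hn, Nat.lt_ceil, lt_div_iff₀ hε₀]
      have h1 := mul_lt_mul_of_pos_left hgt (by positivity : (0 : ℝ) < (N : ℝ) + 1)
      have h2 : ((N : ℝ) + 1) * (s₁ * h) = s₁ := by
        have := meshSize_mul N
        calc ((N : ℝ) + 1) * (s₁ * h) = s₁ * (h * ((N : ℝ) + 1)) := by ring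
          _ = s₁ := by rw [hh', this, mul_one]
      linarith
    have h1 := hCf N s q u hs1 hlt.le hq hu
    refine h1.trans (mul_le_mul_of_nonneg_right ?_ hX0)
    have := Finset.single_le_sum (f := Cf) (fun N _ => hCf0 N) hN
    linarith

end Phase

/-! ### The mesh as an image of the lattice, and Lipschitz regularity of the coefficients. -/

open Filter Topology in
lemma tendsto_meshSize : Tendsto meshSize atTop (𝓝 0) :=
  tendsto_one_div_add_atTop_nhds_zero_nat

lemma innerMesh_eq (d N : ℕ) :
    innerMesh d N = toPt (meshSize N) '' (box d N : Set (Lat d)) := by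
  have h0 := meshSize_pos N
  have h1 := meshSize_mul N
  ext x
  constructor
  · rintro ⟨hx, m, hm, hxm⟩
    refine ⟨fun i => (m i : ℤ), ?_, ?_⟩
    · rw [Finset.mem_coe, mem_box]
      intro i
      have hi := hx i
      rw [hxm i] at hi
      have i1 : (0 : ℝ) < m i := pos_of_mul_pos_right hi.1 h0.le
      have i2 : (m i : ℝ) < N + 1 := by
        rw [← h1] at hi
        exact lt_of_mul_lt_mul_left hi.2 h0.le
      have i3 : 0 < m i := by exact_mod_cast i1
      have i4 : m i < N + 1 := by exact_mod_cast i2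
      omega
    · ext i
      rw [toPt_apply, hxm i]; simp
  · rintro ⟨z, hz, rfl⟩
    rw [Finset.mem_coe, mem_box] at hz
    refine ⟨fun i => ?_, fun i => (z i).toNat, fun i => by
      have := hz i
      change (z i).toNat ≤ N + 1
      omega, fun i => ?_⟩
    · have i1 : (1 : ℝ) ≤ z i := by exact_mod_cast (hz i).1
      have i2 : (z i : ℝ) ≤ N := by exact_mod_cast (hz i).2
      rw [toPt_apply]
      refine ⟨mul_pos h0 (by linarith), ?_⟩
      rw [← h1]
      exact mul_lt_mul_of_pos_left (by linarith) h0
    · rw [toPt_apply]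
      congr 1
      have := (hz i).1
      have e : (((z i).toNat : ℤ) : ℝ) = (z i : ℝ) := by
        rw [Int.toNat_of_nonneg (by omega)]
      exact_mod_cast e.symm

lemma innerMesh_finite (d N : ℕ) : (innerMesh d N).Finite := by
  rw [innerMesh_eq]
  exact (Finset.finite_toSet _).image _

lemma dualMesh_finite {h : ℝ} {k : Fin d} {W : Set (Pt d)} (hW : W.Finite) :
    (dualMesh h k W).Finite := (hW.image _).union (hW.image _)

lemma subset_closedMesh (h : ℝ) (k : Fin d) (W : Set (Pt d)) : W ⊆ closedMesh h k W := by
  intro x hx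
  refine Or.inr ⟨shiftPos h k x, Or.inl ⟨x, hx, rfl⟩, ?_⟩
  simp [shiftPos, shiftNeg]

lemma abs_le_linftyNorm {W : Set (Pt d)} (hW : W.Finite) (u : Pt d → ℝ) {x : Pt d} (hx : x ∈ W) :
    |u x| ≤ linftyNorm W u := by
  have : Finite W := hW
  exact le_ciSup (f := fun x : W => |u x|) (Set.finite_range _).bddAbove ⟨x, hx⟩

lemma linftyNorm_nonneg (W : Set (Pt d)) (u : Pt d → ℝ) : 0 ≤ linftyNorm W u :=
  Real.iSup_nonneg fun _ => abs_nonneg _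

lemma abs_diffOp_le_epsDiff (σ : Fin d → Pt d → ℝ) (N : ℕ) (k j : Fin d) {x : Pt d}
    (hx : x ∈ innerMesh d N) : |diffOp (meshSize N) j (σ k) x| ≤ epsDiff σ N := by
  refine (abs_le_linftyNorm (dualMesh_finite (dualMesh_finite (innerMesh_finite d N))) _
    (subset_closedMesh (meshSize N) k _ hx)).trans ?_
  refine (Finset.single_le_sum (f := fun j => linftyNorm (closedMesh (meshSize N) k
    (innerMesh d N)) (diffOp (meshSize N) j (σ k))) (fun _ _ => linftyNorm_nonneg _ _)
    (Finset.mem_univ j)).trans ?_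
  exact Finset.single_le_sum (f := fun k => ∑ j, linftyNorm (closedMesh (meshSize N) k
    (innerMesh d N)) (diffOp (meshSize N) j (σ k)))
    (fun _ _ => Finset.sum_nonneg fun _ _ => linftyNorm_nonneg _ _) (Finset.mem_univ k)

/-- Along a mesh line, increments of a coefficient are bounded by the distance. -/
lemma mesh_line_lipschitz {σ : Fin d → Pt d → ℝ} {N : ℕ} (hN : epsDiff σ N < 1) (k j : Fin d)
    (z : Lat d) (hz : ∀ i, 1 ≤ z i ∧ z i ≤ N) (m n : ℕ) (hmn : m + n ≤ N) :
    |σ k (toPt (meshSize N) (Function.update z j ((m + n : ℕ) : ℤ)) + (meshSize N / 2) • uv j)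
      - σ k (toPt (meshSize N) (Function.update z j (m : ℤ)) + (meshSize N / 2) • uv j)|
      ≤ meshSize N * n := by
  have h0 := meshSize_pos N
  set h := meshSize N
  induction n with
  | zero => simp
  | succ n ih =>
    have ih := ih (by omega)
    set y : Lat d := Function.update z j ((m + (n + 1) : ℕ) : ℤ) with hy
    have hyD : y ∈ box d N := by
      rw [mem_box]
      intro i
      rcases eq_or_ne i j with rfl | hi
      · rw [hy, Function.update_self]; omega
      · rw [hy, Function.update_of_ne hi]; exact hz i
    have hyI : toPt h y ∈ innerMesh d N := by
      rw [innerMesh_eq]; exact ⟨y, hyD, rfl⟩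
    have h1 := (abs_diffOp_le_epsDiff σ N k j hyI).trans hN.le
    have e : shiftNeg h j (toPt h y)
        = toPt h (Function.update z j ((m + n : ℕ) : ℤ)) + (h / 2) • uv j := by
      have e1 : y = Function.update z j ((m + n : ℕ) : ℤ) + ev j := by
        ext i
        rcases eq_or_ne i j with rfl | hi
        · simp [hy, ev]; ring
        · simp [hy, ev, hi]
      rw [e1, toPt_add_ev]
      unfold shiftNeg
      module
    have h2 : |σ k (toPt h y + (h / 2) • uv j)
        - σ k (toPt h (Function.update z j ((m + n : ℕ) : ℤ)) + (h / 2) • uv j)| ≤ h := by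
      rw [diffOp, abs_div, abs_of_pos h0, div_le_one h0, e] at h1
      exact h1
    have h3 := abs_sub_le (σ k (toPt h y + (h / 2) • uv j))
      (σ k (toPt h (Function.update z j ((m + n : ℕ) : ℤ)) + (h / 2) • uv j))
      (σ k (toPt h (Function.update z j (m : ℤ)) + (h / 2) • uv j))
    push_cast
    linarith

/-- The interior mesh index nearest to a coordinate. -/
def nearIdx (N : ℕ) (t : ℝ) : ℤ := max 1 (min (N : ℤ) ⌊t * (N + 1)⌋)

lemma nearIdx_bounds {N : ℕ} (hN : 1 ≤ N) (t : ℝ) : 1 ≤ nearIdx N t ∧ nearIdx N t ≤ N := by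
  unfold nearIdx; omega

lemma abs_nearIdx_sub {N : ℕ} (hN : 1 ≤ N) {t : ℝ} (h0 : 0 ≤ t) (h1 : t ≤ 1) :
    |meshSize N * nearIdx N t - t| ≤ meshSize N := by
  have hp := meshSize_pos N
  have hm := meshSize_mul N
  have e : meshSize N * nearIdx N t - t = meshSize N * (nearIdx N t - t * (N + 1)) := by
    rw [mul_sub, mul_left_comm, hm, mul_one]
  rw [e, abs_mul, abs_of_pos hp]
  refine mul_le_of_le_one_right hp.le ?_
  have hN0 : (0 : ℝ) ≤ N := Nat.cast_nonneg N
  have f1 := Int.floor_le (t * ((N : ℝ) + 1))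
  have f2 := Int.lt_floor_add_one (t * ((N : ℝ) + 1))
  have f3 : 0 ≤ ⌊t * ((N : ℝ) + 1)⌋ := Int.floor_nonneg.2 (by positivity)
  have f4 : t * ((N : ℝ) + 1) ≤ N + 1 := by
    have := mul_le_mul_of_nonneg_right h1 (by positivity : (0 : ℝ) ≤ N + 1); linarith
  have f5 : ⌊t * ((N : ℝ) + 1)⌋ ≤ N + 1 := by
    have : ((⌊t * ((N : ℝ) + 1)⌋ : ℤ) : ℝ) ≤ ((N + 1 : ℤ) : ℝ) := by push_cast; linarith
    exact_mod_cast this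
  -- Clamping to `1, …, N` changes the floor only at the two ends, where it moves the index by one;
  -- the error still does not exceed one mesh step.
  have cases3 : nearIdx N t = ⌊t * ((N : ℝ) + 1)⌋ ∨
      (⌊t * ((N : ℝ) + 1)⌋ = 0 ∧ nearIdx N t = 1) ∨
      (⌊t * ((N : ℝ) + 1)⌋ = N + 1 ∧ nearIdx N t = N) := by
    unfold nearIdx; omega
  rw [abs_le]
  rcases cases3 with h | ⟨h, h'⟩ | ⟨h, h'⟩
  · rw [h]; constructor <;> linarith
  · rw [h] at f1 f2; rw [h']; push_cast at *; constructor <;> linarith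
  · rw [h] at f1 f2; rw [h']; push_cast at *; constructor <;> linarith

open Filter Topology in
lemma tendsto_nearIdx {t : ℝ} (h0 : 0 ≤ t) (h1 : t ≤ 1) :
    Tendsto (fun N => meshSize N * nearIdx N t) atTop (𝓝 t) := by
  rw [tendsto_iff_norm_sub_tendsto_zero]
  refine squeeze_zero' (Eventually.of_forall fun _ => norm_nonneg _) ?_ tendsto_meshSize
  filter_upwards [eventually_ge_atTop 1] with N hN
  exact abs_nearIdx_sub hN h0 h1

open Filter Topology in
lemma tendsto_mesh_approx {p : Pt d} (hp : p ∈ ccube d) (j : Fin d) :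
    Tendsto (fun N => toPt (meshSize N) (fun i => nearIdx N (p i)) + (meshSize N / 2) • uv j)
      atTop (𝓝 p) := by
  have h1 : Tendsto (fun N => toPt (meshSize N) (fun i => nearIdx N (p i))) atTop (𝓝 p) := by
    have h2 : Tendsto (fun N => (fun i => meshSize N * (nearIdx N (p i) : ℝ))) atTop
        (𝓝 fun i => p i) := tendsto_pi_nhds.2 fun i => tendsto_nearIdx (hp i).1 (hp i).2
    exact ((PiLp.continuous_toLp 2 fun _ : Fin d => ℝ).tendsto _).comp h2
  have h3 : Tendsto (fun N => (meshSize N / 2) • uv j) atTop (𝓝 ((0 / 2 : ℝ) • uv j)) :=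
    (tendsto_meshSize.div_const 2).smul_const _
  simpa using h1.add h3

open Filter Topology in
/-- The mesh assumption makes the coefficients Lipschitz along coordinate lines of the cube. -/
lemma lipschitz_of_meshAssumption {σ : Fin d → Pt d → ℝ}
    (hσ : ∀ᶠ N in atTop, epsDiff σ N < 1) (k j : Fin d)
    (hc : ∀ p ∈ ccube d, ContinuousAt (σ k) p) {p q : Pt d} (hp : p ∈ ccube d) (hq : q ∈ ccube d)
    (hpq : ∀ i, i ≠ j → p i = q i) : |σ k p - σ k q| ≤ |p j - q j| := by
  wlog hle : p j ≤ q j generalizing p q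
  · rw [abs_sub_comm, abs_sub_comm (p j)]
    exact this hq hp (fun i hi => (hpq i hi).symm) (not_le.1 hle).le
  -- Both points are approximated by mesh midpoints on a common line in direction `j`. Along that
  -- line the discrete bound holds for every fine mesh, and continuity passes it to the limit.
  have t1 := ((hc p hp).tendsto.comp (tendsto_mesh_approx hp j)).sub
    ((hc q hq).tendsto.comp (tendsto_mesh_approx hq j))
  have t2 := ((tendsto_nearIdx (hp j).1 (hp j).2).sub (tendsto_nearIdx (hq j).1 (hq j).2)).abs
  refine le_of_tendsto_of_tendsto t1.abs t2 ?_
  filter_upwards [hσ, eventually_ge_atTop 1] with N hN hN1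
  have hbp := nearIdx_bounds hN1 (p j)
  have hbq := nearIdx_bounds hN1 (q j)
  have hmono : nearIdx N (p j) ≤ nearIdx N (q j) := by
    unfold nearIdx
    have : ⌊p j * ((N : ℝ) + 1)⌋ ≤ ⌊q j * ((N : ℝ) + 1)⌋ :=
      Int.floor_le_floor (mul_le_mul_of_nonneg_right hle (by positivity))
    omega
  have key := mesh_line_lipschitz hN k j (fun i => nearIdx N (p i))
    (fun i => nearIdx_bounds hN1 _) (nearIdx N (p j)).toNat
    (nearIdx N (q j) - nearIdx N (p j)).toNat (by omega)
  have e1 : (((nearIdx N (p j)).toNat + (nearIdx N (q j) - nearIdx N (p j)).toNat : ℕ) : ℤ)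
      = nearIdx N (q j) := by omega
  have e2 : (((nearIdx N (p j)).toNat : ℕ) : ℤ) = nearIdx N (p j) := by omega
  have e3 : Function.update (fun i => nearIdx N (p i)) j (nearIdx N (q j))
      = fun i => nearIdx N (q i) := by
    ext i
    rcases eq_or_ne i j with rfl | hi
    · simp
    · simp [hi, hpq i hi]
  have e4 : (((nearIdx N (q j) - nearIdx N (p j)).toNat : ℕ) : ℝ)
      = nearIdx N (q j) - nearIdx N (p j) := by
    have : (((nearIdx N (q j) - nearIdx N (p j)).toNat : ℤ) : ℝ)
        = ((nearIdx N (q j) - nearIdx N (p j) : ℤ) : ℝ) := by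
      rw [Int.toNat_of_nonneg (by omega)]
    push_cast at this
    exact_mod_cast this
  rw [e1, e2, e3, Function.update_eq_self, e4] at key
  rw [abs_sub_comm] at key
  refine key.trans ?_
  rw [abs_sub_comm, ← mul_sub]
  exact le_abs_self _

/-! ### Extension of the coefficients and of the phase to the whole space. -/

/-- Projection onto the closed cube. -/
def clamp (y : Pt d) : Pt d := WithLp.toLp 2 fun i => max 0 (min 1 (y i))

lemma clamp_mem (y : Pt d) : clamp y ∈ ccube d := fun _ =>
  ⟨le_max_left _ _, max_le zero_le_one (min_le_left _ _)⟩

lemma clamp_of_mem {y : Pt d} (hy : y ∈ ccube d) : clamp y = y := by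
  ext i
  have := hy i
  change max 0 (min 1 (y i)) = y i
  rw [min_eq_right this.2, max_eq_right this.1]

lemma isCompact_ccube (d : ℕ) : IsCompact (ccube d) := by
  have h1 : IsCompact (Set.Icc (0 : Fin d → ℝ) 1) := isCompact_Icc
  have h2 := h1.image (PiLp.continuous_toLp 2 fun _ : Fin d => ℝ)
  convert h2 using 1
  ext x
  constructor
  · intro hx
    exact ⟨fun i => x i, ⟨fun i => (hx i).1, fun i => (hx i).2⟩, rfl⟩
  · rintro ⟨y, hy, rfl⟩ i
    exact ⟨hy.1 i, hy.2 i⟩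

lemma ccube_nonempty (d : ℕ) : (ccube d).Nonempty := ⟨0, fun _ => by simp⟩

lemma ccube_subset_closure (d : ℕ) : ccube d ⊆ closure (cube d) := by
  intro p hp
  set c : Pt d := WithLp.toLp 2 fun _ => 1 / 2
  have h1 : Filter.Tendsto (fun n : ℕ => p + meshSize n • (c - p)) Filter.atTop (nhds p) := by
    have := (tendsto_const_nhds (x := p)).add (tendsto_meshSize.smul_const (c - p))
    simpa using this
  refine mem_closure_of_tendsto h1 (Filter.Eventually.of_forall fun n i => ?_)
  have e : (p + meshSize n • (c - p)) i = p i + meshSize n * (1 / 2 - p i) := rfl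
  rw [e]
  have h2 := meshSize_pos n
  have h3 := meshSize_le_one n
  have h4 := hp i
  constructor <;> nlinarith

lemma abs_clamp_sub (l : Fin d) (y : Pt d) {t : ℝ} (ht : 0 ≤ t) :
    |clamp (y + t • uv l) l - clamp y l| ≤ t := by
  change |max 0 (min 1 ((y + t • uv l) l)) - max 0 (min 1 (y l))| ≤ t
  have e : (y + t • uv l) l = y l + t := by simp
  rw [e]
  rw [max_comm 0, max_comm 0]
  refine (abs_max_sub_max_le_abs _ _ _).trans ?_
  rw [abs_le]
  rcases le_total 1 (y l + t) with h | h <;> rcases le_total 1 (y l) with h' | h' <;>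
    simp only [min_eq_left, min_eq_right, h, h'] <;> constructor <;> linarith

section Smooth

open scoped ContDiff

lemma contDiff_fderiv_apply {f : Pt d → ℝ} (hf : ContDiff ℝ ∞ f) (e : Pt d) :
    ContDiff ℝ ∞ fun y => fderiv ℝ f y e :=
  (hf.fderiv_right (m := ∞) (by simp)).clm_apply contDiff_const

lemma hasCompactSupport_fderiv_apply {f : Pt d → ℝ} (hf : HasCompactSupport f) (e : Pt d) :
    HasCompactSupport fun y => fderiv ℝ f y e :=
  (hf.fderiv ℝ).comp_left (g := fun L : Pt d →L[ℝ] ℝ => L e) rfl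

lemma hasDerivAt_line {f : Pt d → ℝ} (hf : ContDiff ℝ ∞ f) (e y : Pt d) (t : ℝ) :
    HasDerivAt (fun t : ℝ => f (y + t • e)) (fderiv ℝ f (y + t • e) e) t := by
  have h1 : HasDerivAt (fun t : ℝ => y + t • e) e t := by
    simpa using ((hasDerivAt_id t).smul_const e).const_add y
  exact ((hf.differentiable (by simp)).differentiableAt.hasFDerivAt).comp_hasDerivAt t h1

/-- A smooth compactly supported extension of a smooth function from a neighbourhood of the cube. -/
lemma exists_extension {U : Set (Pt d)} (hU : IsOpen U) (hc : ccube d ⊆ U) {ψ : Pt d → ℝ}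
    (hψ : ContDiffOn ℝ ∞ ψ U) (hpos : ∀ x ∈ U, 0 < ψ x) :
    ∃ β : Pt d → ℝ, ContDiff ℝ ∞ β ∧ HasCompactSupport β ∧ (∀ y, β y ≤ 0) ∧
      ∀ y ∈ ccube d, β =ᶠ[nhds y] fun x => -ψ x := by
  obtain ⟨K, hK, hcK, hKU⟩ := exists_compact_between (isCompact_ccube d) hU hc
  obtain ⟨χ, h0, h1, hχ⟩ := exists_contMDiffMap_zero_one_nhds_of_isClosed (n := ⊤)
    (modelWithCornersSelf ℝ (Pt d)) (isOpen_interior (s := K)).isClosed_compl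
    (isCompact_ccube d).isClosed (Set.disjoint_compl_left_iff_subset.2 hcK)
  have hχs : ContDiff ℝ ∞ χ := contMDiff_iff_contDiff.1 χ.contMDiff
  have hzero : ∀ x, x ∉ interior K → χ =ᶠ[nhds x] 0 := fun x hx =>
    (Filter.eventually_iff.1 h0 |> fun h => mem_nhdsSet_iff_forall.1 h x hx)
  refine ⟨fun x => -(χ x * ψ x), ?_, ?_, ?_, ?_⟩
  · rw [contDiff_iff_contDiffAt]
    intro x
    by_cases hx : x ∈ interior K
    · exact (hχs.contDiffAt.mul (hψ.contDiffAt (hU.mem_nhds (hKU (interior_subset hx))))).neg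
    · have : (fun x => -(χ x * ψ x)) =ᶠ[nhds x] fun _ => 0 := by
        filter_upwards [hzero x hx] with y hy
        simp [hy]
      exact contDiffAt_const.congr_of_eventuallyEq this
  · refine HasCompactSupport.intro hK fun x hx => ?_
    have := (hzero x fun h => hx (interior_subset h)).self_of_nhds
    simp [this]
  · intro y
    by_cases hy : y ∈ interior K
    · have := mul_nonneg (hχ y).1 (hpos y (hKU (interior_subset hy))).le
      linarith
    · have := (hzero y hy).self_of_nhds
      simp [this]
  · intro y hy
    have := mem_nhdsSet_iff_forall.1 h1 y hy
    filter_upwards [this] with x hx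
    rw [show χ x = 1 from hx, one_mul]

lemma exists_common_bound {ι : Type*} [Fintype ι] {F : ι → Pt d → ℝ} {r : ι → Pt d → ℝ}
    (h : ∀ i, ∃ C : ℝ, 0 ≤ C ∧ ∀ y, |F i y| ≤ C * r i y) (hr : ∀ i y, 0 ≤ r i y) :
    ∃ C : ℝ, 0 ≤ C ∧ ∀ i y, |F i y| ≤ C * r i y := by
  choose C hC hF using h
  exact ⟨∑ i, C i, Finset.sum_nonneg fun i _ => hC i, fun i y => (hF i y).trans
    (mul_le_mul_of_nonneg_right (Finset.single_le_sum (f := C) (fun i _ => hC i)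
      (Finset.mem_univ i)) (hr i y))⟩

lemma exists_bound_of_compactSupport {f : Pt d → ℝ} (hf : Continuous f)
    (hc : HasCompactSupport f) : ∃ C : ℝ, 0 ≤ C ∧ ∀ y, |f y| ≤ C * 1 := by
  obtain ⟨C, hC⟩ := hc.exists_bound_of_continuous hf
  exact ⟨|C|, abs_nonneg _, fun y => by simpa using (hC y).trans (le_abs_self C)⟩

/-- Composing the coefficients with `clamp` keeps their bounds and their Lipschitz constants along
coordinate lines. The phase is cut off smoothly, so all its derivatives are bounded. Positive lower
bounds for the coefficients and for the gradient of the phase come from compactness of the cube. -/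
theorem exists_phase {U : Set (Pt d)} (hU : IsOpen U) (hcube : closure (cube d) ⊆ U)
    {σ : Fin d → Pt d → ℝ} (hσcont : ∀ k, ContinuousOn (σ k) U)
    (hσpos : ∀ k, ∀ x ∈ U, 0 < σ k x) (hσ : ∀ᶠ N in Filter.atTop, epsDiff σ N < 1)
    {ψ : Pt d → ℝ} (hψ : ContDiffOn ℝ ∞ ψ U) (hψgrad : ∀ x ∈ U, 0 < ‖gradient ψ x‖)
    (hψpos : ∀ x ∈ U, 0 < ψ x) :
    ∃ (P : Phase d) (a₀ g₀ : ℝ), P.Nondegenerate a₀ g₀ ∧ (∀ y, P.β y ≤ 0) ∧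
      (∀ y ∈ ccube d, P.β y = -ψ y) ∧ ∀ k, ∀ y ∈ ccube d, P.σ k y = σ k y := by
  have hc : ccube d ⊆ U := (ccube_subset_closure d).trans hcube
  obtain ⟨β, hβs, hβc, hβ0, hβψ⟩ := exists_extension hU hc hψ hψpos
  set b : Fin d → Pt d → ℝ := fun k y => fderiv ℝ β y (uv k) with hb
  have hbs : ∀ k, ContDiff ℝ ∞ (b k) := fun k => contDiff_fderiv_apply hβs _
  have hbc : ∀ k, HasCompactSupport (b k) := fun k => hasCompactSupport_fderiv_apply hβc _
  set bb : Fin d → Fin d → Pt d → ℝ := fun j k y => fderiv ℝ (b k) y (uv j) with hbb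
  have hbbs : ∀ j k, ContDiff ℝ ∞ (bb j k) := fun j k => contDiff_fderiv_apply (hbs k) _
  have hbbc : ∀ j k, HasCompactSupport (bb j k) := fun j k =>
    hasCompactSupport_fderiv_apply (hbc k) _
  obtain ⟨C1, c1, H1⟩ := exists_bound_of_compactSupport hβs.continuous hβc
  obtain ⟨C2, c2, H2⟩ := exists_common_bound (F := b) (r := fun _ _ => 1)
    (fun k => exists_bound_of_compactSupport (hbs k).continuous (hbc k)) (fun _ _ => zero_le_one)
  obtain ⟨C3, c3, H3⟩ := exists_common_bound (F := fun l : Fin d × Fin d => bb l.1 l.2)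
    (r := fun _ _ => 1) (fun l => exists_bound_of_compactSupport (hbbs l.1 l.2).continuous
      (hbbc l.1 l.2)) (fun _ _ => zero_le_one)
  have hlip : ∃ C4 : ℝ, 0 ≤ C4 ∧ ∀ j k l y (t : ℝ), 0 ≤ t →
      |bb j k (y + t • uv l) - bb j k y| ≤ C4 * t := by
    choose L hL using fun l : Fin d × Fin d =>
      (hbbs l.1 l.2).lipschitzWith_of_hasCompactSupport (hbbc l.1 l.2) (by simp)
    refine ⟨∑ l, (L l : ℝ), Finset.sum_nonneg fun l _ => (L l).2, fun j k l y t ht => ?_⟩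
    have h1 := (hL (j, k)).dist_le_mul (y + t • uv l) y
    rw [Real.dist_eq, dist_eq_norm, add_sub_cancel_left, norm_smul, Real.norm_eq_abs,
      abs_of_nonneg ht, PiLp.norm_single, norm_one, mul_one] at h1
    refine h1.trans (mul_le_mul_of_nonneg_right ?_ ht)
    exact Finset.single_le_sum (f := fun l => (L l : ℝ)) (fun l _ => (L l).2)
      (Finset.mem_univ (j, k))
  obtain ⟨C4, c4, H4⟩ := hlip
  have hσbd : ∀ k, ∃ C : ℝ, 0 ≤ C ∧ ∀ y, |σ k (clamp y)| ≤ C * 1 := fun k => by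
    obtain ⟨C, hC⟩ := (isCompact_ccube d).exists_bound_of_continuousOn ((hσcont k).mono hc)
    exact ⟨|C|, abs_nonneg _, fun y => by
      simpa using (hC _ (clamp_mem y)).trans (le_abs_self C)⟩
  obtain ⟨C5, c5, H5⟩ := exists_common_bound (F := fun k y => σ k (clamp y)) (r := fun _ _ => 1)
    hσbd (fun _ _ => zero_le_one)
  simp only [mul_one] at H1 H2 H3 H5
  have hσlip : ∀ k l y (t : ℝ), 0 ≤ t →
      |σ k (clamp (y + t • uv l)) - σ k (clamp y)| ≤ 1 * t := by
    intro k l y t ht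
    refine (lipschitz_of_meshAssumption hσ k l (fun p hp => (hσcont k).continuousAt
      (hU.mem_nhds (hc hp))) (clamp_mem _) (clamp_mem _) fun i hi => ?_).trans
      ((abs_clamp_sub l y ht).trans (one_mul t).ge)
    change max 0 (min 1 ((y + t • uv l) i)) = max 0 (min 1 (y i))
    have : (y + t • uv l) i = y i := by simp [hi]
    rw [this]
  have hamin : ∃ a₀ : ℝ, 0 < a₀ ∧ ∀ k y, a₀ ≤ σ k (clamp y) := by
    have : ∀ k, ∃ a : ℝ, 0 < a ∧ ∀ y ∈ ccube d, a ≤ σ k y := fun k => by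
      obtain ⟨x, hx, hmin⟩ := (isCompact_ccube d).exists_isMinOn (ccube_nonempty d)
        ((hσcont k).mono hc)
      exact ⟨σ k x, hσpos k x (hc hx), fun y hy => hmin hy⟩
    choose a ha hay using this
    rcases isEmpty_or_nonempty (Fin d) with he | he
    · exact ⟨1, one_pos, fun k => (he.false k).elim⟩
    · refine ⟨Finset.univ.inf' Finset.univ_nonempty a, ?_, fun k y =>
        (Finset.inf'_le a (Finset.mem_univ k)).trans (hay k _ (clamp_mem y))⟩
      rw [Finset.lt_inf'_iff]
      exact fun k _ => ha k
  obtain ⟨a₀, ha₀, ha⟩ := hamin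
  have hgpos : ∀ y ∈ ccube d, 0 < ∑ k, b k y ^ 2 := by
    intro y hy
    refine lt_of_le_of_ne (Finset.sum_nonneg fun k _ => sq_nonneg _) fun h0 => ?_
    have hz : ∀ k, fderiv ℝ β y (uv k) = 0 := fun k => by
      have := (Finset.sum_eq_zero_iff_of_nonneg fun k _ => sq_nonneg (b k y)).1 h0.symm k
        (Finset.mem_univ k)
      exact pow_eq_zero_iff two_ne_zero |>.1 this
    have hf : fderiv ℝ β y = 0 := by
      apply ContinuousLinearMap.coe_injective
      refine (EuclideanSpace.basisFun (Fin d) ℝ).toBasis.ext fun k => ?_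
      simpa using hz k
    -- The extension agrees with `-ψ` on a neighbourhood of each point of the closed cube, so the
    -- derivatives agree on its boundary as well.
    have hψ0 : fderiv ℝ ψ y = 0 := by
      have h1 := (hβψ y hy).fderiv_eq (𝕜 := ℝ)
      rw [hf] at h1
      have h2 : fderiv ℝ (fun x => -ψ x) y = -fderiv ℝ ψ y := fderiv_fun_neg
      rw [h2] at h1
      simpa using h1.symm
    have := hψgrad y (hc hy)
    rw [gradient, hψ0, map_zero, norm_zero] at this
    exact lt_irrefl _ this
  obtain ⟨x, hx, hmin⟩ := (isCompact_ccube d).exists_isMinOn (ccube_nonempty d)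
    (f := fun y => ∑ k, b k y ^ 2)
    (continuous_finsetSum _ fun k _ => (hbs k).continuous.pow 2).continuousOn
  set C := C1 + C2 + C3 + C4 + C5 + 1 with hC
  refine ⟨{ β := β, b := b, bb := bb, σ := fun k y => σ k (clamp y), bound := C
            hasDeriv := fun k y t => hasDerivAt_line hβs _ y t
            hasDeriv_b := fun j k y t => hasDerivAt_line (hbs k) _ y t
            β_le := fun y => (H1 y).trans (by linarith)
            b_le := fun k y => (H2 k y).trans (by linarith)
            bb_le := fun j k y => (H3 (j, k) y).trans (by linarith)
            σ_le := fun k y => (H5 k y).trans (by linarith)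
            bb_lip := fun j k l y t ht => (H4 j k l y t ht).trans
              (mul_le_mul_of_nonneg_right (by linarith) ht)
            σ_lip := fun k l y t ht => (hσlip k l y t ht).trans
              (mul_le_mul_of_nonneg_right (by linarith) ht) },
    a₀, ∑ k, b k x ^ 2, ⟨ha₀, hgpos x hx, ha, fun y hy => hmin hy⟩, hβ0,
    fun y hy => (hβψ y hy).self_of_nhds, fun k y hy => ?_⟩
  change σ k (clamp y) = σ k y
  rw [clamp_of_mem hy]

end Smooth

/-! ### Dual meshes, directional boundaries and normals in lattice coordinates. -/

section Mesh

variable {h : ℝ} {N : ℕ}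

lemma toPt_injective (hh : h ≠ 0) : Function.Injective (toPt (d := d) h) := by
  intro x y hxy
  ext i
  have := congrArg (fun p : Pt d => p i) hxy
  simp only [toPt_apply] at this
  exact_mod_cast mul_left_cancel₀ hh this

/-- The midpoint of the edge in direction `k` issued from `x`. -/
def mid (h : ℝ) (k : Fin d) (x : Lat d) : Pt d := toPt h x + (h / 2) • uv k

lemma mid_injective (hh : h ≠ 0) (k : Fin d) : Function.Injective (mid h k) := fun _ _ hxy =>
  toPt_injective hh (add_right_cancel hxy)

lemma shiftPos_toPt (k : Fin d) (x : Lat d) : shiftPos h k (toPt h x) = mid h k x := rfl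

lemma shiftNeg_toPt (k : Fin d) (x : Lat d) : shiftNeg h k (toPt h x) = mid h k (x - ev k) := by
  unfold shiftNeg mid
  rw [toPt_sub_ev]
  module

lemma shiftNeg_mid (k : Fin d) (x : Lat d) : shiftNeg h k (mid h k x) = toPt h x := by
  simp [shiftNeg, mid]

lemma shiftPos_mid (k : Fin d) (x : Lat d) : shiftPos h k (mid h k x) = toPt h (x + ev k) := by
  unfold shiftPos mid
  rw [toPt_add_ev]
  module

lemma mem_dualMesh_inner (k : Fin d) {y : Pt d} :
    y ∈ dualMesh (meshSize N) k (innerMesh d N) ↔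
      ∃ x, (x ∈ box d N ∨ x + ev k ∈ box d N) ∧ mid (meshSize N) k x = y := by
  rw [innerMesh_eq, dualMesh, Set.image_image, Set.image_image]
  constructor
  · rintro (⟨x, hx, rfl⟩ | ⟨x, hx, rfl⟩)
    · exact ⟨x, Or.inl hx, rfl⟩
    · exact ⟨x - ev k, Or.inr (by simpa using hx), (shiftNeg_toPt k x).symm⟩
  · rintro ⟨x, hx | hx, rfl⟩
    · exact Or.inl ⟨x, hx, rfl⟩
    · exact Or.inr ⟨x + ev k, hx, (shiftNeg_toPt k (x + ev k)).trans (by rw [add_sub_cancel_right])⟩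

lemma mid_mem_dualMesh (k : Fin d) {x : Lat d} :
    mid (meshSize N) k x ∈ dualMesh (meshSize N) k (innerMesh d N) ↔
      x ∈ box d N ∨ x + ev k ∈ box d N := by
  rw [mem_dualMesh_inner]
  constructor
  · rintro ⟨y, hy, hxy⟩
    rwa [← mid_injective (meshSize_pos N).ne' k hxy]
  · exact fun hx => ⟨x, hx, rfl⟩

lemma toPt_mem_inner {x : Lat d} : toPt (meshSize N) x ∈ innerMesh d N ↔ x ∈ box d N := by
  rw [innerMesh_eq]
  constructor
  · rintro ⟨y, hy, hxy⟩
    rwa [← toPt_injective (meshSize_pos N).ne' hxy]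
  · exact fun hx => ⟨x, hx, rfl⟩

lemma mem_dirBoundary_inner (k : Fin d) {y : Pt d} :
    y ∈ dirBoundary (meshSize N) k (innerMesh d N) ↔
      ∃ x, (x ∉ box d N ∧ (x + ev k ∈ box d N ∨ x - ev k ∈ box d N)) ∧
        toPt (meshSize N) x = y := by
  constructor
  · rintro ⟨hy, hyn⟩
    have : ∃ x, (x ∈ box d N ∨ x + ev k ∈ box d N ∨ x - ev k ∈ box d N) ∧
        toPt (meshSize N) x = y := by
      rcases hy with ⟨z, hz, rfl⟩ | ⟨z, hz, rfl⟩
      · obtain ⟨x, hx, rfl⟩ := (mem_dualMesh_inner k).1 hz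
        refine ⟨x + ev k, ?_, (shiftPos_mid k x).symm⟩
        rw [add_sub_cancel_right]
        tauto
      · obtain ⟨x, hx, rfl⟩ := (mem_dualMesh_inner k).1 hz
        exact ⟨x, by tauto, (shiftNeg_mid k x).symm⟩
    obtain ⟨x, hx, rfl⟩ := this
    rw [toPt_mem_inner] at hyn
    exact ⟨x, ⟨hyn, by tauto⟩, rfl⟩
  · rintro ⟨x, ⟨hx, hx'⟩, rfl⟩
    refine ⟨?_, by rwa [toPt_mem_inner]⟩
    rcases hx' with hx' | hx'
    · exact Or.inr ⟨mid _ k x, (mid_mem_dualMesh k).2 (Or.inr hx'), shiftNeg_mid k x⟩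
    · refine Or.inl ⟨mid _ k (x - ev k), (mid_mem_dualMesh k).2 (Or.inl hx'), ?_⟩
      rw [shiftPos_mid, sub_add_cancel]

lemma toPt_mem_dirBoundary (k : Fin d) {x : Lat d} :
    toPt (meshSize N) x ∈ dirBoundary (meshSize N) k (innerMesh d N) ↔
      x ∉ box d N ∧ (x + ev k ∈ box d N ∨ x - ev k ∈ box d N) := by
  rw [mem_dirBoundary_inner]
  constructor
  · rintro ⟨y, hy, hxy⟩
    rwa [← toPt_injective (meshSize_pos N).ne' hxy]
  · exact fun hx => ⟨x, hx, rfl⟩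

lemma mid_mem_ccube (k : Fin d) {x : Lat d} (hx : x ∈ box d N ∨ x + ev k ∈ box d N) :
    mid (meshSize N) k x ∈ ccube d := by
  have h1 : toPt (meshSize N) x ∈ ccube d := by
    refine inCube_box N x ?_
    rcases hx with hx | hx
    · exact Or.inl hx
    · exact Or.inr ⟨k, hx⟩
  have h2 : toPt (meshSize N) (x + ev k) ∈ ccube d := by
    refine toPt_mem_ccube fun i => ?_
    have h3 := ev_bounds k i
    rcases hx with hx | hx
    · have := mem_box.1 hx i
      simp only [Pi.add_apply]; omega
    · have := mem_box.1 hx i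
      omega
  intro i
  have e : mid (meshSize N) k x i
      = (toPt (meshSize N) x i + toPt (meshSize N) (x + ev k) i) / 2 := by
    rw [toPt_add_ev]
    simp only [mid, PiLp.add_apply, PiLp.smul_apply, smul_eq_mul]
    ring
  rw [e]
  have := h1 i
  have := h2 i
  constructor <;> linarith

/-- The lattice function of a mesh function vanishing on the boundary. -/
def latFun (N : ℕ) (u : Pt d → ℝ) (x : Lat d) : ℝ :=
  open Classical in if x ∈ box d N then u (toPt (meshSize N) x) else 0

lemma latFun_of_notMem (u : Pt d → ℝ) {x : Lat d} (hx : x ∉ box d N) : latFun N u x = 0 := by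
  simp [latFun, hx]

lemma latFun_of_mem (u : Pt d → ℝ) {x : Lat d} (hx : x ∈ box d N) :
    latFun N u x = u (toPt (meshSize N) x) := by
  simp [latFun, hx]

/-- A grid point without interior index lies in the closed cube but not in its interior, hence on
`∂Ω_h`, where the Dirichlet condition matches the extension by zero. -/
lemma latFun_eq {u : Pt d → ℝ} (hu : ∀ x ∈ boundaryMesh d N, u x = 0) {x : Lat d}
    (hx : ∀ i, 0 ≤ x i ∧ x i ≤ N + 1) : u (toPt (meshSize N) x) = latFun N u x := by
  by_cases hxD : x ∈ box d N
  · rw [latFun_of_mem u hxD]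
  rw [latFun_of_notMem u hxD]
  have hg : toPt (meshSize N) x ∈ grid d N := by
    refine ⟨fun i => (x i).toNat, fun i => ?_, fun i => ?_⟩
    · have := hx i
      change (x i).toNat ≤ N + 1
      omega
    · rw [toPt_apply]
      congr 1
      have e : (((x i).toNat : ℤ) : ℝ) = (x i : ℝ) := by
        rw [Int.toNat_of_nonneg (hx i).1]
      exact_mod_cast e.symm
  refine hu _ ⟨⟨ccube_subset_closure d (toPt_mem_ccube hx), fun hi => hxD ?_⟩, hg⟩
  exact toPt_mem_inner.1 ⟨interior_subset hi, hg⟩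

lemma edge_bounds (k : Fin d) {x : Lat d} (hx : x ∈ box d N ∨ x + ev k ∈ box d N) :
    (∀ i, 0 ≤ x i ∧ x i ≤ N + 1) ∧ ∀ i, 0 ≤ (x + ev k) i ∧ (x + ev k) i ≤ N + 1 := by
  constructor <;> intro i <;> have h3 := ev_bounds k i <;> rcases hx with hx | hx <;>
    have h4 := mem_box.1 hx i <;> (try simp only [Pi.add_apply] at h4 ⊢) <;> omega

lemma diffOp_mid {u : Pt d → ℝ} (hu : ∀ x ∈ boundaryMesh d N, u x = 0) (k : Fin d) {x : Lat d}
    (hx : x ∈ box d N ∨ x + ev k ∈ box d N) :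
    diffOp (meshSize N) k u (mid (meshSize N) k x) = fd (meshSize N) k (latFun N u) x := by
  rw [diffOp, shiftPos_mid, shiftNeg_mid, latFun_eq hu (edge_bounds k hx).1,
    latFun_eq hu (edge_bounds k hx).2, fd]

lemma fd_latFun_eq_zero (u : Pt d → ℝ) (k : Fin d) {x : Lat d}
    (hx : ¬(x ∈ box d N ∨ x + ev k ∈ box d N)) : fd h k (latFun N u) x = 0 := by
  push Not at hx
  simp [fd, latFun_of_notMem u hx.1, latFun_of_notMem u hx.2]

/-- A step in direction `k` changes only coordinate `k`. If it leads into the box, the other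
coordinates are already admissible, so coordinate `k` is the one at fault. Hence the directional
boundaries are disjoint and contain no corners or edges of the cube. -/
lemma coord_notMem {x : Lat d} {k : Fin d} (hx : x ∉ box d N)
    (hx' : x + ev k ∈ box d N ∨ x - ev k ∈ box d N) : ¬(1 ≤ x k ∧ x k ≤ N) := by
  intro hk
  refine hx (mem_box.2 fun i => ?_)
  rcases eq_or_ne i k with rfl | hi
  · exact hk
  · have e : ev k i = 0 := by simp [ev, hi]
    rcases hx' with hx' | hx' <;> have := mem_box.1 hx' i <;>
      simp only [Pi.add_apply, Pi.sub_apply, e] at this <;> omega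

lemma not_both {x : Lat d} {k : Fin d} (hx : x ∉ box d N) (h1 : x + ev k ∈ box d N) :
    x - ev k ∉ box d N := by
  intro h2
  have h3 := coord_notMem hx (Or.inl h1)
  have h4 := mem_box.1 h1 k
  have h5 := mem_box.1 h2 k
  simp only [Pi.add_apply, Pi.sub_apply, ev, Pi.single_eq_same] at h4 h5
  omega

lemma notMem_dirBoundary {x : Lat d} {j k : Fin d} (hx : x ∉ box d N)
    (hx' : x + ev k ∈ box d N ∨ x - ev k ∈ box d N) (hjk : j ≠ k) :
    toPt (meshSize N) x ∉ dirBoundary (meshSize N) j (innerMesh d N) := by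
  rw [toPt_mem_dirBoundary]
  rintro ⟨-, hj⟩
  refine coord_notMem hx hx' ?_
  have e : ev j k = 0 := by simp [ev, hjk.symm]
  rcases hj with hj | hj <;> have := mem_box.1 hj k <;>
    simp only [Pi.add_apply, Pi.sub_apply, e] at this <;> omega

lemma normal_low {x : Lat d} {k : Fin d} (hx : x ∉ box d N) (h1 : x + ev k ∈ box d N) :
    normal (meshSize N) k (innerMesh d N) (toPt (meshSize N) x) = -1 := by
  have h2 := not_both hx h1
  have e1 : shiftNeg (meshSize N) k (toPt (meshSize N) x)
      ∉ dualMesh (meshSize N) k (innerMesh d N) := by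
    rw [shiftNeg_toPt, mid_mem_dualMesh, sub_add_cancel]; tauto
  have e2 : shiftPos (meshSize N) k (toPt (meshSize N) x)
      ∈ dualMesh (meshSize N) k (innerMesh d N) := by
    rw [shiftPos_toPt, mid_mem_dualMesh]; tauto
  have e3 : toPt (meshSize N) x ∈ dirBoundary (meshSize N) k (innerMesh d N) :=
    (toPt_mem_dirBoundary k).2 ⟨hx, Or.inl h1⟩
  simp [normal, e1, e2, e3]

lemma normal_high {x : Lat d} {k : Fin d} (hx : x ∉ box d N) (h1 : x - ev k ∈ box d N) :
    normal (meshSize N) k (innerMesh d N) (toPt (meshSize N) x) = 1 := by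
  have h2 : x + ev k ∉ box d N := fun h => not_both hx h h1
  have e1 : shiftNeg (meshSize N) k (toPt (meshSize N) x)
      ∈ dualMesh (meshSize N) k (innerMesh d N) := by
    rw [shiftNeg_toPt, mid_mem_dualMesh, sub_add_cancel]; tauto
  have e2 : shiftPos (meshSize N) k (toPt (meshSize N) x)
      ∉ dualMesh (meshSize N) k (innerMesh d N) := by
    rw [shiftPos_toPt, mid_mem_dualMesh]; tauto
  have e3 : toPt (meshSize N) x ∈ dirBoundary (meshSize N) k (innerMesh d N) :=
    (toPt_mem_dirBoundary k).2 ⟨hx, Or.inr h1⟩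
  simp [normal, e1, e2, e3]

lemma normal_eq_zero {y : Pt d} {j : Fin d}
    (hy : y ∉ dirBoundary h j (innerMesh d N)) : normal h j (innerMesh d N) y = 0 := by
  simp [normal, hy]

/-- The directional boundaries being disjoint, at a point of `∂_k` the normals in all other
directions vanish. -/
lemma normalDeriv_eq (σ : Fin d → Pt d → ℝ) (u : Pt d → ℝ) {x : Lat d} {k : Fin d}
    (hx : x ∉ box d N) (hx' : x + ev k ∈ box d N ∨ x - ev k ∈ box d N) :
    normalDeriv (meshSize N) σ (innerMesh d N) u (toPt (meshSize N) x)
      = traceOp (meshSize N) k (innerMesh d N) (fun y => σ k y * diffOp (meshSize N) k u y)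
        (toPt (meshSize N) x) * normal (meshSize N) k (innerMesh d N) (toPt (meshSize N) x) := by
  unfold normalDeriv
  refine Finset.sum_eq_single k (fun j _ hj => ?_) (fun hk => absurd (Finset.mem_univ k) hk)
  rw [normal_eq_zero (notMem_dirBoundary hx hx' hj), mul_zero]

end Mesh

/-! ### Mesh integrals rewritten as lattice sums. -/

section Transfer

variable (P : Phase d) {σ : Fin d → Pt d → ℝ} {ψ : Pt d → ℝ} {N : ℕ} {u q : Pt d → ℝ} {lam s : ℝ}

lemma phi_eq (hβ : ∀ y ∈ ccube d, P.β y = -ψ y) (h : ℝ) {y : Pt d} (hy : y ∈ ccube d) :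
    phi lam ψ y = P.ph ⟨lam, h, s, y⟩ := by
  simp only [phi, Phase.ph, hβ y hy]
  congr 1
  ring

lemma finsum_mem_eq_sum_image {α : Type*} {f : Lat d → α} (hf : Function.Injective f)
    (S : Finset (Lat d)) {W : Set α} (hW : ∀ y, y ∈ W ↔ ∃ x, x ∈ S ∧ f x = y) (g : α → ℝ) :
    ∑ᶠ y ∈ W, g y = ∑ x ∈ S, g (f x) := by
  have : W = f '' (S : Set (Lat d)) := by
    ext y
    rw [hW, Set.mem_image]
    rfl
  rw [this, finsum_mem_image hf.injOn, finsum_mem_coe_finset]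

lemma l2Norm_sq_inner (g : Pt d → ℝ) :
    l2Norm (meshSize N) (innerMesh d N) g ^ 2
      = meshSize N ^ d * ∑ x ∈ box d N, g (toPt (meshSize N) x) ^ 2 := by
  have h0 := meshSize_pos N
  have e : meshIntegral (meshSize N) (innerMesh d N) (fun x => g x * g x)
      = meshSize N ^ d * ∑ x ∈ box d N, g (toPt (meshSize N) x) ^ 2 := by
    unfold meshIntegral
    rw [finsum_mem_eq_sum_image (toPt_injective h0.ne') (box d N)
      (fun y => by rw [innerMesh_eq]; rfl)]
    simp only [sq]
  rw [l2Norm, e, Real.sq_sqrt]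
  exact mul_nonneg (pow_nonneg h0.le d) (Finset.sum_nonneg fun _ _ => sq_nonneg _)

lemma transfer_l2 (hβ : ∀ y ∈ ccube d, P.β y = -ψ y) :
    l2Norm (meshSize N) (innerMesh d N) (fun x => Real.exp (s * phi lam ψ x) * u x) ^ 2
      = meshSize N ^ d * ∑ x ∈ box d N, (P.wt lam (meshSize N) s x * latFun N u x) ^ 2 := by
  rw [l2Norm_sq_inner]
  congr 1
  refine Finset.sum_congr rfl fun x hx => ?_
  rw [phi_eq P hβ (meshSize N) (s := s) (inCube_box N x (Or.inl hx)), latFun_of_mem u hx]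
  rfl

lemma transfer_gradient (hβ : ∀ y ∈ ccube d, P.β y = -ψ y) (hu : ∀ x ∈ boundaryMesh d N, u x = 0)
    (k : Fin d) :
    meshIntegral (meshSize N) (dualMesh (meshSize N) k (innerMesh d N))
        (fun x => Real.exp (2 * s * phi lam ψ x) * |diffOp (meshSize N) k u x| ^ 2)
      = meshSize N ^ d * ∑ x ∈ fatten (box d N),
        P.we lam (meshSize N) s k x * fd (meshSize N) k (latFun N u) x ^ 2 := by
  classical
  unfold meshIntegral
  congr 1
  rw [finsum_mem_eq_sum_image (mid_injective (meshSize_pos N).ne' k)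
    ((fatten (box d N)).filter fun x => x ∈ box d N ∨ x + ev k ∈ box d N)]
  · rw [Finset.sum_filter]
    refine Finset.sum_congr rfl fun x _ => ?_
    split_ifs with hx
    · rw [diffOp_mid hu k hx, sq_abs, phi_eq P hβ (meshSize N) (s := s) (mid_mem_ccube k hx)]
      rfl
    · rw [fd_latFun_eq_zero u k hx]; ring
  · intro y
    rw [mem_dualMesh_inner]
    refine exists_congr fun x => and_congr_left fun _ => ?_
    rw [Finset.mem_filter]
    refine ⟨fun hx => ⟨?_, hx⟩, fun hx => hx.2⟩
    rcases hx with hx | hx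
    · exact subset_fatten _ hx
    · exact mem_fatten hx fun i => (abs_ev_le k i).trans (by norm_num)

lemma transfer_flux (hσ : ∀ k, ∀ y ∈ ccube d, P.σ k y = σ k y)
    (hu : ∀ x ∈ boundaryMesh d N, u x = 0)
    (k : Fin d) {x : Lat d} (hx : x ∈ box d N ∨ x + ev k ∈ box d N) :
    σ k (mid (meshSize N) k x) * diffOp (meshSize N) k u (mid (meshSize N) k x)
      = P.A k (lp lam (meshSize N) s x) * fd (meshSize N) k (latFun N u) x := by
  rw [diffOp_mid hu k hx, ← hσ k _ (mid_mem_ccube k hx)]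
  rfl

lemma transfer_laplacian (hσ : ∀ k, ∀ y ∈ ccube d, P.σ k y = σ k y)
    (hu : ∀ x ∈ boundaryMesh d N, u x = 0)
    {x : Lat d} (hx : x ∈ box d N) :
    discreteLaplacian (meshSize N) σ u (toPt (meshSize N) x)
      = latLap (meshSize N) (fun k x => P.A k (lp lam (meshSize N) s x)) (latFun N u) x := by
  unfold discreteLaplacian latLap
  refine Finset.sum_congr rfl fun k _ => ?_
  rw [diffOp, shiftPos_toPt, shiftNeg_toPt, transfer_flux P hσ hu (lam := lam) (s := s) k
    (Or.inl hx), transfer_flux P hσ hu (lam := lam) (s := s) k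
    (Or.inr (by rwa [sub_add_cancel]))]

lemma transfer_source (hβ : ∀ y ∈ ccube d, P.β y = -ψ y) (hσ : ∀ k, ∀ y ∈ ccube d, P.σ k y = σ k y)
    (hu : ∀ x ∈ boundaryMesh d N, u x = 0) :
    l2Norm (meshSize N) (innerMesh d N) (fun x => Real.exp (s * phi lam ψ x) *
        (-discreteLaplacian (meshSize N) σ u x + q x * u x)) ^ 2
      = meshSize N ^ d * P.latSource lam (meshSize N) s (box d N)
        (fun x => q (toPt (meshSize N) x)) (latFun N u) := by
  rw [l2Norm_sq_inner]
  congr 1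
  refine Finset.sum_congr rfl fun x hx => ?_
  rw [transfer_laplacian P hσ hu (lam := lam) (s := s) hx,
    phi_eq P hβ (meshSize N) (s := s) (inCube_box N x (Or.inl hx)), latFun_of_mem u hx]
  rfl

/-- At a point of `∂_k` exactly one of the two edges in direction `k` touches the box. It carries
the trace, and the sign of the normal disappears in the square. At the remaining points outside the
box both differences vanish, so `bdens` adds nothing. -/
lemma transfer_boundary (hβ : ∀ y ∈ ccube d, P.β y = -ψ y) (hσ : ∀ k, ∀ y ∈ ccube d, P.σ k y = σ k y)
    (hu : ∀ x ∈ boundaryMesh d N, u x = 0)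
    (k : Fin d) :
    boundaryIntegral (meshSize N) (dirBoundary (meshSize N) k (innerMesh d N))
        (fun x => traceOp (meshSize N) k (innerMesh d N)
            (fun y => Real.exp (2 * s * phi lam ψ y)) x *
          |normalDeriv (meshSize N) σ (innerMesh d N) u x| ^ 2)
      = meshSize N ^ (d - 1) * ∑ x ∈ fatten (box d N) \ box d N,
        P.bdens lam (meshSize N) s k (latFun N u) x := by
  classical
  unfold boundaryIntegral
  congr 1
  rw [finsum_mem_eq_sum_image (toPt_injective (meshSize_pos N).ne')
    ((fatten (box d N) \ box d N).filter fun x => x + ev k ∈ box d N ∨ x - ev k ∈ box d N)]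
  · rw [Finset.sum_filter]
    refine Finset.sum_congr rfl fun x hxm => ?_
    have hx := (Finset.mem_sdiff.1 hxm).2
    unfold Phase.bdens
    split_ifs with hx'
    · rw [normalDeriv_eq σ u hx hx']
      rcases hx' with h1 | h1
      · have h2 := not_both hx h1
        have e : fd (meshSize N) k (latFun N u) (x - ev k) = 0 :=
          fd_latFun_eq_zero u k (by rw [sub_add_cancel]; tauto)
        have hn := normal_low hx h1
        have ht : ∀ f : Pt d → ℝ, traceOp (meshSize N) k (innerMesh d N) f (toPt (meshSize N) x)
            = f (mid (meshSize N) k x) := fun f => by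
          unfold traceOp
          rw [hn, if_neg (by norm_num), if_pos rfl, shiftPos_toPt]
        rw [ht, ht, hn, e, sq_abs, transfer_flux P hσ hu (lam := lam) (s := s) k (Or.inr h1),
          phi_eq P hβ (meshSize N) (s := s) (mid_mem_ccube k (Or.inr h1))]
        change P.we lam (meshSize N) s k x * _ = _
        ring
      · have h2 : x + ev k ∉ box d N := fun h => not_both hx h h1
        have e : fd (meshSize N) k (latFun N u) x = 0 :=
          fd_latFun_eq_zero u k (by tauto)
        have hn := normal_high hx h1
        have ht : ∀ f : Pt d → ℝ, traceOp (meshSize N) k (innerMesh d N) f (toPt (meshSize N) x)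
            = f (mid (meshSize N) k (x - ev k)) := fun f => by
          unfold traceOp
          rw [hn, if_pos rfl, shiftNeg_toPt]
        rw [ht, ht, hn, e, sq_abs, transfer_flux P hσ hu (lam := lam) (s := s) k (Or.inl h1),
          phi_eq P hβ (meshSize N) (s := s) (mid_mem_ccube k (Or.inl h1))]
        change P.we lam (meshSize N) s k (x - ev k) * _ = _
        ring
    · push Not at hx'
      have e1 : fd (meshSize N) k (latFun N u) x = 0 := fd_latFun_eq_zero u k (by tauto)
      have e2 : fd (meshSize N) k (latFun N u) (x - ev k) = 0 :=
        fd_latFun_eq_zero u k (by rw [sub_add_cancel]; tauto)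
      rw [e1, e2]; ring
  · intro y
    rw [mem_dirBoundary_inner]
    refine exists_congr fun x => and_congr_left fun _ => ?_
    rw [Finset.mem_filter, Finset.mem_sdiff]
    refine ⟨fun hx => ⟨⟨?_, hx.1⟩, hx.2⟩, fun hx => ⟨hx.1.2, hx.2⟩⟩
    rcases hx.2 with h1 | h1
    · exact mem_fatten h1 fun i => (abs_ev_le k i).trans (by norm_num)
    · rw [sub_eq_add_neg] at h1
      exact mem_fatten h1 fun i => by
        rw [Pi.neg_apply, abs_neg]; exact (abs_ev_le k i).trans (by norm_num)

end Transfer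

end DiscreteCarleman

end

open DiscreteCarleman in
open scoped ContDiff in
theorem proposition3p6 (d : ℕ) (hd : 3 ≤ d)
    (U : Set (Pt d)) (hU : IsOpen U) (hcube : closure (cube d) ⊆ U)
    (σ : Fin d → Pt d → ℝ)
    (hσcont : ∀ k, ContinuousOn (σ k) U) (hσpos : ∀ k, ∀ x ∈ U, 0 < σ k x)
    (hσ : MeshAssumption σ)
    (ψ : Pt d → ℝ) (hψ : ContDiffOn ℝ ∞ ψ U)
    (hψgrad : ∀ x ∈ U, 0 < ‖gradient ψ x‖) (hψpos : ∀ x ∈ U, 0 < ψ x) :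
    ∃ lam₀ : ℝ, 1 ≤ lam₀ ∧ ∀ lam : ℝ, lam₀ ≤ lam →
      ∃ s₀ h₀ ε₀ : ℝ, 1 ≤ s₀ ∧ 0 < h₀ ∧ h₀ < 1 ∧ 0 < ε₀ ∧
        ∀ M : ℝ, ∃ C : ℝ, 0 < C ∧
          ∀ (N : ℕ) (h : ℝ), h = meshSize N → h ≤ h₀ →
          ∀ q : Pt d → ℝ, linftyNorm (innerMesh d N) q ≤ M →
          ∀ s : ℝ, s₀ ≤ s → s * h ≤ ε₀ →
          ∀ u : Pt d → ℝ, (∀ x ∈ boundaryMesh d N, u x = 0) →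
            s ^ 3 * l2Norm h (innerMesh d N) (fun x => Real.exp (s * phi lam ψ x) * u x) ^ 2
              + s * ∑ k, meshIntegral h (dualMesh h k (innerMesh d N))
                  (fun x => Real.exp (2 * s * phi lam ψ x) * |diffOp h k u x| ^ 2)
            ≤ C * (l2Norm h (innerMesh d N) (fun x => Real.exp (s * phi lam ψ x) *
                    (-discreteLaplacian h σ u x + q x * u x)) ^ 2
              + s * ∑ k, boundaryIntegral h (dirBoundary h k (innerMesh d N))
                  (fun x => traceOp h k (innerMesh d N)
                      (fun y => Real.exp (2 * s * phi lam ψ y)) x *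
                    |normalDeriv h σ (innerMesh d N) u x| ^ 2)) := by
  obtain ⟨P, a₀, g₀, H, hβ0, hβ, hPσ⟩ :=
    exists_phase hU hcube hσcont hσpos hσ.2.1 hψ hψgrad hψpos
  -- The marching direction of the layer argument is arbitrary; the first coordinate is taken.
  obtain ⟨lam₀, hlam₀, hmain⟩ := P.lattice_carleman_potential H hβ0 ⟨0, by omega⟩
  refine ⟨lam₀, hlam₀, fun lam hlam => ?_⟩
  obtain ⟨s₀, ε₀, hs₀, hε₀, hest⟩ := hmain lam hlam
  -- The value `1 / 2` is arbitrary: `s ≥ 1` and `sh ≤ ε₀` already control `h`, and coarse meshes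
  -- are covered by the constant.
  refine ⟨s₀, 1 / 2, ε₀, hs₀, by norm_num, by norm_num, hε₀, fun M => ?_⟩
  obtain ⟨C, hC, hestM⟩ := hest |M| (abs_nonneg M)
  refine ⟨C, hC, fun N h hh _ q hq s hs hsh u hu => ?_⟩
  subst hh
  have hqL : ∀ x ∈ box d N, |q (toPt (meshSize N) x)| ≤ |M| := fun x hx =>
    (abs_le_linftyNorm (innerMesh_finite d N) q (toPt_mem_inner.2 hx)).trans
      (hq.trans (le_abs_self M))
  have key := hestM N s (fun x => q (toPt (meshSize N) x)) (latFun N u) hs hsh hqL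
    fun x hx => latFun_of_notMem u hx
  have h0 := meshSize_pos N
  have key' := mul_le_mul_of_nonneg_left key (pow_nonneg h0.le d)
  rw [transfer_l2 P hβ, transfer_source P hβ hPσ hu]
  simp only [transfer_gradient P hβ hu, transfer_boundary P hβ hPσ hu, ← Finset.mul_sum]
  have hd1 : meshSize N ^ d = meshSize N ^ (d - 1) * meshSize N := by
    rw [← pow_succ]; congr 1; omega
  -- The factor `s/h` of the lattice boundary term turns the volume scaling `h^d` into `s h^(d-1)`.
  have eb : meshSize N ^ d * P.latBdry lam (meshSize N) s (box d N) (latFun N u)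
      = s * (meshSize N ^ (d - 1) * ∑ k, ∑ x ∈ fatten (box d N) \ box d N,
        P.bdens lam (meshSize N) s k (latFun N u) x) := by
    unfold Phase.latBdry
    rw [hd1]
    field_simp
  rw [← eb]
  unfold Phase.latLhs at key'
  linarith
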